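/- **Setting.** Let $\ell\in\mathbb N$. Let $\mathbb C\langle X_1,\dots,X_\ell\rangle^c$ be the set of expressions $P=p(X_1,\dots,X_\ell)+\sum_{j=1}^\ell\vartheta_j(X_j)$ with $p$ a non-commutative polynomial with complex coefficients and $\vartheta_j:\mathbb R\to\mathbb R$ smooth ($C^\infty$); such an expression is evaluated at $\ell$-tuples of $N\times N$ Hermitian matrices by substitution and functional calculus. It is self-adjoint if $p=p^*$, where $(zX_{i_1}\cdots X_{i_k})^*=\bar z X_{i_k}\cdots X_{i_1}$. Let $\mathcal A$ be the unital $*$-algebra of matrix-valued functions of tuples of Hermitian matrices (of all sizes) generated by the $X_j$ and the $\vartheta(X_j)$, $\vartheta$ smooth. The cyclic derivative $\mathcal D_i$ is linear on polynomials with $$\mathcal D_i(X_{i_1}\cdots X_{i_k})=\sum_{p:\,i_p=i}X_{i_{p+1}}\cdots X_{i_k}X_{i_1}\cdots X_{i_{p-1}},\qquad \mathcal D_i\vartheta(X_j)=1_{i=j}\vartheta'(X_j),$$ and the non-commutative derivative $\partial_i$ is linear with $$\partial_i(X_{i_1}\cdots X_{i_k})=\sum_{p:\,i_p=i}X_{i_1}\cdots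 X_{i_{p-1}}\otimes X_{i_{p+1}}\cdots X_{i_k},\qquad \partial_i\vartheta(X_j)=1_{i=j}\frac{\vartheta(x)-\vartheta(y)}{x-y},$$ the last quotient being read as $\vartheta'(x)$ for $x=y$. For $\eta\ge0$, $A\in\mathbb R$ and a partition $I=(I_1,\dots,I_d)$ of $\{1,\dots,\ell\}$, a self-adjoint $V\in\mathbb C\langle X_1,\dots,X_\ell\rangle^c$ is *$(\eta,A,I)$-trapping* if for all integers $k,N\ge1$ and all $\ell$-tuples $X$ of $N\times N$ Hermitian matrices, with $Z_j=\sum_{i\in I_j}X_i^2$, $$\operatorname{Tr}\Big(\sum_{j=1}^dZ_j^k\sum_{i\in I_j}\tfrac12\big(X_i\,\mathcal D_iV+\mathcal D_iV\,X_i\big)\Big)\ \ge\ \operatorname{Tr}\Big(\eta\sum_{j=1}^dZ_j^{k+1}-A\Big(1+\sum_{j=1}^dZ_j^k\Big)\Big).$$ Let $\mathbb Q^N_V$ be the law on $\ell$-tuples of $N\times N$ Hermitian matrices with density $\frac1{Z^N_V}e^{-N\operatorname{Tr}V(X)}$ with respect to Lebesgue measure. A *non-commutative law* is a linear form $\tau$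 on $\mathcal A$ with $\tau(aa^*)\ge0$, $\tau(1)=1$, $\tau(ab)=\tau(ba)$. Let $X^N$, $N\ge1$, be random tuples with laws $\mathbb Q^N_V$, defined on one probability space (with an arbitrary joint law), and let $\hat\mu^N(a)=\frac1N\operatorname{Tr}a(X^N)$. A *limit point* of $\hat\mu^N$ is a non-commutative law that is a cluster point of $(\hat\mu^N)_N$ for pointwise convergence on $\mathbb C\langle X_1,\dots,X_\ell\rangle^c$. **Theorem.** 1. Let $V$ be $(\eta,A,I)$-trapping with $\eta>0$, $A\in\mathbb R$. Then almost surely every limit point $\tau_V$ of $\hat\mu^N$ under $\mathbb Q^N_V$ satisfies the Dyson–Schwinger equations: for every $P\in\mathbb C\langle X_1,\dots,X_\ell\rangle^c$ and every $i\in\{1,\dots,\ell\}$, $$\tau_V(\mathcal D_iV\cdot P)=\tau_V\otimes\tau_V(\partial_iP).$$ Here, for each $i$, there is a compactly supported probability measure $m_i$ on $\mathbb R$, the distribution of $X_i$ under $\tau_V$, with $\tau_V(f(X_i))=\int f\,dm_i$ for all smooth $f:\mathbb R\to\mathbb R$, and $\tau_V\otimes\tau_V$ of the difference quotient of $\vartheta_i$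 means its integral against $m_i\otimes m_i$. 2. Let $U,W\in\mathbb C\langle X_1,\dots,X_\ell\rangle^c$, $\eta>0$ and $A\in\mathbb R$. There is a finite constant $B$, depending only on $U,W,\eta,A$, such that, for every partition $I$ for which $U$ and $W$ are both $(\eta,A,I)$-trapping and for all large enough $\beta>0$, almost surely every limit point $\tau_{V_\beta}$ of $\hat\mu^N$ under $\mathbb Q^N_{V_\beta}$, $V_\beta=\beta U+W$, satisfies for all $i\in\{1,\dots,\ell\}$ and all integers $k\ge0$ $$\tau_{V_\beta}\big(|\mathcal D_iU|^{2k}\big)\le\Big(\frac B\beta\Big)^k,\qquad |\mathcal D_iU|^{2k}=\big((\mathcal D_iU)^*\mathcal D_iU\big)^k .$$ -/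

import Mathlib

open MeasureTheory ProbabilityTheory Filter

noncomputable section

namespace MatrixModel

open scoped ContDiff TensorProduct ENNReal

/-! ### Hermitian matrices and functions of them -/

/-- The real vector space of `N × N` Hermitian complex matrices. -/
abbrev Herm (N : ℕ) : Type := selfAdjoint (Matrix (Fin N) (Fin N) ℂ)

instance (N : ℕ) : MeasurableSpace (Herm N) := borel _

instance (N : ℕ) : BorelSpace (Herm N) := ⟨rfl⟩

/-- `ℓ`-tuples of `N × N` Hermitian matrices. -/
abbrev HermTuple (ℓ N : ℕ) : Type := Fin ℓ → Herm N

/-- All matrix-valued functions of an `ℓ`-tuple of Hermitian matrices, of every size `N`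
simultaneously, as a `*`-algebra under pointwise operations. -/
abbrev MatFun (ℓ : ℕ) : Type :=
  (N : ℕ) → HermTuple ℓ N → Matrix (Fin N) (Fin N) ℂ

/-- The coordinate function `X_j`. -/
def coordFun {ℓ : ℕ} (j : Fin ℓ) : MatFun ℓ := fun _ X => X j

/-- The function `ϑ(X_j)`, through the functional calculus of Hermitian matrices. -/
def smoothFun {ℓ : ℕ} (j : Fin ℓ) (ϑ : ℝ → ℝ) : MatFun ℓ :=
  fun N X => cfc ϑ (X j : Matrix (Fin N) (Fin N) ℂ)

/-- The generators `X_j` and `ϑ(X_j)`, with `ϑ : ℝ → ℝ` smooth. -/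
def generators (ℓ : ℕ) : Set (MatFun ℓ) :=
  {f | (∃ j, f = coordFun j) ∨ ∃ j, ∃ ϑ : ℝ → ℝ, ContDiff ℝ ∞ ϑ ∧ f = smoothFun j ϑ}

/-- The unital `*`-algebra generated by the `X_j` and the smooth functions `ϑ(X_j)`. -/
def smoothAlg (ℓ : ℕ) : StarSubalgebra ℂ (MatFun ℓ) := StarAlgebra.adjoin ℂ (generators ℓ)

/-- `X_j` as an element of `smoothAlg`. -/
def coord {ℓ : ℕ} (j : Fin ℓ) : smoothAlg ℓ :=
  ⟨coordFun j, StarAlgebra.subset_adjoin ℂ _ (Or.inl ⟨j, rfl⟩)⟩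

/-- `ϑ(X_j)` as an element of `smoothAlg`. -/
def smoothElt {ℓ : ℕ} (j : Fin ℓ) (ϑ : ℝ → ℝ) (h : ContDiff ℝ ∞ ϑ) : smoothAlg ℓ :=
  ⟨smoothFun j ϑ, StarAlgebra.subset_adjoin ℂ _ (Or.inr ⟨j, ϑ, h, rfl⟩)⟩

/-- The value `a(X)` of `a ∈ smoothAlg` at a tuple of Hermitian matrices. -/
def eval {ℓ N : ℕ} (a : smoothAlg ℓ) (X : HermTuple ℓ N) : Matrix (Fin N) (Fin N) ℂ :=
  (a : MatFun ℓ) N X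

/-! ### Non-commutative polynomials and their derivatives -/

/-- Non-commutative polynomials `ℂ⟨X_1, …, X_ℓ⟩`: finite linear combinations of words. -/
abbrev NCPoly (ℓ : ℕ) : Type := MonoidAlgebra ℂ (FreeMonoid (Fin ℓ))

/-- The monomial `X_{i_1} ⋯ X_{i_k}` of the list `[i_1, …, i_k]`. -/
def monomial {ℓ : ℕ} (w : List (Fin ℓ)) : NCPoly ℓ :=
  MonoidAlgebra.of ℂ (FreeMonoid (Fin ℓ)) (FreeMonoid.ofList w)

/-- The linear map on polynomials with prescribed values on monomials. -/
def onMonomials {ℓ : ℕ} {M : Type} [AddCommMonoid M] [Module ℂ M]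
    (f : List (Fin ℓ) → M) : NCPoly ℓ →ₗ[ℂ] M :=
  Finsupp.linearCombination ℂ (fun w : FreeMonoid (Fin ℓ) => f (FreeMonoid.toList w)) ∘ₗ
    (MonoidAlgebra.coeffLinearEquiv ℂ).toLinearMap

/-- A polynomial as an element of `smoothAlg` (substitution of the coordinates). -/
def polyElt {ℓ : ℕ} : NCPoly ℓ →ₐ[ℂ] smoothAlg ℓ :=
  MonoidAlgebra.lift ℂ _ _ (FreeMonoid.lift coord)

/-- The cyclic derivative on polynomials:
`X_{i_1} ⋯ X_{i_k} ↦ ∑_{p : i_p = i} X_{i_{p+1}} ⋯ X_{i_k} X_{i_1} ⋯ X_{i_{p-1}}`. -/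
def polyCyclicDeriv {ℓ : ℕ} (i : Fin ℓ) : NCPoly ℓ →ₗ[ℂ] NCPoly ℓ :=
  onMonomials fun w => ∑ p : Fin w.length,
    if w.get p = i then monomial (w.drop (p + 1) ++ w.take p) else 0

/-- The non-commutative derivative on polynomials:
`X_{i_1} ⋯ X_{i_k} ↦ ∑_{p : i_p = i} X_{i_1} ⋯ X_{i_{p-1}} ⊗ X_{i_{p+1}} ⋯ X_{i_k}`. -/
def polyDeriv {ℓ : ℕ} (i : Fin ℓ) : NCPoly ℓ →ₗ[ℂ] NCPoly ℓ ⊗[ℂ] NCPoly ℓ :=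
  onMonomials fun w => ∑ p : Fin w.length,
    if w.get p = i then monomial (w.take p) ⊗ₜ[ℂ] monomial (w.drop (p + 1)) else 0

/-! ### Potentials and test functions: polynomial plus smooth functions of one variable -/

/-- Expressions `p(X_1, …, X_ℓ) + ∑_j ϑ_j(X_j)` with `p` a non-commutative polynomial and
`ϑ_j : ℝ → ℝ` smooth. -/
structure NCSmooth (ℓ : ℕ) where
  poly : NCPoly ℓ
  smooth : Fin ℓ → ℝ → ℝ
  contDiff : ∀ j, ContDiff ℝ ∞ (smooth j)

namespace NCSmooth

variable {ℓ : ℕ}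

/-- The element `p + ∑_j ϑ_j(X_j)` of `smoothAlg`. -/
def elt (P : NCSmooth ℓ) : smoothAlg ℓ :=
  polyElt P.poly + ∑ j, smoothElt j (P.smooth j) (P.contDiff j)

instance : Add (NCSmooth ℓ) :=
  ⟨fun P Q => ⟨P.poly + Q.poly, fun j x => P.smooth j x + Q.smooth j x,
    fun j => (P.contDiff j).add (Q.contDiff j)⟩⟩

instance : SMul ℝ (NCSmooth ℓ) :=
  ⟨fun β P => ⟨(β : ℂ) • P.poly, fun j x => β * P.smooth j x,
    fun j => contDiff_const.mul (P.contDiff j)⟩⟩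

/-- `P = P*`; as the `ϑ_j` are real-valued, this concerns the polynomial part only, where
`(z X_{i_1} ⋯ X_{i_k})* = conj z X_{i_k} ⋯ X_{i_1}`. -/
def IsSelfAdj (P : NCSmooth ℓ) : Prop :=
  ∀ w : FreeMonoid (Fin ℓ), P.poly.coeff w.reverse = star (P.poly.coeff w)

/-- The cyclic derivative `𝒟_i (p + ∑_j ϑ_j(X_j)) = 𝒟_i p + ϑ_i'(X_i)`. -/
def cyclicDeriv (i : Fin ℓ) (P : NCSmooth ℓ) : smoothAlg ℓ :=
  polyElt (polyCyclicDeriv i P.poly) +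
    smoothElt i (deriv (P.smooth i)) ((contDiff_infty_iff_deriv.mp (P.contDiff i)).2)

end NCSmooth

/-! ### Trapping potentials -/

/-- `Z_S = ∑_{i ∈ S} X_i²`. -/
def blockSq {ℓ N : ℕ} (X : HermTuple ℓ N) (S : Finset (Fin ℓ)) : Matrix (Fin N) (Fin N) ℂ :=
  ∑ i ∈ S, (X i : Matrix (Fin N) (Fin N) ℂ) ^ 2

/-- `X_i . 𝒟_i V = (X_i 𝒟_i V + 𝒟_i V X_i) / 2`, evaluated at `X`. -/
def symDeriv {ℓ N : ℕ} (V : NCSmooth ℓ) (X : HermTuple ℓ N) (i : Fin ℓ) :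
    Matrix (Fin N) (Fin N) ℂ :=
  (1 / 2 : ℂ) • ((X i : Matrix (Fin N) (Fin N) ℂ) * eval (V.cyclicDeriv i) X +
    eval (V.cyclicDeriv i) X * (X i : Matrix (Fin N) (Fin N) ℂ))

/-- `V` is a self-adjoint `(η, A, I)`-trapping potential. Both traces are real. -/
def IsTrapping {ℓ : ℕ} (η A : ℝ) (I : Finpartition (Finset.univ : Finset (Fin ℓ)))
    (V : NCSmooth ℓ) : Prop :=
  0 ≤ η ∧ V.IsSelfAdj ∧
  ∀ k N : ℕ, 1 ≤ k → 1 ≤ N → ∀ X : HermTuple ℓ N,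
    ((η : ℂ) • ∑ S ∈ I.parts, blockSq X S ^ (k + 1) -
        (A : ℂ) • (1 + ∑ S ∈ I.parts, blockSq X S ^ k)).trace.re ≤
      (∑ S ∈ I.parts, blockSq X S ^ k * ∑ i ∈ S, symDeriv V X i).trace.re

/-! ### The matrix model -/

/-- The Hermitian matrix with diagonal entries `y a a`, and with entry `y a b + i y b a` in
position `(a, b)` for `a < b`. -/
def hermOfCoords {N : ℕ} (y : Fin N → Fin N → ℝ) : Herm N :=
  ⟨Matrix.of fun a b =>
      if a = b then (y a a : ℂ)
      else if a < b then (y a b : ℂ) + Complex.I * y b a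
      else (y b a : ℂ) - Complex.I * y a b, by
    rw [selfAdjoint.mem_iff]
    ext a b
    simp only [Matrix.star_apply, Matrix.of_apply]
    rcases lt_trichotomy a b with h | h | h
    · simp [h.ne, h.ne', h, h.not_gt]
    · subst h; simp
    · simp [h.ne, h.ne', h, h.not_gt, sub_eq_add_neg]⟩

/-- Lebesgue measure `dX` on `ℓ`-tuples of Hermitian matrices, the product of the Lebesgue
measures of the diagonal entries and of the real and imaginary parts of the entries above the
diagonal. -/
def lebesgueHerm (ℓ N : ℕ) : Measure (HermTuple ℓ N) :=
  (volume : Measure (Fin ℓ → Fin N → Fin N → ℝ)).map fun y j => hermOfCoords (y j)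

/-- The density `exp (-N Tr V(X))`; the trace is real when `V` is self-adjoint. -/
def gibbsWeight {ℓ N : ℕ} (V : NCSmooth ℓ) (X : HermTuple ℓ N) : ℝ≥0∞ :=
  ENNReal.ofReal (Real.exp (-(N * (eval V.elt X).trace.re)))

/-- The partition function `Z^N_V`. -/
def partitionFun {ℓ : ℕ} (N : ℕ) (V : NCSmooth ℓ) : ℝ≥0∞ :=
  ∫⁻ X, gibbsWeight V X ∂lebesgueHerm ℓ N

/-- The law `ℚ^N_V` of the matrix model. -/
def gibbs {ℓ : ℕ} (N : ℕ) (V : NCSmooth ℓ) : Measure (HermTuple ℓ N) :=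
  (partitionFun N V)⁻¹ • (lebesgueHerm ℓ N).withDensity (gibbsWeight V)

/-! ### Non-commutative laws and limit points -/

/-- Non-commutative laws: linear forms on `smoothAlg` that are positive, unital and tracial. -/
structure IsNCLaw {ℓ : ℕ} (τ : smoothAlg ℓ →ₗ[ℂ] ℂ) : Prop where
  pos : ∀ a, ∃ r : ℝ, 0 ≤ r ∧ τ (a * star a) = r
  one : τ 1 = 1
  trace : ∀ a b, τ (a * b) = τ (b * a)

/-- The empirical distribution `a ↦ (1/N) Tr a(X)` of a tuple of `N × N` matrices. -/
def empirical {ℓ N : ℕ} (X : HermTuple ℓ N) (a : smoothAlg ℓ) : ℂ :=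
  (1 / N : ℂ) * (eval a X).trace

/-- `τ` is a non-commutative law that is a limit point, as `N → ∞`, of the empirical
distributions of the tuples `X N`, for the weak topology of pointwise convergence on the
functions `P = p + ∑_j ϑ_j(X_j)`. -/
def IsLimitPoint {ℓ : ℕ} (X : (N : ℕ) → HermTuple ℓ N) (τ : smoothAlg ℓ →ₗ[ℂ] ℂ) : Prop :=
  IsNCLaw τ ∧
  MapClusterPt (fun P : NCSmooth ℓ => τ P.elt) atTop
    (fun (N : ℕ) (P : NCSmooth ℓ) => empirical (X N) P.elt)

/-! ### Dyson–Schwinger equations -/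

/-- `m` is the (compactly supported) distribution of `X_i` under `τ`:
`τ(f(X_i)) = ∫ f dm` for all smooth `f`. -/
structure IsSpectralDistribution {ℓ : ℕ} (τ : smoothAlg ℓ →ₗ[ℂ] ℂ) (i : Fin ℓ)
    (m : Measure ℝ) : Prop where
  prob : IsProbabilityMeasure m
  bounded : ∃ R : ℝ, ∀ᵐ x ∂m, |x| ≤ R
  integral_eq : ∀ (f : ℝ → ℝ) (hf : ContDiff ℝ ∞ f), τ (smoothElt i f hf) = (∫ x, f x ∂m : ℝ)

/-- `τ ⊗ τ` on `ℂ⟨X⟩ ⊗ ℂ⟨X⟩`. -/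
def tensorSq {ℓ : ℕ} (τ : smoothAlg ℓ →ₗ[ℂ] ℂ) : NCPoly ℓ ⊗[ℂ] NCPoly ℓ →ₗ[ℂ] ℂ :=
  LinearMap.mul' ℂ ℂ ∘ₗ
    TensorProduct.map (τ ∘ₗ polyElt.toLinearMap) (τ ∘ₗ polyElt.toLinearMap)

/-- `(τ ⊗ τ)(∂_i P)` for `P = p + ∑_j ϑ_j(X_j)`, where `m` is the distribution of `X_i` under
`τ`. The derivative `∂_i ϑ_j(X_j)` is zero for `j ≠ i`, and for `j = i` it is the difference
quotient `(ϑ_i(x) - ϑ_i(y)) / (x - y)`, with value `ϑ_i'(x)` on the diagonal (`dslope`), which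
is integrated against `m ⊗ m`. -/
def tensorDeriv {ℓ : ℕ} (τ : smoothAlg ℓ →ₗ[ℂ] ℂ) (i : Fin ℓ) (m : Measure ℝ)
    (P : NCSmooth ℓ) : ℂ :=
  tensorSq τ (polyDeriv i P.poly) +
    (∫ z : ℝ × ℝ, dslope (P.smooth i) z.1 z.2 ∂(m.prod m) : ℝ)

/-- The Dyson–Schwinger equations `τ(𝒟_i V · P) = τ ⊗ τ(∂_i P)`, for all `i` and all `P`. -/
def DysonSchwinger {ℓ : ℕ} (V : NCSmooth ℓ) (τ : smoothAlg ℓ →ₗ[ℂ] ℂ) : Prop :=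
  ∀ i : Fin ℓ, ∃ m : Measure ℝ, IsSpectralDistribution τ i m ∧
    ∀ P : NCSmooth ℓ, τ (V.cyclicDeriv i * P.elt) = tensorDeriv τ i m P

end MatrixModel

end

open MatrixModel

noncomputable section

namespace MatrixModel

open scoped ContDiff TensorProduct ENNReal Topology CompactlySupported Matrix.Norms.L2Operator

variable {ℓ N : ℕ}

/-! Dyson–Schwinger equations. Let d be the defect of the equation for the empirical law of N × N
matrices. Integration by parts against exp(-N Tr V) in the i-th matrix (`integration_by_parts`)
turns the integral of d times a test function into an integral of the gradient of that test
function. Choose the test function conj(d) f², where f is a smooth cutoff to tuples of bounded norm.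
Normalized traces have gradients of size 1/N, and the gradient of the cutoff costs only a term
linear in N |d| f, which is absorbed by the quadratic left side. Hence E(|d|² f²) = O(1/N²) on every
ball (`integral_defect_sq_le`). These bounds are summable, so d f tends to 0 almost surely for every
radius and every monomial, whatever the joint law. No tail estimate for the matrices is made.

The cutoff is removed by the strength of the topology: a limit point is tested against smooth
functions of arbitrary growth. Along an ultrafilter that realizes it, the largest eigenvalue
therefore grows more slowly than any rate fixed in advance (`tendsto_of_cutoff`). The same principle
gives each coordinate a compactly supported distribution (`exists_forall_eq_zero`,
`exists_isSpectralDistribution`).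

Smooth functions are handled by polynomials close to them in C¹ on compact intervals. The estimates
must therefore depend on the C¹ size of a polynomial and not on its degree. This is achieved by
writing the derivative of p(X_i) through difference quotients of p and using the mean value
inequality (`norm_trace_sandwich_polyX_le` for matrices, `norm_tensorSq_polyDeriv_polyX_le` for
laws).

Concentration. The Dyson–Schwinger equation tested against X_i Z^k, combined with the trapping
inequalities for U and W, yields a recursion of Catalan type for the moments of the blocks Z. The
factor β + 1 divides out, so the coordinates are bounded by a constant that depends only on η, A and
ℓ (`exists_isBoundedBy_coord`). Next, the force is β 𝒟_i U plus a bounded term. Testing with an odd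
power 2k - 1 of 𝒟_i U bounds β τ(|𝒟_i U|^{2k}) by products of lower moments, apart from one factor
that is absorbed. Induction then gives 𝒟_i U the norm O(β^{-1/2}) (`geometric_bound_of_quartic`,
`isBoundedBy_of_dysonSchwinger`). In this argument 𝒟_i U is replaced by a polynomial at distance
1/β, so that β times the error stays bounded. -/

/-! ### Evaluation of the smooth algebra -/

/-- Evaluation at a tuple of matrices, as a `*`-algebra homomorphism. -/
def evalHom (X : HermTuple ℓ N) : smoothAlg ℓ →⋆ₐ[ℂ] Matrix (Fin N) (Fin N) ℂ where
  toFun a := eval a X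
  map_one' := rfl
  map_mul' _ _ := rfl
  map_zero' := rfl
  map_add' _ _ := rfl
  commutes' _ := rfl
  map_star' _ := rfl

theorem evalHom_apply (X : HermTuple ℓ N) (a : smoothAlg ℓ) : evalHom X a = eval a X := rfl

theorem eval_add (a b : smoothAlg ℓ) (X : HermTuple ℓ N) :
    eval (a + b) X = eval a X + eval b X := rfl

theorem eval_mul (a b : smoothAlg ℓ) (X : HermTuple ℓ N) :
    eval (a * b) X = eval a X * eval b X := rfl

theorem eval_smul (z : ℂ) (a : smoothAlg ℓ) (X : HermTuple ℓ N) :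
    eval (z • a) X = z • eval a X := rfl

theorem eval_star (a : smoothAlg ℓ) (X : HermTuple ℓ N) :
    eval (star a) X = star (eval a X) := rfl

theorem eval_pow (a : smoothAlg ℓ) (n : ℕ) (X : HermTuple ℓ N) :
    eval (a ^ n) X = eval a X ^ n := map_pow (evalHom X) a n

theorem eval_sum {ι : Type*} (s : Finset ι) (a : ι → smoothAlg ℓ) (X : HermTuple ℓ N) :
    eval (∑ i ∈ s, a i) X = ∑ i ∈ s, eval (a i) X := map_sum (evalHom X) a s

theorem ext_eval {a b : smoothAlg ℓ} (h : ∀ (N : ℕ) (X : HermTuple ℓ N), eval a X = eval b X) :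
    a = b :=
  Subtype.ext (funext fun N => funext fun X => h N X)

theorem eval_coord (j : Fin ℓ) (X : HermTuple ℓ N) :
    eval (coord j) X = (X j : Matrix (Fin N) (Fin N) ℂ) := rfl

theorem eval_smoothElt (j : Fin ℓ) (f : ℝ → ℝ) (hf : ContDiff ℝ ∞ f) (X : HermTuple ℓ N) :
    eval (smoothElt j f hf) X = cfc f (X j : Matrix (Fin N) (Fin N) ℂ) := rfl

theorem isSelfAdjoint_coe (A : Herm N) : IsSelfAdjoint (A : Matrix (Fin N) (Fin N) ℂ) := A.2

/-! ### Functions of one coordinate -/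

theorem smoothElt_mul (j : Fin ℓ) {f g : ℝ → ℝ} (hf : ContDiff ℝ ∞ f) (hg : ContDiff ℝ ∞ g) :
    smoothElt j (fun x => f x * g x) (hf.mul hg) = smoothElt j f hf * smoothElt j g hg :=
  ext_eval fun N X => by
    simp only [eval_mul, eval_smoothElt]
    exact cfc_mul f g _ hf.continuous.continuousOn hg.continuous.continuousOn

theorem smoothElt_add (j : Fin ℓ) {f g : ℝ → ℝ} (hf : ContDiff ℝ ∞ f) (hg : ContDiff ℝ ∞ g) :
    smoothElt j (fun x => f x + g x) (hf.add hg) = smoothElt j f hf + smoothElt j g hg :=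
  ext_eval fun N X => by
    simp only [eval_add, eval_smoothElt]
    exact cfc_add _ f g hf.continuous.continuousOn hg.continuous.continuousOn

theorem smoothElt_sub (j : Fin ℓ) {f g : ℝ → ℝ} (hf : ContDiff ℝ ∞ f) (hg : ContDiff ℝ ∞ g) :
    smoothElt j (fun x => f x - g x) (hf.sub hg) = smoothElt j f hf - smoothElt j g hg :=
  ext_eval fun N X => by
    change _ = cfc f (X j : Matrix (Fin N) (Fin N) ℂ) - cfc g (X j : Matrix (Fin N) (Fin N) ℂ)
    rw [eval_smoothElt]
    exact cfc_sub f g _ hf.continuous.continuousOn hg.continuous.continuousOn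

theorem smoothElt_const_mul (j : Fin ℓ) (r : ℝ) {f : ℝ → ℝ} (hf : ContDiff ℝ ∞ f) :
    smoothElt j (fun x => r * f x) (contDiff_const.mul hf) = (r : ℂ) • smoothElt j f hf :=
  ext_eval fun N X => by
    simp only [eval_smul, eval_smoothElt]
    rw [cfc_const_mul r f _ hf.continuous.continuousOn]
    ext a b; simp

theorem smoothElt_const (j : Fin ℓ) (r : ℝ) :
    smoothElt j (fun _ => r) contDiff_const = (r : ℂ) • (1 : smoothAlg ℓ) :=
  ext_eval fun N X => by
    rw [eval_smul, eval_smoothElt, cfc_const r _ (isSelfAdjoint_coe _)]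
    change _ = (r : ℂ) • (1 : Matrix (Fin N) (Fin N) ℂ)
    rw [Algebra.algebraMap_eq_smul_one]
    ext a b; simp

theorem smoothElt_id (j : Fin ℓ) : smoothElt j (fun x => x) contDiff_id = coord j :=
  ext_eval fun N X => by
    rw [eval_smoothElt, eval_coord]
    exact cfc_id' ℝ _ (isSelfAdjoint_coe _)

theorem star_smoothElt (j : Fin ℓ) {f : ℝ → ℝ} (hf : ContDiff ℝ ∞ f) :
    star (smoothElt j f hf) = smoothElt j f hf :=
  ext_eval fun N X => by
    rw [eval_star, eval_smoothElt]
    exact cfc_predicate (R := ℝ) f (X j : Matrix (Fin N) (Fin N) ℂ)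

theorem star_coord (j : Fin ℓ) : star (coord j) = coord j :=
  ext_eval fun N X => by rw [eval_star, eval_coord]; exact (X j).2

theorem smoothElt_pow (j : Fin ℓ) {f : ℝ → ℝ} (hf : ContDiff ℝ ∞ f) (n : ℕ) :
    smoothElt j (fun x => f x ^ n) (hf.pow n) = smoothElt j f hf ^ n :=
  ext_eval fun N X => by
    rw [eval_pow]
    exact cfc_pow f n _ hf.continuous.continuousOn (isSelfAdjoint_coe _)

/-! ### Monomials -/

@[simp]
theorem onMonomials_monomial {M : Type} [AddCommMonoid M] [Module ℂ M]
    (f : List (Fin ℓ) → M) (w : List (Fin ℓ)) : onMonomials f (monomial w) = f w := by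
  simp [onMonomials, monomial, MonoidAlgebra.of]

theorem monomial_append (u v : List (Fin ℓ)) : monomial (u ++ v) = monomial u * monomial v := by
  simp only [monomial, FreeMonoid.ofList_append, map_mul]

theorem monomial_nil : monomial ([] : List (Fin ℓ)) = 1 := by
  simp only [monomial, FreeMonoid.ofList_nil, map_one]

theorem monomial_cons (j : Fin ℓ) (w : List (Fin ℓ)) :
    monomial (j :: w) = monomial [j] * monomial w := monomial_append [j] w

/-- A property of polynomials that holds for monomials and is preserved by linear combinations
holds for all polynomials. -/
theorem NCPoly.induction {p : NCPoly ℓ → Prop} (P : NCPoly ℓ) (hm : ∀ w, p (monomial w))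
    (ha : ∀ P Q, p P → p Q → p (P + Q)) (hs : ∀ (z : ℂ) P, p P → p (z • P)) : p P := by
  refine MonoidAlgebra.induction_linear P ?_ (fun P Q => ha P Q) fun w z => ?_
  · simpa using hs 0 _ (hm [])
  · have := hs z _ (hm w.toList)
    simpa [monomial, MonoidAlgebra.of] using this

theorem NCPoly.linearMap_ext {M : Type*} [AddCommMonoid M] [Module ℂ M]
    {f g : NCPoly ℓ →ₗ[ℂ] M} (h : ∀ w, f (monomial w) = g (monomial w)) : f = g := by
  refine LinearMap.ext fun P => ?_
  induction P using NCPoly.induction with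
  | hm w => exact h w
  | ha P Q hP hQ => rw [map_add, map_add, hP, hQ]
  | hs z P hP => rw [map_smul, map_smul, hP]

@[simp]
theorem polyElt_monomial_nil : polyElt (monomial ([] : List (Fin ℓ))) = 1 := by
  rw [monomial_nil, map_one]

@[simp]
theorem polyElt_monomial_singleton (j : Fin ℓ) : polyElt (monomial [j]) = coord j := by
  simp [polyElt, monomial]

theorem polyElt_monomial_cons (j : Fin ℓ) (w : List (Fin ℓ)) :
    polyElt (monomial (j :: w)) = coord j * polyElt (monomial w) := by
  rw [monomial_cons, map_mul, polyElt_monomial_singleton]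

/-! ### Derivatives of polynomials -/

theorem polyDeriv_monomial_nil (i : Fin ℓ) : polyDeriv i (monomial []) = 0 := by
  simp [polyDeriv]

theorem polyDeriv_monomial_cons (i j : Fin ℓ) (w : List (Fin ℓ)) :
    polyDeriv i (monomial (j :: w)) =
      (if j = i then 1 ⊗ₜ[ℂ] monomial w else 0) +
        (monomial [j] ⊗ₜ[ℂ] 1) * polyDeriv i (monomial w) := by
  simp only [polyDeriv, onMonomials_monomial]
  change ∑ p : Fin (w.length + 1), _ = _
  rw [Fin.sum_univ_succ, Finset.mul_sum]
  congr 1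
  refine Finset.sum_congr rfl fun p _ => ?_
  simp only [List.get_eq_getElem, Fin.val_succ, List.getElem_cons_succ, List.take_succ_cons,
    List.drop_succ_cons, mul_ite, mul_zero, Algebra.TensorProduct.tmul_mul_tmul, one_mul]
  rw [monomial_cons]

theorem polyDeriv_mul (i : Fin ℓ) (P Q : NCPoly ℓ) :
    polyDeriv i (P * Q) = polyDeriv i P * (1 ⊗ₜ[ℂ] Q) + (P ⊗ₜ[ℂ] 1) * polyDeriv i Q := by
  induction P using NCPoly.induction with
  | ha P P' h h' =>
    rw [add_mul, map_add, map_add, h, h', TensorProduct.add_tmul, add_mul, add_mul]; abel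
  | hs z P h =>
    rw [smul_mul_assoc, map_smul, map_smul, h, ← TensorProduct.smul_tmul', smul_mul_assoc,
      smul_mul_assoc, smul_add]
  | hm u =>
    induction Q using NCPoly.induction with
    | ha Q Q' h h' =>
      rw [mul_add, map_add, map_add, h, h', TensorProduct.tmul_add, mul_add, mul_add]; abel
    | hs z Q h =>
      rw [mul_smul_comm, map_smul, map_smul, h, TensorProduct.tmul_smul, mul_smul_comm,
        mul_smul_comm, smul_add]
    | hm v =>
      rw [← monomial_append]
      induction u with
      | nil =>
        rw [List.nil_append, polyDeriv_monomial_nil, zero_mul, zero_add, monomial_nil,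
          ← Algebra.TensorProduct.one_def, one_mul]
      | cons j u ih =>
        rw [List.cons_append, polyDeriv_monomial_cons, ih, polyDeriv_monomial_cons,
          monomial_append, monomial_cons j u, add_mul, mul_add, ← mul_assoc, ← mul_assoc,
          Algebra.TensorProduct.tmul_mul_tmul, mul_one, add_assoc]
        congr 1
        split_ifs <;> simp

theorem polyDeriv_one (i : Fin ℓ) : polyDeriv i (1 : NCPoly ℓ) = 0 := by
  rw [← monomial_nil, polyDeriv_monomial_nil]

theorem polyDeriv_X (i j : Fin ℓ) :
    polyDeriv i (monomial [j]) = if j = i then 1 else 0 := by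
  rw [polyDeriv_monomial_cons, polyDeriv_monomial_nil, mul_zero, add_zero, monomial_nil,
    Algebra.TensorProduct.one_def]

theorem polyDeriv_pow (i : Fin ℓ) (P : NCPoly ℓ) (n : ℕ) :
    polyDeriv i (P ^ n) = ∑ ab ∈ Finset.range n,
      ((P ^ ab) ⊗ₜ[ℂ] 1) * polyDeriv i P * (1 ⊗ₜ[ℂ] (P ^ (n - 1 - ab))) := by
  induction n with
  | zero => simp [polyDeriv_one]
  | succ n ih =>
    rw [pow_succ', polyDeriv_mul, ih, Finset.sum_range_succ', Finset.mul_sum, add_comm]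
    congr 1
    · refine Finset.sum_congr rfl fun a ha => ?_
      rw [← mul_assoc, ← mul_assoc, Algebra.TensorProduct.tmul_mul_tmul, one_mul, ← pow_succ']
      rw [show n + 1 - 1 - (a + 1) = n - 1 - a by omega]
    · simp [← Algebra.TensorProduct.one_def]

/-- Cutting a word at a letter and exchanging the two halves is the flip of the tensor, followed by
multiplication. Facts on 𝒟_i thus follow from the Leibniz rule for ∂_i. -/
theorem polyCyclicDeriv_eq (i : Fin ℓ) (P : NCPoly ℓ) :
    polyCyclicDeriv i P =
      LinearMap.mul' ℂ (NCPoly ℓ) (TensorProduct.comm ℂ _ _ (polyDeriv i P)) := by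
  have : polyCyclicDeriv i = (LinearMap.mul' ℂ (NCPoly ℓ) ∘ₗ
      (TensorProduct.comm ℂ (NCPoly ℓ) (NCPoly ℓ)).toLinearMap) ∘ₗ polyDeriv i := by
    refine NCPoly.linearMap_ext fun w => ?_
    simp only [polyCyclicDeriv, polyDeriv, LinearMap.comp_apply, onMonomials_monomial, map_sum]
    refine Finset.sum_congr rfl fun p _ => ?_
    split_ifs
    · simp [monomial_append]
    · simp
  rw [this]; rfl

/-! ### Real polynomials of one coordinate -/

/-- The non-commutative polynomial `p(X_j)`, for a real polynomial `p`. -/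
def polyX (j : Fin ℓ) (p : Polynomial ℝ) : NCPoly ℓ :=
  Polynomial.aeval (monomial [j]) (p.map (algebraMap ℝ ℂ))

theorem contDiff_polynomial (p : Polynomial ℝ) : ContDiff ℝ ∞ fun x => p.eval x := by
  simpa using p.contDiff_aeval (𝕜 := ℝ) ∞

theorem polyElt_polyX (j : Fin ℓ) (p : Polynomial ℝ) :
    polyElt (polyX j p) = smoothElt j (fun x => p.eval x) (contDiff_polynomial p) := by
  refine ext_eval fun N X => ?_
  rw [polyX, ← Polynomial.aeval_algHom_apply, polyElt_monomial_singleton, eval_smoothElt,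
    ← evalHom_apply]
  change (evalHom X : smoothAlg ℓ →ₐ[ℂ] Matrix (Fin N) (Fin N) ℂ) _ = _
  rw [← Polynomial.aeval_algHom_apply, cfc_polynomial p _ (isSelfAdjoint_coe _),
    Polynomial.aeval_map_algebraMap]
  rfl

theorem polyX_add (j : Fin ℓ) (p q : Polynomial ℝ) : polyX j (p + q) = polyX j p + polyX j q := by
  simp [polyX]

theorem polyX_C_mul_X_pow (j : Fin ℓ) (n : ℕ) (c : ℝ) :
    polyX j (Polynomial.C c * Polynomial.X ^ n) = (c : ℂ) • monomial [j] ^ n := by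
  simp [polyX, Algebra.smul_def]

theorem eval_polyX (j : Fin ℓ) (p : Polynomial ℝ) (X : HermTuple ℓ N) :
    eval (polyElt (polyX j p)) X = cfc (fun x => p.eval x) (X j : Matrix (Fin N) (Fin N) ℂ) := by
  rw [polyElt_polyX]; rfl

instance instSecondCountableTopologyHerm (N : ℕ) : SecondCountableTopology (Herm N) := by
  have : SecondCountableTopology (Matrix (Fin N) (Fin N) ℂ) :=
    inferInstanceAs (SecondCountableTopology (Fin N → Fin N → ℂ))
  exact inferInstanceAs (SecondCountableTopology {x : Matrix (Fin N) (Fin N) ℂ // _})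

/-! ### Norm and trace estimates -/

/-- Only an inequality, so that the case N = 0, where the identity matrix vanishes, is included. -/
theorem norm_one_le (N : ℕ) : ‖(1 : Matrix (Fin N) (Fin N) ℂ)‖ ≤ 1 := by
  have h := CStarRing.norm_star_mul_self (x := (1 : Matrix (Fin N) (Fin N) ℂ))
  rw [star_one, one_mul] at h
  nlinarith [norm_nonneg (1 : Matrix (Fin N) (Fin N) ℂ)]

theorem norm_le_of_mem_spectrum {A : Matrix (Fin N) (Fin N) ℂ} {x : ℝ} (hx : x ∈ spectrum ℝ A) :
    |x| ≤ ‖A‖ := by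
  have := spectrum.norm_le_norm_mul_of_mem hx
  calc |x| ≤ ‖A‖ * ‖(1 : Matrix (Fin N) (Fin N) ℂ)‖ := this
    _ ≤ ‖A‖ * 1 := by gcongr; exact norm_one_le N
    _ = ‖A‖ := mul_one _

theorem norm_entry_le (A : Matrix (Fin N) (Fin N) ℂ) (a b : Fin N) : ‖A a b‖ ≤ ‖A‖ := by
  have h := Matrix.l2_opNorm_mulVec A (EuclideanSpace.single b (1 : ℂ))
  rw [PiLp.norm_single, norm_one, mul_one] at h
  refine le_trans ?_ h
  have h2 := PiLp.norm_apply_le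
    ((EuclideanSpace.equiv (Fin N) ℂ).symm (A.mulVec (EuclideanSpace.single b (1 : ℂ)).ofLp)) a
  refine le_trans (le_of_eq ?_) h2
  simp

theorem norm_trace_le (A : Matrix (Fin N) (Fin N) ℂ) : ‖A.trace‖ ≤ N * ‖A‖ := by
  calc ‖A.trace‖ ≤ ∑ a, ‖A a a‖ := norm_sum_le _ _
    _ ≤ ∑ _a : Fin N, ‖A‖ := Finset.sum_le_sum fun a _ => norm_entry_le A a a
    _ = N * ‖A‖ := by simp

theorem norm_cfc_le_of_abs_le {A : Herm N} {f : ℝ → ℝ} {R c : ℝ}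
    (hA : ‖(A : Matrix (Fin N) (Fin N) ℂ)‖ ≤ R) (hc : 0 ≤ c) (hf : ∀ x, |x| ≤ R → |f x| ≤ c) :
    ‖cfc f (A : Matrix (Fin N) (Fin N) ℂ)‖ ≤ c :=
  norm_cfc_le hc fun x hx => hf x ((norm_le_of_mem_spectrum hx).trans hA)

theorem norm_cfc_sub_le {A : Herm N} {f g : ℝ → ℝ} (hf : Continuous f) (hg : Continuous g)
    {R c : ℝ} (hA : ‖(A : Matrix (Fin N) (Fin N) ℂ)‖ ≤ R) (hc : 0 ≤ c)
    (h : ∀ x, |x| ≤ R → |f x - g x| ≤ c) :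
    ‖cfc f (A : Matrix (Fin N) (Fin N) ℂ) - cfc g (A : Matrix (Fin N) (Fin N) ℂ)‖ ≤ c := by
  rw [← cfc_sub f g _ hf.continuousOn hg.continuousOn]
  exact norm_cfc_le_of_abs_le hA hc h

theorem isHermitian_coe (A : Herm N) : (A : Matrix (Fin N) (Fin N) ℂ).IsHermitian := A.2

theorem trace_cfc (A : Herm N) (f : ℝ → ℝ) :
    (cfc f (A : Matrix (Fin N) (Fin N) ℂ)).trace =
      ((∑ a, f ((isHermitian_coe A).eigenvalues a) : ℝ) : ℂ) := by
  rw [Matrix.IsHermitian.cfc_eq (isHermitian_coe A),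
    Matrix.IsHermitian.cfc.eq_1, Unitary.conjStarAlgAut_apply, Matrix.trace_mul_cycle,
    Unitary.coe_star_mul_self, one_mul, Matrix.trace_diagonal]
  simp

theorem le_trace_cfc (A : Herm N) {f : ℝ → ℝ} (hf : ∀ x, 0 ≤ f x) {x : ℝ}
    (hx : x ∈ spectrum ℝ (A : Matrix (Fin N) (Fin N) ℂ)) :
    f x ≤ (cfc f (A : Matrix (Fin N) (Fin N) ℂ)).trace.re := by
  rw [trace_cfc, Complex.ofReal_re]
  rw [Matrix.IsHermitian.spectrum_real_eq_range_eigenvalues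
    (isHermitian_coe A)] at hx
  obtain ⟨a, rfl⟩ := hx
  exact Finset.single_le_sum
    (f := fun a => f ((isHermitian_coe A).eigenvalues a))
    (fun a _ => hf _) (Finset.mem_univ a)

theorem norm_le_of_spectrum {A : Herm N} {c : ℝ} (hc : 0 ≤ c)
    (h : ∀ x ∈ spectrum ℝ (A : Matrix (Fin N) (Fin N) ℂ), |x| ≤ c) :
    ‖(A : Matrix (Fin N) (Fin N) ℂ)‖ ≤ c := by
  rw [← cfc_id' ℝ (A : Matrix (Fin N) (Fin N) ℂ) (isSelfAdjoint_coe A)]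
  exact norm_cfc_le hc h

/-! ### Continuity -/

theorem continuous_coordFun (j : Fin ℓ) :
    Continuous fun X : HermTuple ℓ N => (X j : Matrix (Fin N) (Fin N) ℂ) := by
  fun_prop

theorem continuous_cfc {f : ℝ → ℝ} (hf : Continuous f) (j : Fin ℓ) :
    Continuous fun X : HermTuple ℓ N => cfc f (X j : Matrix (Fin N) (Fin N) ℂ) := by
  -- The margin 1 in the radius lets one ball contain the spectra of all matrices near X j.
  refine Continuous.cfc (s := fun X => Metric.closedBall 0
    (‖(X j : Matrix (Fin N) (Fin N) ℂ)‖ + 1)) f (continuous_coordFun j) ?_ ?_ ?_ ?_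
  · exact fun X => isCompact_closedBall _ _
  · intro X
    have h : ∀ᶠ Y : HermTuple ℓ N in 𝓝 X, ‖(Y j : Matrix (Fin N) (Fin N) ℂ)‖ <
        ‖(X j : Matrix (Fin N) (Fin N) ℂ)‖ + 1 :=
      (continuous_coordFun j).norm.continuousAt.eventually_lt continuousAt_const (by simp)
    filter_upwards [h] with Y hY x hx
    rw [mem_closedBall_zero_iff]
    exact (norm_le_of_mem_spectrum hx).trans hY.le
  · exact fun X => hf.continuousOn
  · exact fun X => (X j).2

theorem continuous_eval_polyElt (P : NCPoly ℓ) :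
    Continuous fun X : HermTuple ℓ N => eval (polyElt P) X := by
  induction P using NCPoly.induction with
  | ha P Q hP hQ => simp only [map_add, eval_add]; exact hP.add hQ
  | hs z P hP => simp only [map_smul, eval_smul]; exact hP.const_smul z
  | hm w =>
    induction w with
    | nil => rw [polyElt_monomial_nil]; exact continuous_const
    | cons j w ih =>
      simp only [polyElt_monomial_cons, eval_mul, eval_coord]
      exact (continuous_coordFun j).mul ih

theorem continuous_eval_cyclicDeriv (V : NCSmooth ℓ) (i : Fin ℓ) :
    Continuous fun X : HermTuple ℓ N => eval (V.cyclicDeriv i) X := by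
  simp only [NCSmooth.cyclicDeriv, eval_add, eval_smoothElt]
  exact (continuous_eval_polyElt _).add
    (continuous_cfc (contDiff_infty_iff_deriv.mp (V.contDiff i)).2.continuous i)

/-! ### Gradients of functions of Hermitian tuples -/

/-- The tuple with `H` in position `i` and `0` elsewhere. -/
abbrev dir (i : Fin ℓ) (H : Herm N) : HermTuple ℓ N := Pi.single i H

/-- `Γ` is the gradient of the continuous function `G` with respect to the `i`-th matrix, for the
pairing `(Γ, H) ↦ Tr (Γ H)`, and it is continuous. -/
structure HasGrad (i : Fin ℓ) (G : HermTuple ℓ N → ℂ)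
    (Γ : HermTuple ℓ N → Matrix (Fin N) (Fin N) ℂ) : Prop where
  cont : Continuous G
  cont_grad : Continuous Γ
  deriv : ∀ X (H : Herm N), HasDerivAt (fun t : ℝ => G (X + t • dir i H))
    (Γ X * (H : Matrix (Fin N) (Fin N) ℂ)).trace 0

/-- Moving the base point along the line turns derivatives at time 0, known at all base points, into
derivatives at all times. -/
theorem hasDerivAt_add_smul {E F : Type*} [AddCommGroup E] [Module ℝ E]
    [NormedAddCommGroup F] [NormedSpace ℝ F] {G : E → F} {G' : E → F} {H : E}
    (h : ∀ X, HasDerivAt (fun t : ℝ => G (X + t • H)) (G' X) 0) (X : E) (s : ℝ) :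
    HasDerivAt (fun t : ℝ => G (X + t • H)) (G' (X + s • H)) s := by
  have h1 : HasDerivAt (fun t : ℝ => G ((X + s • H) + t • H)) (G' (X + s • H)) (s - s) := by
    rw [sub_self]; exact h _
  have h2 := h1.comp_sub_const s s
  refine h2.congr_of_eventuallyEq (Eventually.of_forall fun t => ?_)
  change G _ = G _
  congr 1
  rw [add_assoc, ← add_smul, add_sub_cancel]

namespace HasGrad

variable {i : Fin ℓ} {G G₁ G₂ : HermTuple ℓ N → ℂ}
  {Γ Γ₁ Γ₂ : HermTuple ℓ N → Matrix (Fin N) (Fin N) ℂ}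

theorem const (z : ℂ) : HasGrad i (fun _ : HermTuple ℓ N => z) fun _ => 0 where
  cont := continuous_const
  cont_grad := continuous_const
  deriv X H := by simpa using hasDerivAt_const (0 : ℝ) z

theorem add (h₁ : HasGrad i G₁ Γ₁) (h₂ : HasGrad i G₂ Γ₂) :
    HasGrad i (fun X => G₁ X + G₂ X) fun X => Γ₁ X + Γ₂ X where
  cont := h₁.cont.add h₂.cont
  cont_grad := h₁.cont_grad.add h₂.cont_grad
  deriv X H := by
    rw [add_mul, Matrix.trace_add]
    exact (h₁.deriv X H).add (h₂.deriv X H)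

theorem mul (h₁ : HasGrad i G₁ Γ₁) (h₂ : HasGrad i G₂ Γ₂) :
    HasGrad i (fun X => G₁ X * G₂ X) fun X => G₂ X • Γ₁ X + G₁ X • Γ₂ X where
  cont := h₁.cont.mul h₂.cont
  cont_grad := (h₂.cont.smul h₁.cont_grad).add (h₁.cont.smul h₂.cont_grad)
  deriv X H := by
    refine ((h₁.deriv X H).mul (h₂.deriv X H)).congr_deriv ?_
    simp [add_mul, Matrix.trace_add, mul_comm]

theorem const_mul (z : ℂ) (h : HasGrad i G Γ) :
    HasGrad i (fun X => z * G X) fun X => z • Γ X where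
  cont := continuous_const.mul h.cont
  cont_grad := h.cont_grad.const_smul z
  deriv X H := by
    rw [smul_mul_assoc, Matrix.trace_smul]
    exact (h.deriv X H).const_mul z

theorem sub (h₁ : HasGrad i G₁ Γ₁) (h₂ : HasGrad i G₂ Γ₂) :
    HasGrad i (fun X => G₁ X - G₂ X) fun X => Γ₁ X - Γ₂ X where
  cont := h₁.cont.sub h₂.cont
  cont_grad := h₁.cont_grad.sub h₂.cont_grad
  deriv X H := by
    rw [sub_mul, Matrix.trace_sub]
    exact (h₁.deriv X H).sub (h₂.deriv X H)

theorem sum {ι : Type*} {s : Finset ι} {G : ι → HermTuple ℓ N → ℂ}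
    {Γ : ι → HermTuple ℓ N → Matrix (Fin N) (Fin N) ℂ} (h : ∀ k ∈ s, HasGrad i (G k) (Γ k)) :
    HasGrad i (fun X => ∑ k ∈ s, G k X) fun X => ∑ k ∈ s, Γ k X where
  cont := continuous_finsetSum _ fun k hk => (h k hk).cont
  cont_grad := continuous_finsetSum _ fun k hk => (h k hk).cont_grad
  deriv X H := by
    rw [Finset.sum_mul, Matrix.trace_sum]
    exact HasDerivAt.fun_sum fun k hk => (h k hk).deriv X H

theorem star (h : HasGrad i G Γ) : HasGrad i (fun X => star (G X)) fun X => star (Γ X) where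
  cont := h.cont.star
  cont_grad := h.cont_grad.star
  deriv X H := by
    refine (h.deriv X H).star.congr_deriv ?_
    rw [← Matrix.trace_conjTranspose, Matrix.conjTranspose_mul, Matrix.trace_mul_comm]
    congr 2
    exact (isSelfAdjoint_coe H).star_eq

theorem comp_real {F : HermTuple ℓ N → ℝ} {ψ ψ' : ℝ → ℝ} (h : HasGrad i (fun X => (F X : ℂ)) Γ)
    (hψ : ∀ x, HasDerivAt ψ (ψ' x) x) (hψ' : Continuous ψ') :
    HasGrad i (fun X => (ψ (F X) : ℂ)) fun X => (ψ' (F X) : ℂ) • Γ X where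
  cont := by
    have h1 : Continuous F := by
      simpa [Function.comp_def] using Complex.continuous_re.comp h.cont
    have h2 : Continuous ψ := continuous_iff_continuousAt.mpr fun x => (hψ x).continuousAt
    exact Complex.continuous_ofReal.comp (h2.comp h1)
  cont_grad := by
    have h1 : Continuous F := by
      simpa [Function.comp_def] using Complex.continuous_re.comp h.cont
    exact (Complex.continuous_ofReal.comp (hψ'.comp h1)).smul h.cont_grad
  deriv X H := by
    have h0 := h.deriv X H
    have h1 : HasDerivAt (fun t : ℝ => F (X + t • dir i H))
        (Γ X * (H : Matrix (Fin N) (Fin N) ℂ)).trace.re 0 := by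
      have := Complex.reCLM.hasFDerivAt.comp_hasDerivAt (0 : ℝ) h0
      simpa [Function.comp_def] using this
    -- The function is real-valued, so its derivative equals its own real part and the real chain
    -- rule applies.
    have h2 := h0.unique h1.ofReal_comp
    have h3 : HasDerivAt (fun t : ℝ => ψ (F (X + t • dir i H))) _ 0 :=
      HasDerivAt.comp (0 : ℝ) (hψ _) h1
    refine h3.ofReal_comp.congr_deriv ?_
    rw [smul_mul_assoc, Matrix.trace_smul, h2]
    simp

theorem congr (h : HasGrad i G Γ) {G' : HermTuple ℓ N → ℂ}
    {Γ' : HermTuple ℓ N → Matrix (Fin N) (Fin N) ℂ} (hG : ∀ X, G' X = G X)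
    (hΓ : ∀ X, Γ' X = Γ X) : HasGrad i G' Γ' := by
  obtain rfl : G' = G := funext hG
  obtain rfl : Γ' = Γ := funext hΓ
  exact h

end HasGrad

/-! ### Derivatives of polynomials in matrices -/

/-- The linear map `(u ⊗ v) ↦ u(X) M v(X)`. -/
def sandwich (X : HermTuple ℓ N) (M : Matrix (Fin N) (Fin N) ℂ) :
    NCPoly ℓ ⊗[ℂ] NCPoly ℓ →ₗ[ℂ] Matrix (Fin N) (Fin N) ℂ :=
  TensorProduct.lift ((LinearMap.mul ℂ (Matrix (Fin N) (Fin N) ℂ)).compl₁₂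
    (LinearMap.mulRight ℂ M ∘ₗ (evalHom X).toAlgHom.toLinearMap ∘ₗ polyElt.toLinearMap)
    ((evalHom X).toAlgHom.toLinearMap ∘ₗ polyElt.toLinearMap))

@[simp]
theorem sandwich_tmul (X : HermTuple ℓ N) (M : Matrix (Fin N) (Fin N) ℂ) (u v : NCPoly ℓ) :
    sandwich X M (u ⊗ₜ v) = eval (polyElt u) X * M * eval (polyElt v) X := rfl

theorem sandwich_left_mul (X : HermTuple ℓ N) (M : Matrix (Fin N) (Fin N) ℂ) (u : NCPoly ℓ)
    (T : NCPoly ℓ ⊗[ℂ] NCPoly ℓ) :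
    sandwich X M ((u ⊗ₜ 1) * T) = eval (polyElt u) X * sandwich X M T := by
  induction T with
  | zero => simp
  | add a b ha hb => rw [mul_add, map_add, ha, hb, map_add, mul_add]
  | tmul a b => simp [eval_mul, mul_assoc]

theorem continuous_sandwich (M : Matrix (Fin N) (Fin N) ℂ) (T : NCPoly ℓ ⊗[ℂ] NCPoly ℓ) :
    Continuous fun X : HermTuple ℓ N => sandwich X M T := by
  induction T with
  | zero => simpa using continuous_const
  | add a b ha hb => simp only [map_add]; exact ha.add hb
  | tmul a b =>
    exact ((continuous_eval_polyElt a).mul continuous_const).mul (continuous_eval_polyElt b)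

/-- Cyclicity of the trace isolates the direction H at the cost of exchanging the two legs. This is
why gradients involve the flipped tensor. -/
theorem trace_sandwich_mul (X : HermTuple ℓ N) (H M : Matrix (Fin N) (Fin N) ℂ)
    (T : NCPoly ℓ ⊗[ℂ] NCPoly ℓ) :
    (sandwich X H T * M).trace = (sandwich X M (TensorProduct.comm ℂ _ _ T) * H).trace := by
  induction T with
  | zero => simp
  | add a b ha hb => simp [add_mul, ha, hb]
  | tmul a b =>
    simp only [TensorProduct.comm_tmul, sandwich_tmul]
    rw [Matrix.mul_assoc, Matrix.mul_assoc, Matrix.trace_mul_comm, ← Matrix.mul_assoc,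
      Matrix.mul_assoc _ M, Matrix.mul_assoc, Matrix.mul_assoc, Matrix.trace_mul_comm]
    simp only [Matrix.mul_assoc]

theorem hasDerivAt_eval_polyElt (i : Fin ℓ) (P : NCPoly ℓ) (X : HermTuple ℓ N) (H : Herm N) :
    HasDerivAt (fun t : ℝ => eval (polyElt P) (X + t • dir i H))
      (sandwich X H (polyDeriv i P)) 0 := by
  induction P using NCPoly.induction with
  | ha P Q hP hQ => simp only [map_add, eval_add]; exact hP.add hQ
  | hs z P hP => simp only [map_smul, eval_smul]; exact hP.const_smul z
  | hm w =>
    induction w with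
    | nil =>
      rw [polyDeriv_monomial_nil, map_zero, polyElt_monomial_nil]
      exact hasDerivAt_const _ _
    | cons j w ih =>
      have h1 : HasDerivAt (fun t : ℝ => ((X + t • dir i H) j : Matrix (Fin N) (Fin N) ℂ))
          (if j = i then (H : Matrix (Fin N) (Fin N) ℂ) else 0) 0 := by
        have h2 : HasDerivAt (fun t : ℝ => (X j : Matrix (Fin N) (Fin N) ℂ) +
            t • (if j = i then (H : Matrix (Fin N) (Fin N) ℂ) else 0))
            ((1 : ℝ) • (if j = i then (H : Matrix (Fin N) (Fin N) ℂ) else 0)) 0 :=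
          ((hasDerivAt_id (0 : ℝ)).smul_const _).const_add _
        rw [one_smul] at h2
        refine h2.congr_of_eventuallyEq (Eventually.of_forall fun t => ?_)
        by_cases hji : j = i
        · subst hji; simp
        · simp [hji]
      have h3 := h1.mul ih
      simp only [zero_smul, add_zero] at h3
      have h4 : sandwich X (H : Matrix (Fin N) (Fin N) ℂ) (polyDeriv i (monomial (j :: w))) =
          (if j = i then (H : Matrix (Fin N) (Fin N) ℂ) else 0) * eval (polyElt (monomial w)) X +
          (X j : Matrix (Fin N) (Fin N) ℂ) * sandwich X H (polyDeriv i (monomial w)) := by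
        rw [polyDeriv_monomial_cons, map_add, sandwich_left_mul, polyElt_monomial_singleton,
          eval_coord]
        congr 1
        split_ifs
        · rw [sandwich_tmul, map_one]
          change 1 * _ * _ = _
          rw [one_mul]
        · simp
      rw [h4]
      refine h3.congr_of_eventuallyEq (Eventually.of_forall fun t => ?_)
      simp only [polyElt_monomial_cons, eval_mul, eval_coord, Pi.mul_apply]

theorem hasGrad_trace_mul (i : Fin ℓ) (P : NCPoly ℓ) (M : Matrix (Fin N) (Fin N) ℂ) :
    HasGrad i (fun X => (eval (polyElt P) X * M).trace)
      fun X => sandwich X M (TensorProduct.comm ℂ _ _ (polyDeriv i P)) where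
  cont := ((continuous_eval_polyElt P).mul continuous_const).matrix_trace
  cont_grad := continuous_sandwich _ _
  deriv X H := by
    rw [← trace_sandwich_mul]
    have h := (hasDerivAt_eval_polyElt i P X H).mul_const M
    exact ((Matrix.traceLinearMap (Fin N) ℝ ℂ).toContinuousLinearMap.hasFDerivAt).comp_hasDerivAt
      (0 : ℝ) h

theorem sandwich_one (X : HermTuple ℓ N) (T : NCPoly ℓ ⊗[ℂ] NCPoly ℓ) :
    sandwich X 1 T = eval (polyElt (LinearMap.mul' ℂ _ T)) X := by
  induction T with
  | zero => rw [map_zero, map_zero, map_zero]; rfl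
  | add a b ha hb => rw [map_add, ha, hb, map_add, map_add, eval_add]
  | tmul a b => simp [eval_mul]

theorem hasGrad_trace (i : Fin ℓ) (P : NCPoly ℓ) :
    HasGrad i (fun X : HermTuple ℓ N => (eval (polyElt P) X).trace)
      fun X => eval (polyElt (polyCyclicDeriv i P)) X := by
  refine (hasGrad_trace_mul i P 1).congr (fun X => by rw [mul_one]) fun X => ?_
  rw [sandwich_one, polyCyclicDeriv_eq]

/-! ### Polynomial approximation with derivatives -/

theorem exists_polynomial_derivative_eq (p : Polynomial ℝ) :
    ∃ q : Polynomial ℝ, Polynomial.derivative q = p := by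
  induction p using Polynomial.induction_on' with
  | add p q hp hq =>
    obtain ⟨a, rfl⟩ := hp
    obtain ⟨b, rfl⟩ := hq
    exact ⟨a + b, map_add _ _ _⟩
  | monomial n c =>
    refine ⟨Polynomial.monomial (n + 1) (c / (n + 1)), ?_⟩
    rw [Polynomial.derivative_monomial]
    have : (n : ℝ) + 1 ≠ 0 := by positivity
    simp [this]

/-- A `C¹` function can be approximated on compact intervals by polynomials, together with its
derivative. -/
theorem exists_polynomial_near_deriv {f : ℝ → ℝ} (hf : ContDiff ℝ 1 f) (R : ℝ) {ε : ℝ}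
    (hε : 0 < ε) : ∃ p : Polynomial ℝ, ∀ x, |x| ≤ R →
      |p.eval x - f x| ≤ ε ∧ |p.derivative.eval x - deriv f x| ≤ ε := by
  obtain ⟨hd, hc⟩ := contDiff_one_iff_deriv.mp hf
  -- The interval [-S, S] contains 0 even if R is negative, and S ≥ 1 gives ε / S ≤ ε.
  set S := |R| + 1 with hS
  have hS1 : 1 ≤ S := by simp [hS]
  obtain ⟨p₀, hp₀⟩ := exists_polynomial_near_of_continuousOn (-S) S (deriv f) hc.continuousOn
    (ε / S) (by positivity)
  obtain ⟨q, rfl⟩ := exists_polynomial_derivative_eq p₀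
  -- The constant of integration makes the polynomial agree with f at 0. The error in the
  -- derivative, integrated over a length at most S, then bounds the error in the value.
  refine ⟨q + Polynomial.C (f 0 - q.eval 0), fun x hx => ?_⟩
  have hxS : x ∈ Set.Icc (-S) S := by
    have := abs_le.mp (hx.trans ((le_abs_self R).trans (by linarith : |R| ≤ S)))
    exact ⟨this.1, this.2⟩
  have h1 : ∀ y ∈ Set.Icc (-S) S, HasDerivWithinAt (fun y => q.eval y - f y)
      (q.derivative.eval y - deriv f y) (Set.Icc (-S) S) y := fun y _ =>
    ((q.hasDerivAt y).sub (hd y).hasDerivAt).hasDerivWithinAt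
  have h2 := Convex.norm_image_sub_le_of_norm_hasDerivWithin_le h1
    (fun y hy => (hp₀ y hy).le) (convex_Icc (-S) S)
    (show (0 : ℝ) ∈ Set.Icc (-S) S from ⟨by linarith, by linarith⟩) hxS
  constructor
  · have h3 : |q.eval x - f x - (q.eval 0 - f 0)| ≤ ε := by
      refine h2.trans ?_
      rw [sub_zero]
      calc ε / S * ‖x‖ ≤ ε / S * S := by
            gcongr
            exact abs_le.mpr hxS
        _ = ε := by field_simp
    rw [Polynomial.eval_add, Polynomial.eval_C]
    convert h3 using 2
    ring
  · have : ε / S ≤ ε := div_le_self hε.le hS1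
    simpa using (hp₀ x hxS).le.trans this

/-! ### The trace of a function of one matrix -/

theorem polyDeriv_polyX_of_ne {i j : Fin ℓ} (h : j ≠ i) (p : Polynomial ℝ) :
    polyDeriv i (polyX j p) = 0 := by
  induction p using Polynomial.induction_on' with
  | add p q hp hq => rw [polyX_add, map_add, hp, hq, add_zero]
  | monomial n c =>
    rw [← Polynomial.C_mul_X_pow_eq_monomial, polyX_C_mul_X_pow, map_smul, polyDeriv_pow,
      polyDeriv_X, if_neg h]
    simp

theorem polyCyclicDeriv_polyX (i : Fin ℓ) (p : Polynomial ℝ) :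
    polyCyclicDeriv i (polyX i p) = polyX i p.derivative := by
  induction p using Polynomial.induction_on' with
  | add p q hp hq => rw [polyX_add, map_add, hp, hq, map_add, polyX_add]
  | monomial n c =>
    rw [Polynomial.derivative_monomial, ← Polynomial.C_mul_X_pow_eq_monomial,
      ← Polynomial.C_mul_X_pow_eq_monomial, polyX_C_mul_X_pow, polyX_C_mul_X_pow, map_smul,
      polyCyclicDeriv_eq, polyDeriv_pow, polyDeriv_X, if_pos rfl, map_sum, map_sum]
    have : ∀ a ∈ Finset.range n, LinearMap.mul' ℂ (NCPoly ℓ) (TensorProduct.comm ℂ _ _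
        (((monomial [i] ^ a) ⊗ₜ[ℂ] 1) * 1 * (1 ⊗ₜ[ℂ] (monomial [i] ^ (n - 1 - a))))) =
        monomial [i] ^ (n - 1) := by
      intro a ha
      have := Finset.mem_range.mp ha
      rw [mul_one, Algebra.TensorProduct.tmul_mul_tmul, one_mul, mul_one, TensorProduct.comm_tmul,
        LinearMap.mul'_apply, ← pow_add]
      congr 1
      omega
    rw [Finset.sum_congr rfl this, Finset.sum_const, Finset.card_range]
    push_cast
    rw [mul_smul, ← Nat.cast_smul_eq_nsmul ℂ]

theorem dir_same (X : HermTuple ℓ N) (i : Fin ℓ) (H : Herm N) (t : ℝ) :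
    (X + t • dir i H) i = X i + t • H := by
  simp

theorem dir_of_ne (X : HermTuple ℓ N) {i j : Fin ℓ} (h : j ≠ i) (H : Herm N) (t : ℝ) :
    (X + t • dir i H) j = X j := by
  simp [h]

/-- For polynomials this is the formula for the cyclic derivative. It extends to C¹ functions
because derivatives of C¹ polynomial approximations converge uniformly along the line; no
perturbation theory of eigenvalues is involved. -/
theorem hasGrad_trace_cfc (i j : Fin ℓ) {f : ℝ → ℝ} (hf : ContDiff ℝ 1 f) :
    HasGrad i (fun X : HermTuple ℓ N => (cfc f (X j : Matrix (Fin N) (Fin N) ℂ)).trace)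
      fun X => if j = i then cfc (deriv f) (X j : Matrix (Fin N) (Fin N) ℂ) else 0 := by
  obtain ⟨hd, hc⟩ := contDiff_one_iff_deriv.mp hf
  refine ⟨(continuous_cfc hf.continuous j).matrix_trace, ?_, fun X H => ?_⟩
  · split_ifs
    · exact continuous_cfc hc j
    · exact continuous_const
  by_cases hji : j = i
  swap
  · simp only [if_neg hji, zero_mul, Matrix.trace_zero, dir_of_ne X hji]
    exact hasDerivAt_const _ _
  subst hji
  simp only [if_true]
  -- Bounds the norms of all matrices X j + t H with |t| < 1, so one interval of approximation
  -- serves the whole segment.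
  set R := ‖(X j : Matrix (Fin N) (Fin N) ℂ)‖ + ‖(H : Matrix (Fin N) (Fin N) ℂ)‖ with hR
  have hnorm : ∀ t ∈ Set.Ioo (-1 : ℝ) 1,
      ‖((X + t • dir j H) j : Matrix (Fin N) (Fin N) ℂ)‖ ≤ R := by
    intro t ht
    rw [dir_same]
    refine (norm_add_le (X j : Matrix (Fin N) (Fin N) ℂ)
      (t • (H : Matrix (Fin N) (Fin N) ℂ))).trans ?_
    rw [norm_smul]
    have : ‖t‖ ≤ 1 := abs_le.mpr ⟨ht.1.le, ht.2.le⟩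
    nlinarith [norm_nonneg (H : Matrix (Fin N) (Fin N) ℂ)]
  choose p hp using fun n : ℕ => exists_polynomial_near_deriv hf R (ε := 1 / ((n : ℝ) + 1))
    (by positivity)
  have hlim : Tendsto (fun n : ℕ => 1 / ((n : ℝ) + 1)) atTop (𝓝 0) :=
    tendsto_one_div_add_atTop_nhds_zero_nat
  have key := hasDerivAt_of_tendstoUniformlyOn (l := atTop) (s := Set.Ioo (-1 : ℝ) 1) (x := 0)
    (f := fun n t => (eval (polyElt (polyX j (p n))) (X + t • dir j H)).trace)
    (f' := fun n t => (eval (polyElt (polyCyclicDeriv j (polyX j (p n)))) (X + t • dir j H) *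
      (H : Matrix (Fin N) (Fin N) ℂ)).trace)
    (g := fun t => (cfc f ((X + t • dir j H) j : Matrix (Fin N) (Fin N) ℂ)).trace)
    (g' := fun t => (cfc (deriv f) ((X + t • dir j H) j : Matrix (Fin N) (Fin N) ℂ) *
      (H : Matrix (Fin N) (Fin N) ℂ)).trace) isOpen_Ioo ?_ ?_ ?_ (by simp)
  · simpa using key
  · rw [Metric.tendstoUniformlyOn_iff]
    intro ε hε
    have h1 : Tendsto (fun n : ℕ => N * (1 / ((n : ℝ) + 1) * ‖(H : Matrix (Fin N) (Fin N) ℂ)‖))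
        atTop (𝓝 0) := by
      simpa using (hlim.mul_const ‖(H : Matrix (Fin N) (Fin N) ℂ)‖).const_mul (N : ℝ)
    filter_upwards [h1.eventually_lt_const hε] with n hn t ht
    refine lt_of_le_of_lt ?_ hn
    rw [dist_eq_norm, ← Matrix.trace_sub, ← sub_mul, polyCyclicDeriv_polyX, eval_polyX]
    refine (norm_trace_le _).trans ?_
    gcongr
    refine (norm_mul_le _ _).trans ?_
    gcongr
    exact norm_cfc_sub_le hc (Polynomial.continuous _) (hnorm t ht) (by positivity)
      fun x hx => by rw [abs_sub_comm]; exact (hp n x hx).2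
  · exact Eventually.of_forall fun n t _ =>
      hasDerivAt_add_smul (G := fun Y => (eval (polyElt (polyX j (p n))) Y).trace)
        (G' := fun Y => (eval (polyElt (polyCyclicDeriv j (polyX j (p n)))) Y *
          (H : Matrix (Fin N) (Fin N) ℂ)).trace) (H := dir j H)
        (fun Y => (hasGrad_trace j (polyX j (p n))).deriv Y H) X t
  · intro t ht
    rw [tendsto_iff_norm_sub_tendsto_zero]
    have h1 : Tendsto (fun n : ℕ => N * (1 / ((n : ℝ) + 1))) atTop (𝓝 0) := by
      simpa using hlim.const_mul (N : ℝ)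
    refine squeeze_zero (fun _ => norm_nonneg _) (fun n => ?_) h1
    rw [← Matrix.trace_sub, eval_polyX]
    refine (norm_trace_le _).trans ?_
    gcongr
    exact norm_cfc_sub_le (Polynomial.continuous _) hf.continuous (hnorm t ht) (by positivity)
      fun x hx => (hp n x hx).1

/-! ### The gradient of the trace of the potential -/

theorem hasGrad_trace_elt (i : Fin ℓ) (V : NCSmooth ℓ) :
    HasGrad i (fun X : HermTuple ℓ N => (eval V.elt X).trace)
      fun X => eval (V.cyclicDeriv i) X := by
  refine ((hasGrad_trace i V.poly).add (HasGrad.sum (s := Finset.univ) fun j _ =>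
    hasGrad_trace_cfc i j ((V.contDiff j).of_le (by norm_num)))).congr (fun X => ?_) fun X => ?_
  · rw [NCSmooth.elt, eval_add, eval_sum, Matrix.trace_add, Matrix.trace_sum]
    rfl
  · rw [NCSmooth.cyclicDeriv, eval_add, eval_smoothElt]
    congr 1
    simp

/-! ### Self-adjointness of potentials and of their cyclic derivatives -/

/-- The involution `(z X_{i_1} ⋯ X_{i_k})* = conj z X_{i_k} ⋯ X_{i_1}`. -/
def revStar (P : NCPoly ℓ) : NCPoly ℓ :=
  .ofCoeff ((P.coeff.mapRange star (star_zero ℂ)).mapDomain FreeMonoid.reverse)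

theorem revStar_add (P Q : NCPoly ℓ) : revStar (P + Q) = revStar P + revStar Q := by
  simp only [revStar, MonoidAlgebra.coeff_add]
  rw [Finsupp.mapRange_add (fun a b => star_add a b), Finsupp.mapDomain_add,
    MonoidAlgebra.ofCoeff_add]

theorem revStar_smul_monomial (z : ℂ) (w : List (Fin ℓ)) :
    revStar (z • monomial w) = star z • monomial w.reverse := by
  simp only [revStar, monomial, MonoidAlgebra.of_apply, MonoidAlgebra.smul_single', mul_one,
    MonoidAlgebra.coeff_single, Finsupp.mapRange_single, Finsupp.mapDomain_single,
    MonoidAlgebra.ofCoeff_single]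
  rfl

theorem star_polyElt_monomial (w : List (Fin ℓ)) :
    star (polyElt (monomial w)) = polyElt (monomial w.reverse) := by
  induction w with
  | nil => simp
  | cons j w ih =>
    rw [polyElt_monomial_cons, star_mul, ih, List.reverse_cons, monomial_append, map_mul,
      star_coord, polyElt_monomial_singleton]

theorem star_polyElt (P : NCPoly ℓ) : star (polyElt P) = polyElt (revStar P) := by
  refine MonoidAlgebra.induction_linear P ?_ (fun P Q hP hQ => ?_) fun w z => ?_
  · simp [revStar]
  · rw [map_add, star_add, hP, hQ, revStar_add, map_add]
  · have h : (MonoidAlgebra.single w z : NCPoly ℓ) = z • monomial w.toList := by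
      simp [monomial, MonoidAlgebra.of]
    rw [h, map_smul, star_smul, star_polyElt_monomial, revStar_smul_monomial, map_smul]

theorem NCSmooth.IsSelfAdj.revStar_poly {V : NCSmooth ℓ} (hV : V.IsSelfAdj) :
    revStar V.poly = V.poly := by
  refine MonoidAlgebra.coeff_injective (Finsupp.ext fun w => ?_)
  have hinj : Function.Injective (FreeMonoid.reverse : FreeMonoid (Fin ℓ) → FreeMonoid (Fin ℓ)) :=
    Function.LeftInverse.injective (g := FreeMonoid.reverse) fun _ => FreeMonoid.reverse_reverse
  have h := Finsupp.mapDomain_apply hinj (V.poly.coeff.mapRange star (star_zero ℂ)) w.reverse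
  rw [FreeMonoid.reverse_reverse] at h
  rw [revStar, MonoidAlgebra.coeff_ofCoeff, h, Finsupp.mapRange_apply, hV w, star_star]

theorem NCSmooth.IsSelfAdj.star_elt {V : NCSmooth ℓ} (hV : V.IsSelfAdj) :
    star V.elt = V.elt := by
  rw [NCSmooth.elt, star_add, star_polyElt, hV.revStar_poly, star_sum]
  simp_rw [star_smoothElt]

theorem NCSmooth.IsSelfAdj.trace_eq_re {V : NCSmooth ℓ} (hV : V.IsSelfAdj) (X : HermTuple ℓ N) :
    ((eval V.elt X).trace.re : ℂ) = (eval V.elt X).trace := by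
  have h : star (eval V.elt X).trace = (eval V.elt X).trace := by
    rw [← Matrix.trace_conjTranspose]
    change (star (eval V.elt X)).trace = _
    rw [← eval_star, hV.star_elt]
  exact Complex.conj_eq_iff_re.mp h

/-- Complex matrices are combinations of Hermitian matrices, so that a linear functional is
determined by its values on these. -/
theorem exists_herm_decomposition (M : Matrix (Fin N) (Fin N) ℂ) :
    ∃ A B : Herm N, M = (A : Matrix (Fin N) (Fin N) ℂ) +
      Complex.I • (B : Matrix (Fin N) (Fin N) ℂ) :=
  ⟨realPart M, imaginaryPart M, (realPart_add_I_smul_imaginaryPart M).symm⟩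

theorem eq_of_trace_mul_herm {M M' : Matrix (Fin N) (Fin N) ℂ}
    (h : ∀ H : Herm N, (M * (H : Matrix (Fin N) (Fin N) ℂ)).trace =
      (M' * (H : Matrix (Fin N) (Fin N) ℂ)).trace) : M = M' := by
  refine Matrix.ext_iff_trace_mul_right.mpr fun D => ?_
  obtain ⟨A, B, rfl⟩ := exists_herm_decomposition D
  simp only [mul_add, mul_smul_comm, Matrix.trace_add, Matrix.trace_smul, h]

/-- The trace of V is real, so conjugation leaves it and hence its gradient unchanged. Uniqueness of
the gradient replaces a computation on words. -/
theorem NCSmooth.IsSelfAdj.star_cyclicDeriv {V : NCSmooth ℓ} (hV : V.IsSelfAdj) (i : Fin ℓ) :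
    star (V.cyclicDeriv i) = V.cyclicDeriv i := by
  refine ext_eval fun N X => ?_
  refine eq_of_trace_mul_herm fun H => ?_
  have h1 := (hasGrad_trace_elt (N := N) i V).star.deriv X H
  have h2 : ∀ Y : HermTuple ℓ N, star (eval V.elt Y).trace = (eval V.elt Y).trace := fun Y => by
    rw [← hV.trace_eq_re Y]
    exact Complex.conj_ofReal _
  replace h1 := h1.congr_of_eventuallyEq (Eventually.of_forall fun t => (h2 _).symm)
  exact h1.unique ((hasGrad_trace_elt (N := N) i V).deriv X H)

/-! ### Coordinates -/

/-- The real coordinates of a Hermitian matrix. -/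
def hermCoords (H : Herm N) : Fin N → Fin N → ℝ := fun a b =>
  if a ≤ b then ((H : Matrix (Fin N) (Fin N) ℂ) a b).re
  else ((H : Matrix (Fin N) (Fin N) ℂ) b a).im

theorem hermOfCoords_apply (y : Fin N → Fin N → ℝ) (a b : Fin N) :
    (hermOfCoords y : Matrix (Fin N) (Fin N) ℂ) a b = if a = b then (y a a : ℂ)
      else if a < b then (y a b : ℂ) + Complex.I * y b a
      else (y b a : ℂ) - Complex.I * y a b := rfl

theorem hermOfCoords_hermCoords (H : Herm N) : hermOfCoords (hermCoords H) = H := by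
  refine Subtype.ext (Matrix.ext fun a b => ?_)
  have hH : ∀ a b, star ((H : Matrix (Fin N) (Fin N) ℂ) b a) =
      (H : Matrix (Fin N) (Fin N) ℂ) a b := fun a b => (isHermitian_coe H).apply a b
  rw [hermOfCoords_apply]
  rcases lt_trichotomy a b with h | h | h
  · simp only [hermCoords, h.ne, h, h.le, h.not_ge, if_true, if_false]
    apply Complex.ext <;> simp
  · subst h
    have := hH a a
    simp only [hermCoords, le_refl, if_true]
    exact Complex.conj_eq_iff_re.mp this
  · simp only [hermCoords, h.ne', h.not_gt, h.le, h.not_ge, if_true, if_false]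
    rw [← hH a b]
    apply Complex.ext <;> simp

theorem hermOfCoords_add_smul (y v : Fin N → Fin N → ℝ) (t : ℝ) :
    hermOfCoords (y + t • v) = hermOfCoords y + t • hermOfCoords v := by
  refine Subtype.ext (Matrix.ext fun a b => ?_)
  rw [AddSubgroup.coe_add, selfAdjoint.val_smul, Matrix.add_apply, Matrix.smul_apply]
  simp only [hermOfCoords_apply, Pi.add_apply, Pi.smul_apply, smul_eq_mul, Complex.real_smul]
  split_ifs <;> push_cast <;> ring

theorem continuous_hermOfCoords :
    Continuous (hermOfCoords : (Fin N → Fin N → ℝ) → Herm N) := by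
  refine Continuous.subtype_mk (continuous_matrix fun a b => ?_) _
  simp only [Matrix.of_apply]
  split_ifs <;> fun_prop

/-- Converts bounds on operator norms into compactness in the real coordinates. -/
theorem abs_le_norm_hermOfCoords (y : Fin N → Fin N → ℝ) (a b : Fin N) :
    |y a b| ≤ ‖(hermOfCoords y : Matrix (Fin N) (Fin N) ℂ)‖ := by
  rcases lt_trichotomy a b with h | h | h
  · refine le_trans ?_ (norm_entry_le (hermOfCoords y : Matrix (Fin N) (Fin N) ℂ) a b)
    rw [hermOfCoords_apply, if_neg h.ne, if_pos h]
    refine le_trans (le_of_eq ?_) (Complex.abs_re_le_norm _)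
    simp
  · subst h
    refine le_trans ?_ (norm_entry_le (hermOfCoords y : Matrix (Fin N) (Fin N) ℂ) a a)
    rw [hermOfCoords_apply, if_pos rfl]
    simp
  · refine le_trans ?_ (norm_entry_le (hermOfCoords y : Matrix (Fin N) (Fin N) ℂ) b a)
    rw [hermOfCoords_apply, if_neg h.ne, if_pos h]
    refine le_trans (le_of_eq ?_) (Complex.abs_im_le_norm _)
    simp

/-- The parametrization of tuples of Hermitian matrices by real coordinates. -/
def coordMap (y : Fin ℓ → Fin N → Fin N → ℝ) : HermTuple ℓ N := fun j => hermOfCoords (y j)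

theorem continuous_coordMap :
    Continuous (coordMap : (Fin ℓ → Fin N → Fin N → ℝ) → HermTuple ℓ N) :=
  continuous_pi fun j => continuous_hermOfCoords.comp (continuous_apply j)

theorem coordMap_add_smul (y : Fin ℓ → Fin N → Fin N → ℝ) (i : Fin ℓ) (H : Herm N) (t : ℝ) :
    coordMap (y + t • (Pi.single i (hermCoords H) : Fin ℓ → Fin N → Fin N → ℝ)) = coordMap y + t • dir i H := by
  funext j
  by_cases h : j = i
  · subst h
    simp [coordMap, hermOfCoords_add_smul, hermOfCoords_hermCoords]
  · simp [coordMap, h]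

instance instIsAddHaarMeasureVolumeMatrix (N : ℕ) :
    (volume : Measure (Fin N → Fin N → ℝ)).IsAddHaarMeasure :=
  Measure.pi.isAddHaarMeasure fun _ : Fin N => (volume : Measure (Fin N → ℝ))

instance instIsAddHaarMeasureVolumeTuple (ℓ N : ℕ) :
    (volume : Measure (Fin ℓ → Fin N → Fin N → ℝ)).IsAddHaarMeasure :=
  Measure.pi.isAddHaarMeasure fun _ : Fin ℓ => (volume : Measure (Fin N → Fin N → ℝ))

/-- The function `G` vanishes outside a set of tuples of matrices with bounded norms. -/
def BoundedSupport (G : HermTuple ℓ N → ℂ) : Prop :=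
  ∃ R : ℝ, ∀ X, G X ≠ 0 → ∀ j, ‖(X j : Matrix (Fin N) (Fin N) ℂ)‖ ≤ R

theorem BoundedSupport.of_imp {G G' : HermTuple ℓ N → ℂ} (h : BoundedSupport G)
    (h' : ∀ X, G' X ≠ 0 → G X ≠ 0) : BoundedSupport G' :=
  let ⟨R, hR⟩ := h
  ⟨R, fun X hX => hR X (h' X hX)⟩

theorem BoundedSupport.hasCompactSupport {G : HermTuple ℓ N → ℂ} (h : BoundedSupport G) :
    HasCompactSupport fun y => G (coordMap y) := by
  obtain ⟨R, hR⟩ := h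
  refine HasCompactSupport.of_support_subset_isCompact
    (K := Metric.closedBall 0 (max R 0)) (isCompact_closedBall _ _) fun y hy => ?_
  have h1 := hR _ hy
  rw [mem_closedBall_zero_iff]
  have h0 : (0 : ℝ) ≤ max R 0 := le_max_right _ _
  refine (pi_norm_le_iff_of_nonneg h0).mpr fun j => (pi_norm_le_iff_of_nonneg h0).mpr fun a =>
    (pi_norm_le_iff_of_nonneg h0).mpr fun b => ?_
  exact (abs_le_norm_hermOfCoords (y j) a b).trans ((h1 j).trans (le_max_left _ _))

theorem measurable_coordMap :
    Measurable (coordMap : (Fin ℓ → Fin N → Fin N → ℝ) → HermTuple ℓ N) :=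
  continuous_coordMap.measurable

theorem lebesgueHerm_eq : lebesgueHerm ℓ N = Measure.map coordMap volume := rfl

theorem BoundedSupport.integrable {G : HermTuple ℓ N → ℂ} (h : BoundedSupport G)
    (hG : Continuous G) : Integrable G (lebesgueHerm ℓ N) := by
  rw [lebesgueHerm_eq, integrable_map_measure hG.aestronglyMeasurable
    measurable_coordMap.aemeasurable]
  exact (hG.comp continuous_coordMap).integrable_of_hasCompactSupport h.hasCompactSupport

/-- The region where some norm exceeds R is open and G vanishes there, so all directional
derivatives vanish there too. The radius does not change. -/
theorem HasGrad.boundedSupport_grad {i : Fin ℓ} {G : HermTuple ℓ N → ℂ}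
    {Γ : HermTuple ℓ N → Matrix (Fin N) (Fin N) ℂ} (h : HasGrad i G Γ) (hG : BoundedSupport G)
    (Δ : Matrix (Fin N) (Fin N) ℂ) : BoundedSupport fun X => (Γ X * Δ).trace := by
  obtain ⟨R, hR⟩ := hG
  refine ⟨R, fun X hX j => ?_⟩
  by_contra hj
  push Not at hj
  apply hX
  have h1 : ∀ᶠ Y : HermTuple ℓ N in 𝓝 X, R < ‖(Y j : Matrix (Fin N) (Fin N) ℂ)‖ :=
    continuousAt_const.eventually_lt (continuous_coordFun j).norm.continuousAt hj
  have h2 : ∀ᶠ Y in 𝓝 X, G Y = 0 := by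
    filter_upwards [h1] with Y hY
    by_contra h0
    exact absurd (hR Y h0 j) (not_le.mpr hY)
  have h3 : Γ X = 0 := by
    refine eq_of_trace_mul_herm fun H => ?_
    rw [zero_mul, Matrix.trace_zero]
    refine (h.deriv X H).unique ?_
    refine (hasDerivAt_const (0 : ℝ) (0 : ℂ)).congr_of_eventuallyEq ?_
    have hc : ContinuousAt (fun t : ℝ => X + t • dir i H) 0 := by fun_prop
    have : Tendsto (fun t : ℝ => X + t • dir i H) (𝓝 0) (𝓝 X) := by
      simpa [ContinuousAt] using hc
    exact this.eventually h2
  simp only [h3, zero_mul, Matrix.trace_zero]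

/-- The integral of a derivative of a compactly supported function vanishes, in all complex
directions. -/
theorem HasGrad.integral_eq_zero {i : Fin ℓ} {G : HermTuple ℓ N → ℂ}
    {Γ : HermTuple ℓ N → Matrix (Fin N) (Fin N) ℂ} (h : HasGrad i G Γ) (hG : BoundedSupport G)
    (Δ : Matrix (Fin N) (Fin N) ℂ) : ∫ X, (Γ X * Δ).trace ∂lebesgueHerm ℓ N = 0 := by
  have hcont : ∀ Δ : Matrix (Fin N) (Fin N) ℂ, Continuous fun X => (Γ X * Δ).trace := fun Δ =>
    (h.cont_grad.mul continuous_const).matrix_trace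
  have key : ∀ H : Herm N,
      ∫ X, (Γ X * (H : Matrix (Fin N) (Fin N) ℂ)).trace ∂lebesgueHerm ℓ N = 0 := by
    intro H
    have hs := h.boundedSupport_grad hG (H : Matrix (Fin N) (Fin N) ℂ)
    have hi := hs.integrable (hcont _)
    have hi0 := hG.integrable h.cont
    rw [lebesgueHerm_eq, integrable_map_measure (hcont _).aestronglyMeasurable
      measurable_coordMap.aemeasurable] at hi
    rw [lebesgueHerm_eq, integrable_map_measure h.cont.aestronglyMeasurable
      measurable_coordMap.aemeasurable] at hi0
    rw [lebesgueHerm_eq, integral_map measurable_coordMap.aemeasurable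
      (hcont _).aestronglyMeasurable]
    -- Integration by parts against the constant function 1: a directional derivative of a compactly
    -- supported function has integral 0.
    have := integral_bilinear_hasLineDerivAt_right_eq_neg_left_of_integrable
      (μ := (volume : Measure (Fin ℓ → Fin N → Fin N → ℝ))) (f := fun _ => (1 : ℂ))
      (f' := fun _ => (0 : ℂ)) (g := fun y => G (coordMap y))
      (g' := fun y => (Γ (coordMap y) * (H : Matrix (Fin N) (Fin N) ℂ)).trace)
      (v := Pi.single i (hermCoords H)) (B := ContinuousLinearMap.mul ℝ ℂ)
      (by simp) (by simpa [Function.comp_def] using hi)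
      (by simpa [Function.comp_def] using hi0)
      (fun y _ => hasDerivAt_const _ _) (fun y _ => by
        unfold HasLineDerivAt
        simp only [coordMap_add_smul]
        exact h.deriv (coordMap y) H)
    simpa using this
  obtain ⟨A, B, rfl⟩ := exists_herm_decomposition Δ
  simp only [mul_add, mul_smul_comm, Matrix.trace_add, Matrix.trace_smul, smul_eq_mul]
  rw [integral_add, integral_const_mul, key, key]
  · simp
  · exact (h.boundedSupport_grad hG _).integrable (hcont _)
  · exact ((h.boundedSupport_grad hG _).integrable (hcont _)).const_mul _

/-! ### The integrated Dyson–Schwinger equation -/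

/-- The linear map `u ⊗ v ↦ Tr u(X) Tr v(X)`. -/
def traceSq (X : HermTuple ℓ N) : NCPoly ℓ ⊗[ℂ] NCPoly ℓ →ₗ[ℂ] ℂ :=
  let φ : NCPoly ℓ →ₗ[ℂ] ℂ := Matrix.traceLinearMap (Fin N) ℂ ℂ ∘ₗ
    (evalHom X).toAlgHom.toLinearMap ∘ₗ polyElt.toLinearMap
  LinearMap.mul' ℂ ℂ ∘ₗ TensorProduct.map φ φ

@[simp]
theorem traceSq_tmul (X : HermTuple ℓ N) (u v : NCPoly ℓ) :
    traceSq X (u ⊗ₜ v) = (eval (polyElt u) X).trace * (eval (polyElt v) X).trace := rfl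

theorem trace_mul_single_one (M : Matrix (Fin N) (Fin N) ℂ) (a b : Fin N) :
    (M * Matrix.single a b 1).trace = M b a := by
  rw [Matrix.trace_mul_comm, Matrix.trace_single_mul]
  exact one_mul _

/-- Summing v E_{ba} u E_{ab} over matrix units decouples the two legs. This is how the product of
two traces arises as the divergence of the vector field P. -/
theorem sum_trace_sandwich_single (X : HermTuple ℓ N) (T : NCPoly ℓ ⊗[ℂ] NCPoly ℓ) :
    ∑ a, ∑ b, (sandwich X (Matrix.single b a 1) (TensorProduct.comm ℂ _ _ T) *
      Matrix.single a b 1).trace = traceSq X T := by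
  induction T with
  | zero => simp
  | add S T hS hT => simp only [map_add, add_mul, Matrix.trace_add, Finset.sum_add_distrib, hS, hT]
  | tmul u v =>
    simp only [TensorProduct.comm_tmul, sandwich_tmul, traceSq_tmul]
    have h : ∀ a b, (eval (polyElt v) X * Matrix.single b a 1 * eval (polyElt u) X *
        Matrix.single a b 1).trace = eval (polyElt u) X a a * eval (polyElt v) X b b :=
      fun a b => by
      rw [trace_mul_single_one, Matrix.mul_assoc, Matrix.mul_apply, Finset.sum_eq_single b]
      · rw [Matrix.single_mul_apply_same, one_mul, mul_comm]
      · intro e _ he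
        rw [Matrix.single_mul_apply_of_ne _ _ _ _ _ he, mul_zero]
      · simp
    simp only [h]
    simp only [Matrix.trace, Matrix.diag_apply, Finset.sum_mul_sum]

/-- The real density of the matrix model, as a complex number. -/
def gibbsDensity (V : NCSmooth ℓ) (X : HermTuple ℓ N) : ℝ :=
  Real.exp (-(N * (eval V.elt X).trace.re))

theorem hasGrad_gibbsDensity (i : Fin ℓ) {V : NCSmooth ℓ} (hV : V.IsSelfAdj) :
    HasGrad i (fun X : HermTuple ℓ N => (gibbsDensity V X : ℂ))
      fun X => (-(N * gibbsDensity V X) : ℂ) • eval (V.cyclicDeriv i) X := by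
  have h1 : HasGrad i (fun X : HermTuple ℓ N => ((eval V.elt X).trace.re : ℂ))
      fun X => eval (V.cyclicDeriv i) X :=
    (hasGrad_trace_elt i V).congr (fun X => hV.trace_eq_re X) fun _ => rfl
  refine (h1.comp_real (ψ := fun x => Real.exp (-(N * x)))
    (ψ' := fun x => -(N * Real.exp (-(N * x)))) (fun x => ?_) (by fun_prop)).congr
    (fun _ => rfl) fun X => ?_
  · have := ((hasDerivAt_id x).const_mul (N : ℝ)).neg.exp
    refine this.congr_deriv ?_
    simp [mul_comm]
  · simp [gibbsDensity]

theorem trace_mul_eq_sum (A B : Matrix (Fin N) (Fin N) ℂ) :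
    (A * B).trace = ∑ a, ∑ b, A a b * (B * Matrix.single a b 1).trace := by
  simp only [trace_mul_single_one]
  simp [Matrix.trace, Matrix.mul_apply]

/-- Integration by parts in the direction of the vector field `P` in the `i`-th matrix. -/
theorem integration_by_parts (i : Fin ℓ) (P : NCPoly ℓ) {V : NCSmooth ℓ} (hV : V.IsSelfAdj)
    {g : HermTuple ℓ N → ℂ} {Γ : HermTuple ℓ N → Matrix (Fin N) (Fin N) ℂ} (hg : HasGrad i g Γ)
    (hs : BoundedSupport g) :
    ∫ X, (N * (eval (V.cyclicDeriv i * polyElt P) X).trace - traceSq X (polyDeriv i P)) * g X *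
        gibbsDensity V X ∂lebesgueHerm ℓ N =
      ∫ X, (eval (polyElt P) X * Γ X).trace * gibbsDensity V X ∂lebesgueHerm ℓ N := by
  set w : HermTuple ℓ N → ℂ := fun X => (gibbsDensity V X : ℂ) with hw
  set Q : HermTuple ℓ N → Matrix (Fin N) (Fin N) ℂ := fun X => eval (polyElt P) X with hQ
  -- The vector field P is split into entries: the entry (a, b), multiplied by g and the density, is
  -- differentiated in the direction of the matrix unit E_{ab}. These directions are not Hermitian,
  -- but the vanishing of the integral extends to them by complex linearity.
  have hgrad : ∀ a b, HasGrad i (fun X => (Q X * Matrix.single b a 1).trace * (g X * w X)) _ :=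
    fun a b => (hasGrad_trace_mul i P (Matrix.single b a 1)).mul
      (hg.mul (hasGrad_gibbsDensity i hV))
  have hsupp : ∀ a b, BoundedSupport
      (fun X => (Q X * Matrix.single b a 1).trace * (g X * w X)) := fun a b =>
    hs.of_imp fun X hX h0 => hX (by simp [h0])
  have hzero := fun a b => (hgrad a b).integral_eq_zero (hsupp a b) (Matrix.single a b 1)
  have hint := fun a b => ((hgrad a b).boundedSupport_grad (hsupp a b)
    (Matrix.single a b 1)).integrable
      (((hgrad a b).cont_grad.mul continuous_const).matrix_trace)
  have hentry : ∀ X a b, (Q X * Matrix.single b a 1).trace = Q X a b := fun X a b => by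
    exact trace_mul_single_one _ _ _
  have hcw : Continuous w := (hasGrad_gibbsDensity (N := N) i hV).cont
  have hsum : ∑ a, ∑ b, ∫ X, ((((g X * w X) •
      sandwich X (Matrix.single b a 1) (TensorProduct.comm ℂ _ _ (polyDeriv i P)) +
      (Q X * Matrix.single b a 1).trace • (w X • Γ X + g X • (-(N * gibbsDensity V X) : ℂ) •
        eval (V.cyclicDeriv i) X)) * Matrix.single a b 1).trace) ∂lebesgueHerm ℓ N = 0 :=
    Finset.sum_eq_zero fun a _ => Finset.sum_eq_zero fun b _ => hzero a b
  have hswap : ∫ X, ∑ a, ∑ b, ((((g X * w X) •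
      sandwich X (Matrix.single b a 1) (TensorProduct.comm ℂ _ _ (polyDeriv i P)) +
      (Q X * Matrix.single b a 1).trace • (w X • Γ X + g X • (-(N * gibbsDensity V X) : ℂ) •
        eval (V.cyclicDeriv i) X)) * Matrix.single a b 1).trace) ∂lebesgueHerm ℓ N = 0 := by
    rw [← hsum, integral_finsetSum _ fun a _ => integrable_finsetSum _ fun b _ => hint a b]
    exact Finset.sum_congr rfl fun a _ => integral_finsetSum _ fun b _ => hint a b
  have hpoint : ∀ X, ∑ a, ∑ b, ((((g X * w X) •
      sandwich X (Matrix.single b a 1) (TensorProduct.comm ℂ _ _ (polyDeriv i P)) +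
      (Q X * Matrix.single b a 1).trace • (w X • Γ X + g X • (-(N * gibbsDensity V X) : ℂ) •
        eval (V.cyclicDeriv i) X)) * Matrix.single a b 1).trace) =
      (Q X * Γ X).trace * w X - (N * (eval (V.cyclicDeriv i * polyElt P) X).trace -
        traceSq X (polyDeriv i P)) * g X * w X := by
    intro X
    have h1 : (eval (V.cyclicDeriv i * polyElt P) X).trace =
        (Q X * eval (V.cyclicDeriv i) X).trace := by rw [eval_mul, Matrix.trace_mul_comm]
    rw [h1, trace_mul_eq_sum (Q X) (Γ X), trace_mul_eq_sum (Q X),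
      ← sum_trace_sandwich_single X (polyDeriv i P)]
    simp only [hentry, add_mul, smul_mul_assoc, smul_add, Matrix.trace_add, Matrix.trace_smul,
      smul_eq_mul, Finset.mul_sum, Finset.sum_mul, sub_mul, ← Finset.sum_sub_distrib, hw]
    refine Finset.sum_congr rfl fun a _ => Finset.sum_congr rfl fun b _ => ?_
    ring
  simp only [hpoint] at hswap
  have hcΦ : Continuous fun X : HermTuple ℓ N =>
      (N * (eval (V.cyclicDeriv i * polyElt P) X).trace - traceSq X (polyDeriv i P)) := by
    refine (continuous_const.mul (((continuous_eval_cyclicDeriv V i).mul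
      (continuous_eval_polyElt P)).matrix_trace)).sub ?_
    have : (fun X : HermTuple ℓ N => traceSq X (polyDeriv i P)) = _ :=
      funext fun X => (sum_trace_sandwich_single X (polyDeriv i P)).symm
    rw [this]
    exact continuous_finsetSum _ fun a _ => continuous_finsetSum _ fun b _ =>
      ((continuous_sandwich _ _).mul continuous_const).matrix_trace
  rw [integral_sub, sub_eq_zero] at hswap
  · exact hswap.symm
  · refine BoundedSupport.integrable ?_
      (((continuous_eval_polyElt P).mul hg.cont_grad).matrix_trace.mul hcw)
    obtain ⟨R, hR⟩ := hs
    have hb := fun a b => hg.boundedSupport_grad ⟨R, hR⟩ (Matrix.single a b 1)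
    choose S hS using hb
    refine ⟨∑ a, ∑ b, |S a b|, fun X hX j => ?_⟩
    have h1 : (Q X * Γ X).trace ≠ 0 := left_ne_zero_of_mul hX
    rw [trace_mul_eq_sum] at h1
    obtain ⟨a, _, ha⟩ := Finset.exists_ne_zero_of_sum_ne_zero h1
    obtain ⟨b, _, hb⟩ := Finset.exists_ne_zero_of_sum_ne_zero ha
    refine (hS a b X (right_ne_zero_of_mul hb) j).trans ((le_abs_self _).trans ?_)
    refine le_trans ?_ (Finset.single_le_sum (f := fun a => ∑ b, |S a b|)
      (fun a _ => Finset.sum_nonneg fun b _ => abs_nonneg _) (Finset.mem_univ a))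
    exact Finset.single_le_sum (f := fun b => |S a b|) (fun b _ => abs_nonneg _)
      (Finset.mem_univ b)
  · exact (hs.of_imp fun X hX h0 => hX (by simp [h0])).integrable
      ((hcΦ.mul hg.cont).mul hcw)

/-! ### Difference quotients -/

theorem dslope_const_mul_pow (c : ℝ) (n : ℕ) (x y : ℝ) :
    dslope (fun t => c * t ^ n) x y = c * ∑ a ∈ Finset.range n, x ^ a * y ^ (n - 1 - a) := by
  by_cases h : y = x
  · subst h
    have h1 : ∀ a ∈ Finset.range n, y ^ a * y ^ (n - 1 - a) = y ^ (n - 1) := fun a ha => by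
      have := Finset.mem_range.mp ha
      rw [← pow_add]
      congr 1
      omega
    rw [dslope_same, Finset.sum_congr rfl h1]
    simp
  · rw [dslope_of_ne _ h, slope_def_field]
    have h2 := (Commute.all x y).geom_sum₂_mul n
    have h3 : x - y ≠ 0 := sub_ne_zero.mpr (Ne.symm h)
    have h4 : y - x ≠ 0 := sub_ne_zero.mpr h
    rw [div_eq_iff h4]
    linear_combination c * h2

theorem dslope_add {f g : ℝ → ℝ} (hf : Differentiable ℝ f) (hg : Differentiable ℝ g) (x y : ℝ) :
    dslope (fun t => f t + g t) x y = dslope f x y + dslope g x y := by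
  by_cases h : y = x
  · subst h
    simp only [dslope_same]
    exact deriv_add (hf y) (hg y)
  · simp only [dslope_of_ne _ h, slope_def_field]
    ring

/-- The mean value inequality. It controls ∂_i of a function of X_i by the C¹ size of the function,
independently of the degree of an approximating polynomial. -/
theorem abs_dslope_le {f : ℝ → ℝ} (hf : Differentiable ℝ f) {S L : ℝ}
    (hL : ∀ x, |x| ≤ S → |deriv f x| ≤ L) {x y : ℝ} (hx : |x| ≤ S) (hy : |y| ≤ S) :
    |dslope f x y| ≤ L := by
  by_cases h : y = x
  · subst h
    rw [dslope_same]
    exact hL y hy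
  · rw [dslope_of_ne _ h, slope_def_field, abs_div, div_le_iff₀ (abs_pos.mpr (sub_ne_zero.mpr h))]
    exact Convex.norm_image_sub_le_of_norm_hasDerivWithin_le (s := Set.Icc (-S) S)
      (fun z _ => (hf z).hasDerivAt.hasDerivWithinAt) (fun z hz => hL z (abs_le.mpr hz))
      (convex_Icc _ _) (abs_le.mp hx) (abs_le.mp hy)

/-- A linear functional that is, on the tensors `X_i^a ⊗ X_i^b`, a combination of evaluations at
points `(x, y)` is the same combination of difference quotients on `∂_i p(X_i)`. -/
theorem map_polyDeriv_polyX {ι : Type*} (s : Finset ι) (c : ι → ℂ) (x y : ι → ℝ) (i : Fin ℓ)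
    (Λ : NCPoly ℓ ⊗[ℂ] NCPoly ℓ →ₗ[ℂ] ℂ)
    (hΛ : ∀ a b : ℕ, Λ ((monomial [i] ^ a) ⊗ₜ (monomial [i] ^ b)) =
      ∑ k ∈ s, c k * ((x k ^ a * y k ^ b : ℝ) : ℂ)) (p : Polynomial ℝ) :
    Λ (polyDeriv i (polyX i p)) = ∑ k ∈ s, c k * (dslope (fun t => p.eval t) (x k) (y k) : ℝ) := by
  induction p using Polynomial.induction_on' with
  | add p q hp hq =>
    rw [polyX_add, map_add, map_add, hp, hq, ← Finset.sum_add_distrib]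
    refine Finset.sum_congr rfl fun k _ => ?_
    simp only [Polynomial.eval_add]
    rw [dslope_add p.differentiable q.differentiable]
    push_cast
    ring
  | monomial n c' =>
    rw [← Polynomial.C_mul_X_pow_eq_monomial, polyX_C_mul_X_pow, map_smul, polyDeriv_pow,
      polyDeriv_X, if_pos rfl, map_smul, map_sum]
    have : ∀ a ∈ Finset.range n, Λ (((monomial [i] ^ a) ⊗ₜ[ℂ] 1) * 1 *
        (1 ⊗ₜ[ℂ] (monomial [i] ^ (n - 1 - a)))) =
        ∑ k ∈ s, c k * ((x k ^ a * y k ^ (n - 1 - a) : ℝ) : ℂ) := fun a _ => by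
      rw [mul_one, Algebra.TensorProduct.tmul_mul_tmul, one_mul, mul_one, hΛ]
    rw [Finset.sum_congr rfl this, Finset.sum_comm, Finset.smul_sum]
    refine Finset.sum_congr rfl fun k _ => ?_
    simp only [Polynomial.eval_mul, Polynomial.eval_C, Polynomial.eval_pow, Polynomial.eval_X]
    rw [dslope_const_mul_pow, ← Finset.mul_sum, smul_eq_mul]
    push_cast
    ring

/-! ### Trace inequalities -/

theorem sum_norm_sq_le (A : Matrix (Fin N) (Fin N) ℂ) :
    ∑ q : Fin N × Fin N, ‖A q.1 q.2‖ ^ 2 ≤ N * ‖A‖ ^ 2 := by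
  have h1 : ((∑ q : Fin N × Fin N, ‖A q.1 q.2‖ ^ 2 : ℝ) : ℂ) = (A * star A).trace := by
    rw [Fintype.sum_prod_type, Matrix.trace]
    push_cast
    refine Finset.sum_congr rfl fun a _ => ?_
    rw [Matrix.diag_apply, Matrix.mul_apply]
    refine Finset.sum_congr rfl fun b _ => ?_
    rw [Matrix.star_apply]
    exact (Complex.mul_conj' _).symm
  have h2 := norm_trace_le (A * star A)
  rw [← h1, Complex.norm_real, CStarRing.norm_self_mul_star] at h2
  calc _ ≤ _ := Real.le_norm_self _
    _ ≤ _ := h2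
    _ = _ := by ring

/-- Cauchy–Schwarz on the entries together with Tr(AA*) ≤ N ‖A‖². The factor is N, although there
are N² entries. -/
theorem sum_norm_mul_le (A B : Matrix (Fin N) (Fin N) ℂ) :
    ∑ q : Fin N × Fin N, ‖A q.1 q.2‖ * ‖B q.2 q.1‖ ≤ N * ‖A‖ * ‖B‖ := by
  have h1 := Finset.sum_mul_sq_le_sq_mul_sq Finset.univ
    (fun q : Fin N × Fin N => ‖A q.1 q.2‖) fun q => ‖B q.2 q.1‖
  have h2 := sum_norm_sq_le A
  have h3 : ∑ q : Fin N × Fin N, ‖B q.2 q.1‖ ^ 2 ≤ N * ‖B‖ ^ 2 := by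
    refine le_trans (le_of_eq ?_) (sum_norm_sq_le B)
    exact Fintype.sum_equiv (Equiv.prodComm _ _) _ _ fun q => rfl
  have h4 : 0 ≤ ∑ q : Fin N × Fin N, ‖B q.2 q.1‖ ^ 2 := Finset.sum_nonneg fun _ _ => by positivity
  refine le_of_sq_le_sq (h1.trans ?_) (by positivity)
  calc _ ≤ (N * ‖A‖ ^ 2) * (N * ‖B‖ ^ 2) := mul_le_mul h2 h3 h4 (by positivity)
    _ = _ := by ring

theorem eval_monomial_singleton_pow (X : HermTuple ℓ N) (i : Fin ℓ) (a : ℕ) :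
    eval (polyElt (monomial [i] ^ a)) X = (X i : Matrix (Fin N) (Fin N) ℂ) ^ a := by
  rw [map_pow, polyElt_monomial_singleton, eval_pow, eval_coord]

theorem abs_eigenvalues_le (A : Herm N) (a : Fin N) :
    |(isHermitian_coe A).eigenvalues a| ≤ ‖(A : Matrix (Fin N) (Fin N) ℂ)‖ := by
  refine norm_le_of_mem_spectrum ?_
  rw [(isHermitian_coe A).spectrum_real_eq_range_eigenvalues]
  exact ⟨a, rfl⟩

/-- Written in an eigenbasis of A: B and B' are the unitary conjugates of M and M', and do not
depend on the exponents. -/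
theorem trace_pow_mul_pow_mul (A : Herm N) (M M' : Matrix (Fin N) (Fin N) ℂ) :
    ∃ B B' : Matrix (Fin N) (Fin N) ℂ, ‖B‖ ≤ ‖M‖ ∧ ‖B'‖ ≤ ‖M'‖ ∧ ∀ a b : ℕ,
      ((A : Matrix (Fin N) (Fin N) ℂ) ^ b * M * (A : Matrix (Fin N) (Fin N) ℂ) ^ a * M').trace =
        ∑ q : Fin N × Fin N, B q.1 q.2 * B' q.2 q.1 *
          (((isHermitian_coe A).eigenvalues q.2 ^ a * (isHermitian_coe A).eigenvalues q.1 ^ b :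
            ℝ) : ℂ) := by
  set U := (isHermitian_coe A).eigenvectorUnitary with hU
  set u : Matrix (Fin N) (Fin N) ℂ := (U : Matrix (Fin N) (Fin N) ℂ) with hu
  set D : Matrix (Fin N) (Fin N) ℂ :=
    Matrix.diagonal (RCLike.ofReal ∘ (isHermitian_coe A).eigenvalues) with hD
  have hnorm : ∀ M : Matrix (Fin N) (Fin N) ℂ, ‖star u * M * u‖ ≤ ‖M‖ := fun M => by
    rw [CStarRing.norm_mul_coe_unitary]
    exact ((CStarRing.norm_coe_unitary_mul (star U) M)).le
  refine ⟨star u * M * u, star u * M' * u, hnorm M, hnorm M', fun a b => ?_⟩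
  have hpow : ∀ n : ℕ, (A : Matrix (Fin N) (Fin N) ℂ) ^ n = u * D ^ n * star u := fun n => by
    conv_lhs => rw [(isHermitian_coe A).spectral_theorem, ← map_pow]
    rfl
  have hDpow : ∀ n : ℕ, D ^ n = Matrix.diagonal
      fun k => (((isHermitian_coe A).eigenvalues k ^ n : ℝ) : ℂ) := fun n => by
    rw [hD, Matrix.diagonal_pow]
    congr 1
    funext k
    simp
  have h1 : ((A : Matrix (Fin N) (Fin N) ℂ) ^ b * M * (A : Matrix (Fin N) (Fin N) ℂ) ^ a * M').trace
      = (D ^ b * (star u * M * u) * (D ^ a * (star u * M' * u))).trace := by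
    rw [hpow, hpow]
    calc _ = (u * (D ^ b * star u * M * (u * D ^ a * star u) * M')).trace := by
          simp only [Matrix.mul_assoc]
      _ = ((D ^ b * star u * M * (u * D ^ a * star u) * M') * u).trace := Matrix.trace_mul_comm _ _
      _ = _ := by simp only [Matrix.mul_assoc]
  rw [h1, hDpow, hDpow, Fintype.sum_prod_type, Matrix.trace]
  refine Finset.sum_congr rfl fun j _ => ?_
  rw [Matrix.diag_apply, Matrix.mul_apply]
  refine Finset.sum_congr rfl fun k _ => ?_
  rw [Matrix.diagonal_mul, Matrix.diagonal_mul]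
  push_cast
  ring

/-- In an eigenbasis of X_i the trace is a double sum of difference quotients of p, weighted by
entries of the conjugates of M and M'. The quotients are bounded by L and the entries are summed
with `sum_norm_mul_le`. -/
theorem norm_trace_sandwich_polyX_le {X : HermTuple ℓ N} {i : Fin ℓ} {S L : ℝ}
    (hX : ‖(X i : Matrix (Fin N) (Fin N) ℂ)‖ ≤ S) {p : Polynomial ℝ}
    (hp : ∀ x, |x| ≤ S → |p.derivative.eval x| ≤ L) (M M' : Matrix (Fin N) (Fin N) ℂ) :
    ‖(sandwich X M (TensorProduct.comm ℂ _ _ (polyDeriv i (polyX i p))) * M').trace‖ ≤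
      L * (N * ‖M‖ * ‖M'‖) := by
  obtain ⟨B, B', hB, hB', h⟩ := trace_pow_mul_pow_mul (X i) M M'
  have hΛ := map_polyDeriv_polyX Finset.univ (fun q : Fin N × Fin N => B q.1 q.2 * B' q.2 q.1)
    (fun q => (isHermitian_coe (X i)).eigenvalues q.2)
    (fun q => (isHermitian_coe (X i)).eigenvalues q.1) i
    (Matrix.traceLinearMap (Fin N) ℂ ℂ ∘ₗ LinearMap.mulRight ℂ M' ∘ₗ sandwich X M ∘ₗ
      (TensorProduct.comm ℂ (NCPoly ℓ) (NCPoly ℓ)).toLinearMap) (fun a b => by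
        simp only [LinearMap.comp_apply, LinearEquiv.coe_coe, TensorProduct.comm_tmul,
          sandwich_tmul, eval_monomial_singleton_pow]
        exact h a b) p
  refine (congrArg norm hΛ).le.trans ?_
  have hL : 0 ≤ L ∨ N = 0 := by
    rcases Nat.eq_zero_or_pos N with h0 | h0
    · exact Or.inr h0
    · exact Or.inl ((abs_nonneg _).trans (hp _ ((abs_eigenvalues_le (X i) ⟨0, h0⟩).trans hX)))
  rcases hL with hL | rfl
  swap
  · simp
  calc _ ≤ ∑ q : Fin N × Fin N, L * (‖B q.1 q.2‖ * ‖B' q.2 q.1‖) := by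
        refine (norm_sum_le _ _).trans (Finset.sum_le_sum fun q _ => ?_)
        rw [norm_mul, norm_mul, Complex.norm_real, mul_comm]
        refine mul_le_mul_of_nonneg_right ?_ (by positivity)
        refine abs_dslope_le p.differentiable (fun x hx => ?_)
          ((abs_eigenvalues_le (X i) _).trans hX) ((abs_eigenvalues_le (X i) _).trans hX)
        rw [Polynomial.deriv]
        exact hp x hx
    _ = L * ∑ q : Fin N × Fin N, ‖B q.1 q.2‖ * ‖B' q.2 q.1‖ := (Finset.mul_sum _ _ _).symm
    _ ≤ L * (N * ‖B‖ * ‖B'‖) := mul_le_mul_of_nonneg_left (sum_norm_mul_le B B') hL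
    _ ≤ _ := by gcongr

/-! ### Uniform bounds on balls -/

/-- All matrices of the tuple have norm at most `S`. -/
def NormLE (S : ℝ) (X : HermTuple ℓ N) : Prop :=
  ∀ j, ‖(X j : Matrix (Fin N) (Fin N) ℂ)‖ ≤ S

theorem exists_norm_eval_polyElt_le (P : NCPoly ℓ) (S : ℝ) : ∃ C : ℝ, 0 ≤ C ∧
    ∀ (N : ℕ) (X : HermTuple ℓ N), NormLE S X → ‖eval (polyElt P) X‖ ≤ C := by
  induction P using NCPoly.induction with
  | ha P Q hP hQ =>
    obtain ⟨C, hC, h⟩ := hP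
    obtain ⟨C', hC', h'⟩ := hQ
    refine ⟨C + C', by positivity, fun N X hX => ?_⟩
    rw [map_add, eval_add]
    exact (norm_add_le _ _).trans (add_le_add (h N X hX) (h' N X hX))
  | hs z P hP =>
    obtain ⟨C, hC, h⟩ := hP
    refine ⟨‖z‖ * C, by positivity, fun N X hX => ?_⟩
    rw [map_smul, eval_smul, norm_smul]
    gcongr
    exact h N X hX
  | hm w =>
    induction w with
    | nil =>
      refine ⟨1, zero_le_one, fun N X hX => ?_⟩
      rw [polyElt_monomial_nil]
      exact norm_one_le N
    | cons j w ih =>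
      obtain ⟨C, hC, h⟩ := ih
      refine ⟨|S| * C, by positivity, fun N X hX => ?_⟩
      rw [polyElt_monomial_cons, eval_mul, eval_coord]
      refine (norm_mul_le _ _).trans ?_
      exact mul_le_mul ((hX j).trans (le_abs_self S)) (h N X hX) (norm_nonneg _) (abs_nonneg _)

theorem exists_norm_sandwich_le (T : NCPoly ℓ ⊗[ℂ] NCPoly ℓ) (S : ℝ) : ∃ C : ℝ, 0 ≤ C ∧
    ∀ (N : ℕ) (X : HermTuple ℓ N) (M : Matrix (Fin N) (Fin N) ℂ), NormLE S X →
      ‖sandwich X M T‖ ≤ C * ‖M‖ := by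
  induction T with
  | zero => exact ⟨0, le_rfl, fun N X M _ => by simp⟩
  | add a b ha hb =>
    obtain ⟨C, hC, h⟩ := ha
    obtain ⟨C', hC', h'⟩ := hb
    refine ⟨C + C', by positivity, fun N X M hX => ?_⟩
    rw [map_add, add_mul]
    exact (norm_add_le _ _).trans (add_le_add (h N X M hX) (h' N X M hX))
  | tmul u v =>
    obtain ⟨C, hC, h⟩ := exists_norm_eval_polyElt_le u S
    obtain ⟨C', hC', h'⟩ := exists_norm_eval_polyElt_le v S
    refine ⟨C * C', by positivity, fun N X M hX => ?_⟩
    rw [sandwich_tmul]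
    calc _ ≤ ‖eval (polyElt u) X‖ * ‖M‖ * ‖eval (polyElt v) X‖ :=
          (norm_mul_le _ _).trans (by gcongr; exact norm_mul_le _ _)
      _ ≤ C * ‖M‖ * C' := by
          gcongr
          · exact h N X hX
          · exact h' N X hX
      _ = _ := by ring

/-- Each term of the gradient is one trace, of size N, times one bounded matrix. With the prefactor
1/N² in the defect this contributes a gradient of size 1/N. -/
theorem exists_hasGrad_traceSq (i : Fin ℓ) (T : NCPoly ℓ ⊗[ℂ] NCPoly ℓ) (S : ℝ) :
    ∃ C : ℝ, 0 ≤ C ∧ ∀ N : ℕ, ∃ Γ : HermTuple ℓ N → Matrix (Fin N) (Fin N) ℂ,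
      HasGrad i (fun X => traceSq X T) Γ ∧ ∀ X, NormLE S X → ‖Γ X‖ ≤ C * N := by
  induction T with
  | zero =>
    refine ⟨0, le_rfl, fun N => ⟨fun _ => 0, ?_, fun X _ => by simp⟩⟩
    exact (HasGrad.const 0).congr (fun X => map_zero _) fun _ => rfl
  | add a b ha hb =>
    obtain ⟨C, hC, h⟩ := ha
    obtain ⟨C', hC', h'⟩ := hb
    refine ⟨C + C', by positivity, fun N => ?_⟩
    obtain ⟨Γ, hΓ, hb⟩ := h N
    obtain ⟨Γ', hΓ', hb'⟩ := h' N
    refine ⟨_, (hΓ.add hΓ').congr (fun X => map_add _ _ _) fun _ => rfl, fun X hX => ?_⟩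
    rw [add_mul]
    exact (norm_add_le _ _).trans (add_le_add (hb X hX) (hb' X hX))
  | tmul u v =>
    obtain ⟨C₁, hC₁, h₁⟩ := exists_norm_eval_polyElt_le u S
    obtain ⟨C₂, hC₂, h₂⟩ := exists_norm_eval_polyElt_le v S
    obtain ⟨C₃, hC₃, h₃⟩ := exists_norm_eval_polyElt_le (polyCyclicDeriv i u) S
    obtain ⟨C₄, hC₄, h₄⟩ := exists_norm_eval_polyElt_le (polyCyclicDeriv i v) S
    refine ⟨C₂ * C₃ + C₁ * C₄, by positivity, fun N => ⟨_, (hasGrad_trace i u).mul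
      (hasGrad_trace i v), fun X hX => ?_⟩⟩
    refine (norm_add_le _ _).trans ?_
    rw [norm_smul, norm_smul]
    calc _ ≤ (N * C₂) * C₃ + (N * C₁) * C₄ := by
          gcongr
          · exact (norm_trace_le _).trans (by gcongr; exact h₂ N X hX)
          · exact h₃ N X hX
          · exact (norm_trace_le _).trans (by gcongr; exact h₁ N X hX)
          · exact h₄ N X hX
      _ = _ := by ring

/-! ### A smooth cutoff -/

/-- A smooth function that vanishes exactly on `[-R, R]` and is `1` for `x² ≥ R² + 1`. -/
def outside (R : ℝ) (x : ℝ) : ℝ := Real.smoothTransition (x ^ 2 - R ^ 2)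

theorem contDiff_outside (R : ℝ) : ContDiff ℝ ∞ (outside R) :=
  Real.smoothTransition.contDiff.comp ((contDiff_id.pow 2).sub contDiff_const)

theorem outside_nonneg (R x : ℝ) : 0 ≤ outside R x := Real.smoothTransition.nonneg _

theorem outside_eq_zero {R x : ℝ} (hx : |x| ≤ R) : outside R x = 0 := by
  refine Real.smoothTransition.zero_of_nonpos ?_
  have := sq_le_sq' (by linarith [abs_le.mp hx]) (abs_le.mp hx).2
  linarith

theorem abs_le_of_outside_lt_one {R x : ℝ} (hR : 0 ≤ R) (hx : outside R x < 1) : |x| ≤ R + 1 := by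
  by_contra h
  push Not at h
  refine hx.ne (Real.smoothTransition.one_of_one_le ?_)
  rw [← sq_abs]
  nlinarith

/-- The total mass of the eigenvalues of the tuple outside `[-R, R]`. -/
def outsideMass (R : ℝ) (X : HermTuple ℓ N) : ℝ :=
  ∑ j, (cfc (outside R) (X j : Matrix (Fin N) (Fin N) ℂ)).trace.re

/-- A smooth cutoff, which is `1` for tuples of norm at most `R` and `0` for tuples of norm more
than `R + 1`. -/
def cutoff (R : ℝ) (X : HermTuple ℓ N) : ℝ := 1 - Real.smoothTransition (outsideMass R X)

theorem cutoff_nonneg (R : ℝ) (X : HermTuple ℓ N) : 0 ≤ cutoff R X :=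
  sub_nonneg.mpr (Real.smoothTransition.le_one _)

theorem cutoff_le_one (R : ℝ) (X : HermTuple ℓ N) : cutoff R X ≤ 1 :=
  sub_le_self _ (Real.smoothTransition.nonneg _)

theorem trace_cfc_nonneg (A : Herm N) {f : ℝ → ℝ} (hf : ∀ x, 0 ≤ f x) :
    0 ≤ (cfc f (A : Matrix (Fin N) (Fin N) ℂ)).trace.re := by
  rw [trace_cfc, Complex.ofReal_re]
  exact Finset.sum_nonneg fun a _ => hf _

theorem outsideMass_nonneg (R : ℝ) (X : HermTuple ℓ N) : 0 ≤ outsideMass R X :=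
  Finset.sum_nonneg fun j _ => trace_cfc_nonneg (X j) (outside_nonneg R)

theorem cutoff_eq_one {R : ℝ} {X : HermTuple ℓ N} (hX : NormLE R X) : cutoff R X = 1 := by
  have : outsideMass R X = 0 := by
    refine Finset.sum_eq_zero fun j _ => ?_
    rw [trace_cfc, Complex.ofReal_re]
    exact Finset.sum_eq_zero fun a _ =>
      outside_eq_zero ((abs_eigenvalues_le (X j) a).trans (hX j))
  rw [cutoff, this, Real.smoothTransition.zero, sub_zero]

theorem outsideMass_lt_one_of_cutoff {R : ℝ} {X : HermTuple ℓ N} (hX : cutoff R X ≠ 0) :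
    outsideMass R X < 1 := by
  by_contra h
  push Not at h
  exact hX (by rw [cutoff, Real.smoothTransition.one_of_one_le h, sub_self])

/-- A single eigenvalue of modulus above R + 1 already contributes 1 to `outsideMass`, which makes
the cutoff vanish. -/
theorem normLE_of_cutoff {R : ℝ} (hR : 0 ≤ R) {X : HermTuple ℓ N} (hX : cutoff R X ≠ 0) :
    NormLE (R + 1) X := by
  intro j
  refine norm_le_of_spectrum (by positivity) fun x hx => abs_le_of_outside_lt_one hR ?_
  refine lt_of_le_of_lt ((le_trace_cfc (X j) (outside_nonneg R) hx).trans ?_)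
    (outsideMass_lt_one_of_cutoff hX)
  exact Finset.single_le_sum (f := fun j => (cfc (outside R)
    (X j : Matrix (Fin N) (Fin N) ℂ)).trace.re)
    (fun j _ => trace_cfc_nonneg (X j) (outside_nonneg R)) (Finset.mem_univ j)

theorem hasGrad_cutoff (R : ℝ) (i : Fin ℓ) :
    HasGrad i (fun X : HermTuple ℓ N => (cutoff R X : ℂ)) fun X =>
      (-deriv Real.smoothTransition (outsideMass R X) : ℂ) •
        cfc (deriv (outside R)) (X i : Matrix (Fin N) (Fin N) ℂ) := by
  have h1 : HasGrad i (fun X : HermTuple ℓ N => (outsideMass R X : ℂ))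
      fun X => cfc (deriv (outside R)) (X i : Matrix (Fin N) (Fin N) ℂ) := by
    refine (HasGrad.sum (s := Finset.univ) fun j _ => hasGrad_trace_cfc i j
      ((contDiff_outside R).of_le (by norm_num))).congr (fun X => ?_) fun X => by simp
    rw [outsideMass, Complex.ofReal_sum]
    refine Finset.sum_congr rfl fun j _ => ?_
    rw [trace_cfc, Complex.ofReal_re]
  have hs : ContDiff ℝ 1 Real.smoothTransition := Real.smoothTransition.contDiff
  obtain ⟨hd, hc⟩ := contDiff_one_iff_deriv.mp hs
  refine (h1.comp_real (ψ := fun x => 1 - Real.smoothTransition x)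
    (ψ' := fun x => -deriv Real.smoothTransition x) (fun x => ?_) hc.neg).congr
    (fun _ => rfl) fun X => by push_cast; rfl
  exact (hd x).hasDerivAt.const_sub 1

/-- Where the cutoff is nonzero, `outsideMass` lies in [0, 1] and the spectrum in [-(R + 1), R + 1],
so both factors are continuous functions on fixed compact sets and the bound does not depend on N.
-/
theorem exists_norm_grad_cutoff_le {R : ℝ} (hR : 0 ≤ R) (i : Fin ℓ) : ∃ C : ℝ, 0 ≤ C ∧
    ∀ (N : ℕ) (X : HermTuple ℓ N), cutoff R X ≠ 0 →
      ‖(-deriv Real.smoothTransition (outsideMass R X) : ℂ) •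
        cfc (deriv (outside R)) (X i : Matrix (Fin N) (Fin N) ℂ)‖ ≤ C := by
  have hs : ContDiff ℝ 1 Real.smoothTransition := Real.smoothTransition.contDiff
  obtain ⟨_, hc⟩ := contDiff_one_iff_deriv.mp hs
  have ho : ContDiff ℝ 1 (outside R) := (contDiff_outside R).of_le (by norm_num)
  obtain ⟨_, hc'⟩ := contDiff_one_iff_deriv.mp ho
  obtain ⟨A, hA⟩ := isCompact_Icc.exists_bound_of_continuousOn
    (s := Set.Icc (0 : ℝ) 1) hc.continuousOn
  obtain ⟨B, hB⟩ := isCompact_Icc.exists_bound_of_continuousOn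
    (s := Set.Icc (-(R + 1)) (R + 1)) hc'.continuousOn
  refine ⟨|A| * |B|, by positivity, fun N X hX => ?_⟩
  rw [norm_smul]
  gcongr
  · rw [norm_neg, Complex.norm_real]
    exact (hA _ ⟨outsideMass_nonneg R X, (outsideMass_lt_one_of_cutoff hX).le⟩).trans
      (le_abs_self A)
  · exact norm_cfc_le_of_abs_le (normLE_of_cutoff hR hX i) (abs_nonneg _) fun x hx =>
      (hB x (abs_le.mp hx)).trans (le_abs_self B)

/-! ### Fluctuations -/

/-- The defect in the Dyson–Schwinger equation for the empirical distribution. -/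
def defect (V : NCSmooth ℓ) (i : Fin ℓ) (P : NCPoly ℓ) (X : HermTuple ℓ N) : ℂ :=
  (1 / N : ℂ) * (eval (V.cyclicDeriv i * polyElt P) X).trace -
    (1 / N : ℂ) ^ 2 * traceSq X (polyDeriv i P)

/-- The polynomial version of `defect`, with a polynomial `Q` in the place of `𝒟_i V`. -/
def polyDefect (Q : NCPoly ℓ) (i : Fin ℓ) (P : NCPoly ℓ) (X : HermTuple ℓ N) : ℂ :=
  (1 / N : ℂ) * (eval (polyElt (Q * P)) X).trace - (1 / N : ℂ) ^ 2 * traceSq X (polyDeriv i P)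

theorem continuous_traceSq (T : NCPoly ℓ ⊗[ℂ] NCPoly ℓ) :
    Continuous fun X : HermTuple ℓ N => traceSq X T := by
  induction T with
  | zero => simpa using continuous_const
  | add a b ha hb => simp only [map_add]; exact ha.add hb
  | tmul u v =>
    exact ((continuous_eval_polyElt u).matrix_trace).mul (continuous_eval_polyElt v).matrix_trace

theorem continuous_defect (V : NCSmooth ℓ) (i : Fin ℓ) (P : NCPoly ℓ) :
    Continuous (defect V i P : HermTuple ℓ N → ℂ) :=
  (continuous_const.mul ((continuous_eval_cyclicDeriv V i).mul
    (continuous_eval_polyElt P)).matrix_trace).sub (continuous_const.mul (continuous_traceSq _))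

theorem sandwich_comm_left_mul (X : HermTuple ℓ N) (u : NCPoly ℓ) (T : NCPoly ℓ ⊗[ℂ] NCPoly ℓ) :
    sandwich X 1 (TensorProduct.comm ℂ _ _ ((u ⊗ₜ 1) * T)) =
      sandwich X (eval (polyElt u) X) (TensorProduct.comm ℂ _ _ T) := by
  induction T with
  | zero => simp
  | add a b ha hb => simp only [mul_add, map_add, ha, hb]
  | tmul a b => simp [eval_mul, mul_assoc]

theorem sandwich_comm_mul_right (X : HermTuple ℓ N) (u : NCPoly ℓ) (T : NCPoly ℓ ⊗[ℂ] NCPoly ℓ) :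
    sandwich X 1 (TensorProduct.comm ℂ _ _ (T * (1 ⊗ₜ u))) =
      sandwich X (1 : Matrix (Fin N) (Fin N) ℂ) ((1 ⊗ₜ 1) * TensorProduct.comm ℂ _ _ T *
        (u ⊗ₜ 1)) := by
  induction T with
  | zero => simp
  | add a b ha hb => simp only [mul_add, add_mul, map_add, ha, hb]
  | tmul a b => simp

theorem sandwich_mul_right (X : HermTuple ℓ N) (u : NCPoly ℓ) (T : NCPoly ℓ ⊗[ℂ] NCPoly ℓ) :
    sandwich X (1 : Matrix (Fin N) (Fin N) ℂ) (T * (u ⊗ₜ 1)) =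
      sandwich X (eval (polyElt u) X) T := by
  induction T with
  | zero => simp
  | add a b ha hb => simp only [add_mul, map_add, ha, hb]
  | tmul a b => simp [eval_mul, mul_assoc]

/-- In a product each factor is differentiated with the other one placed in the middle. This
separates the factor p(X_i), whose degree is not controlled, from the fixed polynomials. -/
theorem eval_polyCyclicDeriv_mul (X : HermTuple ℓ N) (i : Fin ℓ) (u v : NCPoly ℓ) :
    eval (polyElt (polyCyclicDeriv i (u * v))) X =
      sandwich X (eval (polyElt v) X) (TensorProduct.comm ℂ _ _ (polyDeriv i u)) +
        sandwich X (eval (polyElt u) X) (TensorProduct.comm ℂ _ _ (polyDeriv i v)) := by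
  rw [polyCyclicDeriv_eq, ← sandwich_one, polyDeriv_mul, map_add, map_add, sandwich_comm_left_mul,
    sandwich_comm_mul_right, ← Algebra.TensorProduct.one_def, one_mul, sandwich_mul_right]

/-- Bounds for the gradient of `polyDefect`, uniform in the polynomial `p` that replaces a smooth
function. -/
theorem exists_grad_polyDefect_le (Q₀ : NCPoly ℓ) (i : Fin ℓ) (P : NCPoly ℓ) (S L : ℝ) :
    ∃ C : ℝ, 0 ≤ C ∧ ∀ (N : ℕ) (p : Polynomial ℝ), 1 ≤ N →
      (∀ x, |x| ≤ S → |p.eval x| ≤ L ∧ |p.derivative.eval x| ≤ L) →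
      ∃ Γ : HermTuple ℓ N → Matrix (Fin N) (Fin N) ℂ,
        HasGrad i (polyDefect (Q₀ + polyX i p) i P) Γ ∧
          ∀ X, NormLE S X → ‖(eval (polyElt P) X * star (Γ X)).trace‖ ≤ C := by
  obtain ⟨C₀, hC₀, h₀⟩ := exists_norm_eval_polyElt_le P S
  obtain ⟨C₁, hC₁, h₁⟩ := exists_norm_eval_polyElt_le (polyCyclicDeriv i (Q₀ * P)) S
  obtain ⟨C₂, hC₂, h₂⟩ := exists_norm_sandwich_le
    (TensorProduct.comm ℂ _ _ (polyDeriv i P)) S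
  obtain ⟨C₃, hC₃, h₃⟩ := exists_hasGrad_traceSq i (polyDeriv i P) S
  -- The terms come from, in order: the derivative of the fixed product Q₀ P, the derivative of
  -- p(X_i) paired with P and its adjoint, the derivative of P with p(X_i) in the middle, and the
  -- derivative of the product of traces.
  refine ⟨C₀ * C₁ + (|L| * (C₀ * C₀) + C₀ * (C₂ * |L|)) + C₀ * C₃, by positivity,
    fun N p hN hp => ?_⟩
  obtain ⟨Γ, hΓ, hb⟩ := h₃ N
  have hN0 : (0 : ℝ) < N := by exact_mod_cast hN
  refine ⟨_, (((hasGrad_trace i ((Q₀ + polyX i p) * P)).const_mul (1 / N : ℂ)).sub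
    (hΓ.const_mul ((1 / N : ℂ) ^ 2))), fun X hX => ?_⟩
  have hP := h₀ N X hX
  have hstar : ∀ B : Matrix (Fin N) (Fin N) ℂ,
      ‖(eval (polyElt P) X * star B).trace‖ = ‖(B * star (eval (polyElt P) X)).trace‖ := fun B => by
    rw [← norm_star, ← Matrix.trace_conjTranspose, Matrix.conjTranspose_mul]
    congr 2
    exact congrArg (· * _) (star_star B)
  have hgen : ∀ B : Matrix (Fin N) (Fin N) ℂ, ‖(B * star (eval (polyElt P) X)).trace‖ ≤
      N * (C₀ * ‖B‖) := fun B => by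
    refine (norm_trace_le _).trans ?_
    gcongr
    refine (norm_mul_le _ _).trans ?_
    rw [norm_star, mul_comm]
    gcongr
  have hLp : ∀ x, |x| ≤ S → |p.derivative.eval x| ≤ |L| := fun x hx =>
    (hp x hx).2.trans (le_abs_self L)
  have e1 : ‖(eval (polyElt (polyCyclicDeriv i ((Q₀ + polyX i p) * P))) X *
      star (eval (polyElt P) X)).trace‖ ≤
      N * (C₀ * C₁ + (|L| * (C₀ * C₀) + C₀ * (C₂ * |L|))) := by
    rw [add_mul, map_add, map_add, eval_add, eval_polyCyclicDeriv_mul X i (polyX i p), add_mul,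
      add_mul, Matrix.trace_add, Matrix.trace_add]
    refine (norm_add_le _ _).trans ?_
    rw [mul_add]
    refine add_le_add ((hgen _).trans (by gcongr; exact h₁ N X hX)) ?_
    refine (norm_add_le _ _).trans ?_
    rw [mul_add]
    refine add_le_add ?_ ((hgen _).trans ?_)
    · refine (norm_trace_sandwich_polyX_le (hX i) hLp _ _).trans ?_
      rw [norm_star]
      calc |L| * (N * ‖eval (polyElt P) X‖ * ‖eval (polyElt P) X‖) ≤ |L| * (N * C₀ * C₀) := by
            gcongr
        _ = _ := by ring
    · gcongr
      refine (h₂ N X _ hX).trans ?_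
      gcongr
      rw [eval_polyX]
      exact norm_cfc_le_of_abs_le (hX i) (abs_nonneg _) fun x hx =>
        (hp x hx).1.trans (le_abs_self L)
  have e2 : ‖(Γ X * star (eval (polyElt P) X)).trace‖ ≤ N * (C₀ * (C₃ * N)) :=
    (hgen _).trans (by gcongr; exact hb X hX)
  rw [hstar, sub_mul, smul_mul_assoc, smul_mul_assoc, Matrix.trace_sub, Matrix.trace_smul,
    Matrix.trace_smul]
  refine (norm_sub_le _ _).trans ?_
  rw [norm_smul, norm_smul]
  have hn1 : ‖(1 / N : ℂ)‖ = 1 / N := by simp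
  have hn2 : ‖(1 / N : ℂ) ^ 2‖ = (1 / N) ^ 2 := by rw [norm_pow, hn1]
  rw [hn1, hn2]
  refine add_le_add ?_ ?_
  · calc _ ≤ 1 / (N : ℝ) * (N * (C₀ * C₁ + (|L| * (C₀ * C₀) + C₀ * (C₂ * |L|)))) := by gcongr
      _ = _ := by field_simp
  · calc _ ≤ (1 / (N : ℝ)) ^ 2 * (N * (C₀ * (C₃ * N))) := by gcongr
      _ = _ := by field_simp

/-! ### Second moment of the truncated defect -/

theorem integrable_gibbsDensity {V : NCSmooth ℓ} (h : partitionFun N V ≠ ⊤) :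
    Integrable (fun X : HermTuple ℓ N => gibbsDensity V X) (lebesgueHerm ℓ N) := by
  have hc : Continuous fun X : HermTuple ℓ N => gibbsDensity V X := by
    refine Real.continuous_exp.comp (continuous_const.mul (Complex.continuous_re.comp ?_)).neg
    simp only [NCSmooth.elt, eval_add, eval_sum, eval_smoothElt]
    exact ((continuous_eval_polyElt _).add (continuous_finsetSum _ fun j _ =>
      continuous_cfc (V.contDiff j).continuous j)).matrix_trace
  refine ⟨hc.aestronglyMeasurable, ?_⟩
  rw [hasFiniteIntegral_iff_ofReal (f := fun X : HermTuple ℓ N => gibbsDensity V X)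
    (Eventually.of_forall fun X => (Real.exp_pos _).le)]
  exact h.lt_top

/-- The quadratic bound obtained by integrating by parts against the defect itself. -/
theorem integral_defect_sq_le {V : NCSmooth ℓ} (hV : V.IsSelfAdj) (i : Fin ℓ) (P : NCPoly ℓ)
    {R : ℝ} (hR : 0 ≤ R) (hN : 1 ≤ N) (hZ : partitionFun N V ≠ ⊤) {C : ℝ} (hC : 0 ≤ C)
    {Ψ : HermTuple ℓ N → ℂ} {Γ : HermTuple ℓ N → Matrix (Fin N) (Fin N) ℂ} (hΨ : HasGrad i Ψ Γ)
    (hΓ : ∀ X, cutoff R X ≠ 0 → ‖(eval (polyElt P) X * star (Γ X)).trace‖ ≤ C)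
    (hd : ∀ X, cutoff R X ≠ 0 → ‖defect V i P X - Ψ X‖ ≤ C / N)
    (hcut : ∀ X : HermTuple ℓ N, cutoff R X ≠ 0 → ‖(eval (polyElt P) X *
      (-deriv Real.smoothTransition (outsideMass R X) : ℂ) •
        cfc (deriv (outside R)) (X i : Matrix (Fin N) (Fin N) ℂ)).trace‖ ≤ C * N) :
    N ^ 2 * ∫ X, (‖Ψ X‖ * cutoff R X) ^ 2 * gibbsDensity V X ∂lebesgueHerm ℓ N ≤
      (2 * C + 9 * C ^ 2) * ∫ X, gibbsDensity V X ∂lebesgueHerm ℓ N := by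
  have hN0 : (0 : ℝ) < N := by exact_mod_cast hN
  have hNC : (N : ℂ) ≠ 0 := by exact_mod_cast hN0.ne'
  have hf := hasGrad_cutoff (N := N) R i
  have hw0 : ∀ X : HermTuple ℓ N, 0 < gibbsDensity V X := fun X => Real.exp_pos _
  have hwi := integrable_gibbsDensity hZ
  have hwc : Continuous fun X : HermTuple ℓ N => (gibbsDensity V X : ℂ) :=
    (hasGrad_gibbsDensity (N := N) i hV).cont
  have hfs : BoundedSupport fun X : HermTuple ℓ N => (cutoff R X : ℂ) :=
    ⟨R + 1, fun X hX => normLE_of_cutoff hR (by simpa using hX)⟩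
  set Q : HermTuple ℓ N → Matrix (Fin N) (Fin N) ℂ := fun X => eval (polyElt P) X
  set Γf : HermTuple ℓ N → Matrix (Fin N) (Fin N) ℂ := fun X =>
    (-deriv Real.smoothTransition (outsideMass R X) : ℂ) •
        cfc (deriv (outside R)) (X i : Matrix (Fin N) (Fin N) ℂ)
  -- With the test function conj(Ψ) f², the left side of the integration by parts is N² times the
  -- second moment of f Ψ, up to the difference between `defect` and Ψ.
  have hg := (hΨ.star.mul (hf.mul hf))
  have hgs : BoundedSupport fun X => star (Ψ X) * ((cutoff R X : ℂ) * (cutoff R X : ℂ)) :=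
    hfs.of_imp fun X hX h0 => hX (by rw [h0]; simp)
  have hibp := integration_by_parts i P hV hg hgs
  set u : HermTuple ℓ N → ℝ := fun X => ‖Ψ X‖ * cutoff R X with hu
  -- the integrand is an integrated derivative, up to the difference of the two defects
  have hA : ∀ X, (N : ℂ) ^ 2 * (((u X) ^ 2 * gibbsDensity V X : ℝ) : ℂ) =
      (N * (eval (V.cyclicDeriv i * polyElt P) X).trace - traceSq X (polyDeriv i P)) *
        (star (Ψ X) * ((cutoff R X : ℂ) * (cutoff R X : ℂ))) * gibbsDensity V X -
      (N : ℂ) ^ 2 * ((defect V i P X - Ψ X) *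
        (star (Ψ X) * ((cutoff R X : ℂ) * (cutoff R X : ℂ)))) * gibbsDensity V X := by
    intro X
    have h1 : (N : ℂ) ^ 2 * defect V i P X =
        N * (eval (V.cyclicDeriv i * polyElt P) X).trace - traceSq X (polyDeriv i P) := by
      rw [defect]; field_simp
    have h2 : ((‖Ψ X‖ : ℂ)) ^ 2 = Ψ X * star (Ψ X) := (Complex.mul_conj' _).symm
    rw [← h1, hu]
    push_cast
    rw [mul_pow, h2]
    ring
  have hcΓ : Continuous fun X => (Q X * ((((cutoff R X : ℂ) * (cutoff R X : ℂ)) • star (Γ X) +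
      star (Ψ X) • ((cutoff R X : ℂ) • Γf X + (cutoff R X : ℂ) • Γf X)))).trace :=
    ((continuous_eval_polyElt P).mul hg.cont_grad).matrix_trace
  have hi1 : Integrable (fun X => (Q X * ((((cutoff R X : ℂ) * (cutoff R X : ℂ)) • star (Γ X) +
      star (Ψ X) • ((cutoff R X : ℂ) • Γf X + (cutoff R X : ℂ) • Γf X)))).trace *
      (gibbsDensity V X : ℂ)) (lebesgueHerm ℓ N) :=
    (hfs.of_imp fun X hX h0 => hX (by rw [h0]; simp)).integrable (hcΓ.mul hwc)
  have hi2 : Integrable (fun X => (N : ℂ) ^ 2 * ((defect V i P X - Ψ X) *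
      (star (Ψ X) * ((cutoff R X : ℂ) * (cutoff R X : ℂ)))) * (gibbsDensity V X : ℂ))
      (lebesgueHerm ℓ N) :=
    (hfs.of_imp fun X hX h0 => hX (by rw [h0]; simp)).integrable
      ((continuous_const.mul (((continuous_defect V i P).sub hΨ.cont).mul hg.cont)).mul hwc)
  have hi3 : Integrable (fun X => (N * (eval (V.cyclicDeriv i * polyElt P) X).trace -
      traceSq X (polyDeriv i P)) * (star (Ψ X) * ((cutoff R X : ℂ) * (cutoff R X : ℂ))) *
      (gibbsDensity V X : ℂ)) (lebesgueHerm ℓ N) := by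
    refine (hfs.of_imp fun X hX h0 => hX (by rw [h0]; simp)).integrable
      (((Continuous.sub ?_ (continuous_traceSq _)).mul hg.cont).mul hwc)
    exact continuous_const.mul ((continuous_eval_cyclicDeriv V i).mul
      (continuous_eval_polyElt P)).matrix_trace
  have hcu : Continuous u := by
    have : Continuous fun X : HermTuple ℓ N => cutoff R X := by
      simpa [Function.comp_def] using Complex.continuous_re.comp hf.cont
    exact hΨ.cont.norm.mul this
  have hcwr : Continuous fun X : HermTuple ℓ N => gibbsDensity V X := by
    simpa [Function.comp_def] using Complex.continuous_re.comp hwc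
  have hi4 : Integrable (fun X => (u X) ^ 2 * gibbsDensity V X) (lebesgueHerm ℓ N) := by
    have : Integrable (fun X => (((u X) ^ 2 * gibbsDensity V X : ℝ) : ℂ)) (lebesgueHerm ℓ N) :=
      (hfs.of_imp fun X hX h0 => hX (by
        have h0' : cutoff R X = 0 := by exact_mod_cast h0
        simp [hu, h0'])).integrable
        (Complex.continuous_ofReal.comp ((hcu.pow 2).mul hcwr))
    exact this.re.congr (Eventually.of_forall fun X => Complex.ofReal_re _)
  have hE : (N : ℂ) ^ 2 * ((∫ X, (u X) ^ 2 * gibbsDensity V X ∂lebesgueHerm ℓ N : ℝ) : ℂ) =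
      ∫ X, ((Q X * ((((cutoff R X : ℂ) * (cutoff R X : ℂ)) • star (Γ X) +
      star (Ψ X) • ((cutoff R X : ℂ) • Γf X + (cutoff R X : ℂ) • Γf X)))).trace *
      (gibbsDensity V X : ℂ) - (N : ℂ) ^ 2 * ((defect V i P X - Ψ X) *
      (star (Ψ X) * ((cutoff R X : ℂ) * (cutoff R X : ℂ)))) * (gibbsDensity V X : ℂ))
        ∂lebesgueHerm ℓ N := by
    rw [integral_sub hi1 hi2, ← hibp, ← integral_sub hi3 hi2, ← integral_complex_ofReal,
      ← integral_const_mul]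
    exact integral_congr_ae (Eventually.of_forall hA)
  have hbound : ∀ X, ‖(Q X * ((((cutoff R X : ℂ) * (cutoff R X : ℂ)) • star (Γ X) +
      star (Ψ X) • ((cutoff R X : ℂ) • Γf X + (cutoff R X : ℂ) • Γf X)))).trace *
      (gibbsDensity V X : ℂ) - (N : ℂ) ^ 2 * ((defect V i P X - Ψ X) *
      (star (Ψ X) * ((cutoff R X : ℂ) * (cutoff R X : ℂ)))) * (gibbsDensity V X : ℂ)‖ ≤
      (C + 9 / 2 * C ^ 2) * gibbsDensity V X +
        (N : ℝ) ^ 2 / 2 * ((u X) ^ 2 * gibbsDensity V X) := by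
    intro X
    have hpos := hw0 X
    by_cases h0 : cutoff R X = 0
    · rw [h0]
      simp only [Complex.ofReal_zero, mul_zero, zero_mul, zero_smul, add_zero, smul_zero,
        Matrix.trace_zero, sub_zero, norm_zero]
      positivity
    have hc0 := cutoff_nonneg R X
    have hc1 := cutoff_le_one R X
    have b1 := hΓ X h0
    have b2 := hd X h0
    have b3 : ‖(Q X * Γf X).trace‖ ≤ C * N := hcut X h0
    have hnc : ‖(cutoff R X : ℂ)‖ = cutoff R X := by
      rw [Complex.norm_real, Real.norm_of_nonneg hc0]
    rw [← sub_mul, norm_mul, Complex.norm_real, Real.norm_of_nonneg hpos.le]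
    have hmain : ‖(Q X * ((((cutoff R X : ℂ) * (cutoff R X : ℂ)) • star (Γ X) +
      star (Ψ X) • ((cutoff R X : ℂ) • Γf X + (cutoff R X : ℂ) • Γf X)))).trace -
      (N : ℂ) ^ 2 * ((defect V i P X - Ψ X) *
      (star (Ψ X) * ((cutoff R X : ℂ) * (cutoff R X : ℂ))))‖ ≤ C + 3 * C * (N * u X) := by
      rw [← smul_add, mul_add, mul_smul_comm, mul_smul_comm, mul_smul_comm, ← two_smul ℂ (Γf X),
        mul_smul_comm]
      simp only [Matrix.trace_add, Matrix.trace_smul, smul_eq_mul]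
      refine (norm_sub_le _ _).trans ?_
      refine (add_le_add_left (norm_add_le _ _) _).trans ?_
      simp only [norm_mul, norm_pow, hnc, norm_star, Complex.norm_natCast, Complex.norm_ofNat]
      have t1 : cutoff R X * cutoff R X * ‖(Q X * star (Γ X)).trace‖ ≤ C := by
        have : cutoff R X * cutoff R X ≤ 1 := mul_le_one₀ hc1 hc0 hc1
        calc _ ≤ 1 * C := mul_le_mul this b1 (norm_nonneg _) zero_le_one
          _ = C := one_mul C
      have t2 : ‖Ψ X‖ * (cutoff R X * (2 * ‖(Q X * Γf X).trace‖)) ≤ 2 * C * (N * u X) := by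
        calc _ ≤ ‖Ψ X‖ * (cutoff R X * (2 * (C * N))) := by gcongr
          _ = _ := by rw [hu]; ring
      have t3 : (N : ℝ) ^ 2 * (‖defect V i P X - Ψ X‖ * (‖Ψ X‖ * (cutoff R X * cutoff R X))) ≤
          C * (N * u X) := by
        calc _ ≤ (N : ℝ) ^ 2 * (C / N * (‖Ψ X‖ * (cutoff R X * 1))) := by gcongr
          _ = _ := by rw [hu]; field_simp
      linarith
    -- Of the linear terms, 2C comes from the gradient of the squared cutoff and C from replacing
    -- the defect by Ψ. Half of the second moment is absorbed by the left side, and doubling the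
    -- rest gives 2C + 9C².
    have hamgm : C + 3 * C * (N * u X) ≤ C + 9 / 2 * C ^ 2 + (N : ℝ) ^ 2 / 2 * (u X) ^ 2 := by
      nlinarith [sq_nonneg (3 * C - N * u X)]
    calc _ ≤ (C + 9 / 2 * C ^ 2 + (N : ℝ) ^ 2 / 2 * (u X) ^ 2) * gibbsDensity V X := by
          gcongr
          exact hmain.trans hamgm
      _ = _ := by ring
  have hfin := norm_integral_le_of_norm_le
    ((hwi.const_mul (C + 9 / 2 * C ^ 2)).add (hi4.const_mul ((N : ℝ) ^ 2 / 2)))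
    (Eventually.of_forall hbound)
  have hI0 : 0 ≤ ∫ X, (u X) ^ 2 * gibbsDensity V X ∂lebesgueHerm ℓ N :=
    integral_nonneg fun X => mul_nonneg (sq_nonneg _) (hw0 X).le
  rw [← hE, norm_mul, norm_pow, Complex.norm_natCast, Complex.norm_real,
    Real.norm_of_nonneg hI0] at hfin
  simp only [Pi.add_apply] at hfin
  rw [integral_add (hwi.const_mul _) (hi4.const_mul _), integral_const_mul,
    integral_const_mul] at hfin
  linarith

/-- The quadratic bound is available for test functions with a known gradient, here polynomial
defects. The smooth part of 𝒟_i V is replaced by a polynomial that depends on N, which is why the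
gradient bounds had to be uniform in that polynomial. -/
theorem exists_integral_defect_sq_le {V : NCSmooth ℓ} (hV : V.IsSelfAdj) (i : Fin ℓ)
    (P : NCPoly ℓ) {R : ℝ} (hR : 0 ≤ R) : ∃ C : ℝ, 0 ≤ C ∧ ∀ N : ℕ, 1 ≤ N →
      partitionFun N V ≠ ⊤ →
      Integrable (fun X : HermTuple ℓ N => (‖defect V i P X‖ * cutoff R X) ^ 2 *
        gibbsDensity V X) (lebesgueHerm ℓ N) ∧
      ∫ X : HermTuple ℓ N, (‖defect V i P X‖ * cutoff R X) ^ 2 * gibbsDensity V X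
        ∂lebesgueHerm ℓ N ≤ C / N ^ 2 * ∫ X, gibbsDensity V X ∂lebesgueHerm ℓ N := by
  set θ := deriv (V.smooth i) with hθ
  have hθs : ContDiff ℝ ∞ θ := (contDiff_infty_iff_deriv.mp (V.contDiff i)).2
  have hθ1 : ContDiff ℝ 1 θ := hθs.of_le (by norm_num)
  obtain ⟨_, hθc⟩ := contDiff_one_iff_deriv.mp hθ1
  obtain ⟨A, hA⟩ := isCompact_Icc.exists_bound_of_continuousOn
    (s := Set.Icc (-(R + 1)) (R + 1)) hθs.continuous.continuousOn
  obtain ⟨B, hB⟩ := isCompact_Icc.exists_bound_of_continuousOn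
    (s := Set.Icc (-(R + 1)) (R + 1)) hθc.continuousOn
  obtain ⟨C₁, hC₁, h₁⟩ := exists_grad_polyDefect_le (polyCyclicDeriv i V.poly) i P (R + 1)
    (|A| + |B| + 1)
  obtain ⟨C₂, hC₂, h₂⟩ := exists_norm_eval_polyElt_le P (R + 1)
  obtain ⟨C₃, hC₃, h₃⟩ := exists_norm_grad_cutoff_le hR i
  set C := C₁ + C₂ + C₂ * C₃ with hC
  have hC0 : 0 ≤ C := by positivity
  refine ⟨2 * (2 * C + 9 * C ^ 2) + 2 * C ^ 2, by positivity, fun N hN hZ => ?_⟩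
  have hN0 : (0 : ℝ) < N := by exact_mod_cast hN
  have hN1 : (1 : ℝ) ≤ N := by exact_mod_cast hN
  -- The precision 1/N keeps the difference of the two defects of order 1/N, the size of the
  -- fluctuations themselves.
  obtain ⟨p, hp⟩ := exists_polynomial_near_deriv hθ1 (R + 1) (ε := 1 / N) (by positivity)
  have hinv : 1 / (N : ℝ) ≤ 1 := by rw [div_le_one hN0]; exact hN1
  obtain ⟨Γ, hΓ, hΓb⟩ := h₁ N p hN fun x hx => by
    have a1 : |θ x| ≤ A := hA x (abs_le.mp hx)
    have a2 : |deriv θ x| ≤ B := hB x (abs_le.mp hx)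
    obtain ⟨a3, a4⟩ := hp x hx
    have a5 := abs_sub_abs_le_abs_sub (p.eval x) (θ x)
    have a6 := abs_sub_abs_le_abs_sub (p.derivative.eval x) (deriv θ x)
    constructor <;> linarith [le_abs_self A, le_abs_self B, abs_nonneg A, abs_nonneg B]
  have hd : ∀ X : HermTuple ℓ N, cutoff R X ≠ 0 →
      ‖defect V i P X - polyDefect (polyCyclicDeriv i V.poly + polyX i p) i P X‖ ≤ C / N := by
    intro X hX
    have hXn := normLE_of_cutoff hR hX
    have e : defect V i P X - polyDefect (polyCyclicDeriv i V.poly + polyX i p) i P X =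
        (1 / N : ℂ) * ((cfc θ (X i : Matrix (Fin N) (Fin N) ℂ) -
          cfc (fun x => p.eval x) (X i : Matrix (Fin N) (Fin N) ℂ)) *
            eval (polyElt P) X).trace := by
      rw [defect, polyDefect, NCSmooth.cyclicDeriv, map_mul, map_add, eval_mul, eval_mul, eval_add,
        eval_add, eval_polyX, eval_smoothElt, sub_mul, add_mul, add_mul, Matrix.trace_sub,
        Matrix.trace_add, Matrix.trace_add]
      ring
    rw [e, norm_mul]
    have hn1 : ‖(1 / N : ℂ)‖ = 1 / N := by simp
    rw [hn1]
    have h4 := norm_cfc_sub_le (A := X i) hθs.continuous p.continuous (hXn i)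
      (c := 1 / N) (by positivity) fun x hx => by rw [abs_sub_comm]; exact (hp x hx).1
    calc _ ≤ 1 / (N : ℝ) * (N * (1 / N * C₂)) := by
          gcongr
          refine (norm_trace_le _).trans ?_
          gcongr
          refine (norm_mul_le _ _).trans ?_
          gcongr
          exact h₂ N X hXn
      _ = C₂ / N := by field_simp
      _ ≤ C / N := by
          gcongr
          rw [hC]
          nlinarith [mul_nonneg hC₂ hC₃]
  have key := integral_defect_sq_le hV i P hR hN hZ hC0 hΓ
    (fun X hX => (hΓb X (normLE_of_cutoff hR hX)).trans (by
      rw [hC]; nlinarith [mul_nonneg hC₂ hC₃])) hd (fun X hX => by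
      refine (norm_trace_le _).trans ?_
      rw [mul_comm]
      gcongr
      refine (norm_mul_le _ _).trans ?_
      calc _ ≤ C₂ * C₃ := by
            gcongr
            · exact h₂ N X (normLE_of_cutoff hR hX)
            · exact h₃ N X hX
        _ ≤ C := by rw [hC]; linarith)
  set Ψ : HermTuple ℓ N → ℂ := polyDefect (polyCyclicDeriv i V.poly + polyX i p) i P
  have hcut : Continuous fun X : HermTuple ℓ N => cutoff R X := by
    simpa [Function.comp_def] using Complex.continuous_re.comp (hasGrad_cutoff R i).cont
  have hwc : Continuous fun X : HermTuple ℓ N => gibbsDensity V X := by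
    simpa [Function.comp_def] using
      Complex.continuous_re.comp (hasGrad_gibbsDensity (N := N) i hV).cont
  have hfs : BoundedSupport fun X : HermTuple ℓ N => (cutoff R X : ℂ) :=
    ⟨R + 1, fun X hX => normLE_of_cutoff hR (by simpa using hX)⟩
  have hint : ∀ F : HermTuple ℓ N → ℂ, Continuous F →
      Integrable (fun X => (‖F X‖ * cutoff R X) ^ 2 * gibbsDensity V X) (lebesgueHerm ℓ N) := by
    intro F hF
    have : Integrable (fun X => (((‖F X‖ * cutoff R X) ^ 2 * gibbsDensity V X : ℝ) : ℂ))
        (lebesgueHerm ℓ N) :=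
      (hfs.of_imp fun X hX h0 => hX (by
        have h0' : cutoff R X = 0 := by exact_mod_cast h0
        simp [h0'])).integrable
        (Complex.continuous_ofReal.comp (((hF.norm.mul hcut).pow 2).mul hwc))
    exact this.re.congr (Eventually.of_forall fun X => Complex.ofReal_re _)
  have hi1 := hint _ (continuous_defect V i P)
  have hi2 := hint _ hΓ.cont
  have hi3 := integrable_gibbsDensity hZ
  refine ⟨hi1, ?_⟩
  have hpt : ∀ X : HermTuple ℓ N, (‖defect V i P X‖ * cutoff R X) ^ 2 * gibbsDensity V X ≤
      2 * ((‖Ψ X‖ * cutoff R X) ^ 2 * gibbsDensity V X) +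
        2 * (C / N) ^ 2 * gibbsDensity V X := by
    intro X
    have hw0 : 0 < gibbsDensity V X := Real.exp_pos _
    have h5 : ‖defect V i P X‖ * cutoff R X ≤ ‖Ψ X‖ * cutoff R X + C / N := by
      by_cases h0 : cutoff R X = 0
      · rw [h0, mul_zero, mul_zero, zero_add]
        positivity
      have h6 := hd X h0
      have h7 := norm_sub_norm_le (defect V i P X) (Ψ X)
      have h8 := cutoff_nonneg R X
      have h9 := cutoff_le_one R X
      have h10 : 0 ≤ C / (N : ℝ) := by positivity
      nlinarith
    have h11 : 0 ≤ ‖defect V i P X‖ * cutoff R X :=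
      mul_nonneg (norm_nonneg _) (cutoff_nonneg R X)
    have h12 : (‖defect V i P X‖ * cutoff R X) ^ 2 ≤
        2 * (‖Ψ X‖ * cutoff R X) ^ 2 + 2 * (C / N) ^ 2 := by
      calc _ ≤ (‖Ψ X‖ * cutoff R X + C / N) ^ 2 := by gcongr
        _ ≤ _ := by nlinarith [sq_nonneg (‖Ψ X‖ * cutoff R X - C / N)]
    nlinarith
  have hmono := integral_mono hi1 ((hi2.const_mul 2).add (hi3.const_mul (2 * (C / N) ^ 2))) hpt
  simp only [Pi.add_apply] at hmono
  rw [integral_add (hi2.const_mul 2) (hi3.const_mul _), integral_const_mul,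
    integral_const_mul] at hmono
  have hk : ∫ X, (‖Ψ X‖ * cutoff R X) ^ 2 * gibbsDensity V X ∂lebesgueHerm ℓ N ≤
      (2 * C + 9 * C ^ 2) / N ^ 2 * ∫ X, gibbsDensity V X ∂lebesgueHerm ℓ N := by
    rw [div_mul_eq_mul_div, le_div_iff₀ (by positivity), mul_comm]
    exact key
  refine hmono.trans ?_
  calc _ ≤ 2 * ((2 * C + 9 * C ^ 2) / N ^ 2 * ∫ X, gibbsDensity V X ∂lebesgueHerm ℓ N) +
        2 * (C / N) ^ 2 * ∫ X, gibbsDensity V X ∂lebesgueHerm ℓ N := by gcongr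
    _ = _ := by field_simp

/-! ### Almost sure vanishing of the truncated defects -/

theorem gibbsWeight_eq (V : NCSmooth ℓ) (X : HermTuple ℓ N) :
    gibbsWeight V X = ENNReal.ofReal (gibbsDensity V X) := rfl

theorem continuous_gibbsDensity (V : NCSmooth ℓ) :
    Continuous fun X : HermTuple ℓ N => gibbsDensity V X := by
  refine Real.continuous_exp.comp (continuous_const.mul (Complex.continuous_re.comp ?_)).neg
  simp only [NCSmooth.elt, eval_add, eval_sum, eval_smoothElt]
  exact ((continuous_eval_polyElt _).add (continuous_finsetSum _ fun j _ =>
    continuous_cfc (V.contDiff j).continuous j)).matrix_trace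

theorem gibbs_univ (N : ℕ) (V : NCSmooth ℓ) :
    gibbs N V Set.univ = (partitionFun N V)⁻¹ * partitionFun N V := by
  rw [gibbs, Measure.smul_apply, withDensity_apply _ MeasurableSet.univ, Measure.restrict_univ]
  rfl

theorem lintegral_gibbs (V : NCSmooth ℓ) {F : HermTuple ℓ N → ℝ≥0∞} (hF : Measurable F) :
    ∫⁻ X, F X ∂gibbs N V =
      (partitionFun N V)⁻¹ * ∫⁻ X, gibbsWeight V X * F X ∂lebesgueHerm ℓ N := by
  rw [gibbs, lintegral_smul_measure, lintegral_withDensity_eq_lintegral_mul _ ?_ hF]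
  · rfl
  · exact (continuous_gibbsDensity V).measurable.ennreal_ofReal

theorem continuous_cutoff (R : ℝ) : Continuous fun X : HermTuple ℓ N => cutoff R X := by
  refine continuous_const.sub (Real.smoothTransition.continuous.comp ?_)
  exact continuous_finsetSum _ fun j _ => Complex.continuous_re.comp
    (continuous_cfc (contDiff_outside R).continuous j).matrix_trace

theorem measurable_defect_sq (V : NCSmooth ℓ) (i : Fin ℓ) (P : NCPoly ℓ) (R : ℝ) :
    Measurable fun X : HermTuple ℓ N =>
      ENNReal.ofReal ((‖defect V i P X‖ * cutoff R X) ^ 2) :=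
  (((continuous_defect V i P).norm.mul (continuous_cutoff R)).pow 2).measurable.ennreal_ofReal

theorem exists_lintegral_defect_le {V : NCSmooth ℓ} (hV : V.IsSelfAdj) (i : Fin ℓ)
    (P : NCPoly ℓ) {R : ℝ} (hR : 0 ≤ R) : ∃ C : ℝ, 0 ≤ C ∧ ∀ N : ℕ, 1 ≤ N →
      IsProbabilityMeasure (gibbs N V) →
      ∫⁻ X : HermTuple ℓ N, ENNReal.ofReal ((‖defect V i P X‖ * cutoff R X) ^ 2) ∂gibbs N V ≤
        ENNReal.ofReal (C / N ^ 2) := by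
  obtain ⟨C, hC, h⟩ := exists_integral_defect_sq_le hV i P hR
  refine ⟨C, hC, fun N hN hprob => ?_⟩
  have h1 := hprob.measure_univ
  rw [gibbs_univ] at h1
  -- If the partition function were infinite or zero, its product with its inverse would be 0 and
  -- the Gibbs measure would not have mass 1.
  have hZ : partitionFun N V ≠ ⊤ := fun h0 => by simp [h0] at h1
  have hZ0 : partitionFun N V ≠ 0 := fun h0 => by simp [h0] at h1
  obtain ⟨hi, hb⟩ := h N hN hZ
  have hw0 : ∀ X : HermTuple ℓ N, 0 < gibbsDensity V X := fun X => Real.exp_pos _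
  rw [lintegral_gibbs V (measurable_defect_sq V i P R)]
  have e1 : ∫⁻ X, gibbsWeight V X * ENNReal.ofReal ((‖defect V i P X‖ * cutoff R X) ^ 2)
      ∂lebesgueHerm ℓ N = ENNReal.ofReal (∫ X, (‖defect V i P X‖ * cutoff R X) ^ 2 *
        gibbsDensity V X ∂lebesgueHerm ℓ N) := by
    rw [ofReal_integral_eq_lintegral_ofReal hi
      (Eventually.of_forall fun X => mul_nonneg (sq_nonneg _) (hw0 X).le)]
    refine lintegral_congr fun X => ?_
    rw [ENNReal.ofReal_mul (sq_nonneg _), gibbsWeight_eq, mul_comm]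
  have e2 : partitionFun N V = ENNReal.ofReal (∫ X, gibbsDensity V X ∂lebesgueHerm ℓ N) := by
    rw [ofReal_integral_eq_lintegral_ofReal (integrable_gibbsDensity hZ)
      (Eventually.of_forall fun X => (hw0 X).le)]
    rfl
  calc _ ≤ (partitionFun N V)⁻¹ * (ENNReal.ofReal (C / N ^ 2) * partitionFun N V) := by
        rw [e1]
        gcongr
        refine (ENNReal.ofReal_le_ofReal hb).trans ?_
        rw [ENNReal.ofReal_mul (by positivity), ← e2]
    _ = ENNReal.ofReal (C / N ^ 2) := by
        rw [mul_comm, mul_assoc, ENNReal.mul_inv_cancel hZ0 hZ, mul_one]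

/-- Almost surely, the defects in the Dyson–Schwinger equations tend to zero along tuples of
bounded norm. -/
theorem ae_tendsto_defect {V : NCSmooth ℓ} (hV : V.IsSelfAdj) {Ω : Type*} [MeasurableSpace Ω]
    {μ : Measure Ω} [IsProbabilityMeasure μ] {X : (N : ℕ) → Ω → HermTuple ℓ N}
    (hX : ∀ N, 1 ≤ N → HasLaw (X N) (gibbs N V) μ) :
    ∀ᵐ ξ ∂μ, ∀ (i : Fin ℓ) (w : List (Fin ℓ)) (R : ℕ),
      Tendsto (fun N => ‖defect V i (monomial w) (X N ξ)‖ * cutoff R (X N ξ)) atTop (𝓝 0) := by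
  rw [ae_all_iff]
  intro i
  rw [ae_all_iff]
  intro w
  rw [ae_all_iff]
  intro R
  obtain ⟨C, hC, h⟩ := exists_lintegral_defect_le hV i (monomial w) (R := R) (by positivity)
  set F : (N : ℕ) → HermTuple ℓ N → ℝ≥0∞ := fun N X =>
    ENNReal.ofReal ((‖defect V i (monomial w) X‖ * cutoff R X) ^ 2) with hF
  have hFm : ∀ N, Measurable (F N) := fun N => measurable_defect_sq V i (monomial w) R
  have hb : ∀ n : ℕ, ∫⁻ ξ, F (n + 1) (X (n + 1) ξ) ∂μ ≤
      ENNReal.ofReal (C / ((n + 1 : ℕ) : ℝ) ^ 2) := by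
    intro n
    have hl := hX (n + 1) (by omega)
    have hprob : IsProbabilityMeasure (gibbs (n + 1) V) := by
      rw [← hl.map_eq]
      exact Measure.isProbabilityMeasure_map hl.aemeasurable
    rw [← lintegral_map' (hFm (n + 1)).aemeasurable hl.aemeasurable, hl.map_eq]
    exact h (n + 1) (by omega) hprob
  have hae : ∀ n, AEMeasurable (fun ξ => F (n + 1) (X (n + 1) ξ)) μ := fun n =>
    (hFm (n + 1)).comp_aemeasurable (hX (n + 1) (by omega)).aemeasurable
  -- The expectations are summable, so the random series converges almost surely and its terms tend
  -- to 0. Independence plays no role. The index is shifted since the law is prescribed only from N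
  -- = 1 on.
  have hsum : ∫⁻ ξ, ∑' n : ℕ, F (n + 1) (X (n + 1) ξ) ∂μ ≠ ⊤ := by
    rw [lintegral_tsum hae]
    have hs : Summable fun n : ℕ => C / ((n + 1 : ℕ) : ℝ) ^ 2 := by
      have := (summable_nat_add_iff 1).mpr
        (Real.summable_one_div_nat_pow.mpr (by norm_num : 1 < 2))
      simpa [div_eq_mul_inv] using this.mul_left C
    refine ne_top_of_le_ne_top ?_ (ENNReal.tsum_le_tsum hb)
    rw [← ENNReal.ofReal_tsum_of_nonneg (fun n => by positivity) hs]
    exact ENNReal.ofReal_ne_top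
  filter_upwards [ae_lt_top' (AEMeasurable.tsum hae) hsum] with ξ hξ
  have h1 := ENNReal.tendsto_atTop_zero_of_tsum_ne_top hξ.ne
  have h2 : Tendsto (fun n : ℕ => (‖defect V i (monomial w) (X (n + 1) ξ)‖ *
      cutoff R (X (n + 1) ξ)) ^ 2) atTop (𝓝 0) := by
    have := (ENNReal.tendsto_toReal ENNReal.zero_ne_top).comp h1
    refine (this.congr fun n => ?_)
    exact ENNReal.toReal_ofReal (sq_nonneg _)
  rw [← tendsto_add_atTop_iff_nat 1]
  have h3 := (Real.continuous_sqrt.tendsto 0).comp h2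
  rw [Real.sqrt_zero] at h3
  refine h3.congr fun n => ?_
  exact Real.sqrt_sq (mul_nonneg (norm_nonneg _) (cutoff_nonneg _ _))

variable {τ : smoothAlg ℓ →ₗ[ℂ] ℂ}

/-! ### The Hilbert seminorm of a non-commutative law -/

namespace IsNCLaw

theorem nonneg_re (hτ : IsNCLaw τ) (a : smoothAlg ℓ) : 0 ≤ (τ (star a * a)).re := by
  obtain ⟨r, hr, h⟩ := hτ.pos (star a)
  rw [star_star] at h
  rw [h]
  exact hr

theorem im_eq_zero (hτ : IsNCLaw τ) (a : smoothAlg ℓ) : (τ (star a * a)).im = 0 := by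
  obtain ⟨r, hr, h⟩ := hτ.pos (star a)
  rw [star_star] at h
  rw [h]
  exact Complex.ofReal_im r

/-- Positivity at 1 + a and at 1 + i a makes the imaginary part of τ(a) + τ(a*) and the real part of
τ(a) - τ(a*) vanish. -/
theorem map_star (hτ : IsNCLaw τ) (a : smoothAlg ℓ) : τ (star a) = star (τ a) := by
  have h0 := hτ.im_eq_zero a
  have h1 := hτ.im_eq_zero (1 + a)
  have h2 := hτ.im_eq_zero (1 + Complex.I • a)
  have e1 : star (1 + a) * (1 + a) = 1 + a + star a + star a * a := by
    rw [star_add, star_one]; noncomm_ring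
  have e2 : star (1 + Complex.I • a) * (1 + Complex.I • a) =
      1 + Complex.I • a - Complex.I • star a + star a * a := by
    rw [star_add, star_one, star_smul, add_mul, mul_add, mul_add, smul_mul_smul_comm]
    simp
    abel
  rw [e1] at h1
  rw [e2] at h2
  simp only [map_add, map_sub, map_smul, hτ.one, Complex.add_im, Complex.sub_im, Complex.one_im,
    h0, smul_eq_mul, Complex.mul_im, Complex.I_re, Complex.I_im] at h1 h2
  apply Complex.ext
  · simp; linarith
  · simp; linarith

/-- The pre-Hilbert structure `⟨a, b⟩ = τ(a* b)` of a non-commutative law. -/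
abbrev core (hτ : IsNCLaw τ) : PreInnerProductSpace.Core ℂ (smoothAlg ℓ) where
  inner a b := τ (star a * b)
  conj_inner_symm a b := by
    change star (τ (star b * a)) = τ (star a * b)
    rw [← hτ.map_star, star_mul, star_star]
  re_inner_nonneg a := hτ.nonneg_re a
  add_left a b c := by rw [star_add, add_mul, map_add]
  smul_left a b z := by
    rw [star_smul, smul_mul_assoc, map_smul]
    rfl

end IsNCLaw

/-- The `L²` seminorm of a non-commutative law. -/
def norm₂ (τ : smoothAlg ℓ →ₗ[ℂ] ℂ) (a : smoothAlg ℓ) : ℝ := Real.sqrt (τ (star a * a)).re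

theorem norm₂_nonneg (a : smoothAlg ℓ) : 0 ≤ norm₂ τ a := Real.sqrt_nonneg _

namespace IsNCLaw

theorem norm₂_sq (hτ : IsNCLaw τ) (a : smoothAlg ℓ) : norm₂ τ a ^ 2 = (τ (star a * a)).re :=
  Real.sq_sqrt (hτ.nonneg_re a)

theorem norm₂_star (hτ : IsNCLaw τ) (a : smoothAlg ℓ) : norm₂ τ (star a) = norm₂ τ a := by
  rw [norm₂, norm₂, star_star, hτ.trace]

theorem norm_star_mul_le (hτ : IsNCLaw τ) (a b : smoothAlg ℓ) :
    ‖τ (star a * b)‖ ≤ norm₂ τ a * norm₂ τ b := by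
  let := hτ.core
  exact InnerProductSpace.Core.norm_inner_le_norm (𝕜 := ℂ) a b

theorem norm_mul_le (hτ : IsNCLaw τ) (a b : smoothAlg ℓ) :
    ‖τ (a * b)‖ ≤ norm₂ τ a * norm₂ τ b := by
  have := hτ.norm_star_mul_le (star a) b
  rwa [star_star, hτ.norm₂_star] at this

theorem norm₂_add_le (hτ : IsNCLaw τ) (a b : smoothAlg ℓ) :
    norm₂ τ (a + b) ≤ norm₂ τ a + norm₂ τ b := by
  refine le_of_sq_le_sq ?_ (add_nonneg (norm₂_nonneg _) (norm₂_nonneg _))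
  have e : star (a + b) * (a + b) = star a * a + star b * b + star a * b + star b * a := by
    rw [star_add]; noncomm_ring
  have h1 := hτ.norm_star_mul_le a b
  have h2 := hτ.norm_star_mul_le b a
  rw [hτ.norm₂_sq, e, map_add, map_add, map_add, Complex.add_re, Complex.add_re, Complex.add_re,
    ← hτ.norm₂_sq, ← hτ.norm₂_sq]
  have h3 := (Complex.re_le_norm (τ (star a * b))).trans h1
  have h4 := (Complex.re_le_norm (τ (star b * a))).trans h2
  nlinarith

theorem norm₂_smul (z : ℂ) (a : smoothAlg ℓ) : norm₂ τ (z • a) = ‖z‖ * norm₂ τ a := by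
  rw [norm₂, norm₂, star_smul, smul_mul_smul_comm, map_smul, smul_eq_mul]
  have : star z * z = ((‖z‖ ^ 2 : ℝ) : ℂ) := by
    rw [Complex.ofReal_pow]
    exact Complex.conj_mul' z
  rw [this, Complex.re_ofReal_mul, Real.sqrt_mul (sq_nonneg _), Real.sqrt_sq (norm_nonneg _)]

theorem norm₂_one (hτ : IsNCLaw τ) : norm₂ τ 1 = 1 := by
  rw [norm₂, star_one, one_mul, hτ.one, Complex.one_re, Real.sqrt_one]

theorem norm_le_norm₂ (hτ : IsNCLaw τ) (a : smoothAlg ℓ) : ‖τ a‖ ≤ norm₂ τ a := by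
  have := hτ.norm_mul_le 1 a
  rwa [one_mul, hτ.norm₂_one, one_mul] at this

end IsNCLaw

/-- Left multiplication by `b` is bounded by `C` for the `L²` seminorm of `τ`. -/
def IsBoundedBy (τ : smoothAlg ℓ →ₗ[ℂ] ℂ) (b : smoothAlg ℓ) (C : ℝ) : Prop :=
  0 ≤ C ∧ ∀ c, norm₂ τ (b * c) ≤ C * norm₂ τ c

namespace IsBoundedBy

variable {a b : smoothAlg ℓ} {A B : ℝ}

theorem one : IsBoundedBy τ 1 1 := ⟨zero_le_one, fun c => by rw [one_mul, one_mul]⟩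

theorem mul (ha : IsBoundedBy τ a A) (hb : IsBoundedBy τ b B) : IsBoundedBy τ (a * b) (A * B) :=
  ⟨mul_nonneg ha.1 hb.1, fun c => by
    rw [mul_assoc, mul_assoc]
    exact (ha.2 _).trans (mul_le_mul_of_nonneg_left (hb.2 c) ha.1)⟩

theorem add (hτ : IsNCLaw τ) (ha : IsBoundedBy τ a A) (hb : IsBoundedBy τ b B) :
    IsBoundedBy τ (a + b) (A + B) :=
  ⟨add_nonneg ha.1 hb.1, fun c => by
    rw [add_mul, add_mul]
    exact (hτ.norm₂_add_le _ _).trans (add_le_add (ha.2 c) (hb.2 c))⟩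

theorem smul (z : ℂ) (ha : IsBoundedBy τ a A) : IsBoundedBy τ (z • a) (‖z‖ * A) :=
  ⟨mul_nonneg (norm_nonneg _) ha.1, fun c => by
    rw [smul_mul_assoc, IsNCLaw.norm₂_smul, mul_assoc]
    exact mul_le_mul_of_nonneg_left (ha.2 c) (norm_nonneg _)⟩

theorem mono (ha : IsBoundedBy τ a A) (h : A ≤ B) : IsBoundedBy τ a B :=
  ⟨ha.1.trans h, fun c => (ha.2 c).trans (mul_le_mul_of_nonneg_right h (norm₂_nonneg c))⟩

theorem pow (ha : IsBoundedBy τ a A) (n : ℕ) : IsBoundedBy τ (a ^ n) (A ^ n) := by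
  induction n with
  | zero => simpa using one
  | succ n ih => rw [pow_succ, pow_succ]; exact ih.mul ha

theorem star (hτ : IsNCLaw τ) (ha : IsBoundedBy τ a A) : IsBoundedBy τ (star a) A := by
  refine ⟨ha.1, fun c => ?_⟩
  have h1 : norm₂ τ (Star.star a * c) ^ 2 ≤ norm₂ τ (Star.star a * c) * (A * norm₂ τ c) := by
    rw [hτ.norm₂_sq]
    have e : Star.star (Star.star a * c) * (Star.star a * c) =
        Star.star c * (a * (Star.star a * c)) := by
      rw [star_mul, star_star, mul_assoc]
    rw [e]
    refine (Complex.re_le_norm _).trans ((hτ.norm_star_mul_le _ _).trans ?_)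
    calc _ ≤ norm₂ τ c * (A * norm₂ τ (Star.star a * c)) :=
          mul_le_mul_of_nonneg_left (ha.2 _) (norm₂_nonneg _)
      _ = _ := by ring
  rcases (norm₂_nonneg (τ := τ) (Star.star a * c)).eq_or_lt with h0 | h0
  · rw [← h0]
    exact mul_nonneg ha.1 (norm₂_nonneg _)
  · rw [sq] at h1
    exact le_of_mul_le_mul_left h1 h0

/-- Traciality makes the adjoint isometric for the L² seminorm, so bounds for left multiplication
pass to right multiplication. -/
theorem right (hτ : IsNCLaw τ) (ha : IsBoundedBy τ a A) (c : smoothAlg ℓ) :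
    norm₂ τ (c * a) ≤ A * norm₂ τ c := by
  rw [← hτ.norm₂_star, star_mul, ← hτ.norm₂_star c]
  exact (ha.star hτ).2 _

theorem norm_le (hτ : IsNCLaw τ) (ha : IsBoundedBy τ a A) : ‖τ a‖ ≤ A := by
  have h := ha.2 1
  rw [mul_one, hτ.norm₂_one, mul_one] at h
  exact (hτ.norm_le_norm₂ a).trans h

end IsBoundedBy

/-- A self-adjoint element with geometrically bounded moments is bounded. -/
theorem isBoundedBy_of_moments (hτ : IsNCLaw τ) {b : smoothAlg ℓ} (hb : star b = b) {C M : ℝ}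
    (hC : 0 ≤ C) (h : ∀ n : ℕ, (τ (b ^ (2 * n))).re ≤ M * C ^ (2 * n)) : IsBoundedBy τ b C := by
  refine ⟨hC, fun c => ?_⟩
  rcases (norm₂_nonneg (τ := τ) c).eq_or_lt with h0 | h0
  · -- a null vector stays null
    have h1 : norm₂ τ (b * c) ^ 2 ≤ 0 := by
      rw [hτ.norm₂_sq, star_mul, mul_assoc]
      refine (Complex.re_le_norm _).trans ((hτ.norm_star_mul_le _ _).trans ?_)
      rw [← h0, zero_mul]
    rw [← h0, mul_zero]
    nlinarith [norm₂_nonneg (τ := τ) (b * c)]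
  have hstar : ∀ n : ℕ, star (b ^ n) = b ^ n := fun n => by rw [star_pow, hb]
  -- iterating the Cauchy–Schwarz inequality
  have step : ∀ n : ℕ, norm₂ τ (b ^ n * c) ^ 2 ≤ norm₂ τ c * norm₂ τ (b ^ (2 * n) * c) := by
    intro n
    rw [hτ.norm₂_sq, star_mul, hstar, mul_assoc, ← mul_assoc (b ^ n), ← pow_add, ← two_mul]
    exact (Complex.re_le_norm _).trans (hτ.norm_star_mul_le _ _)
  have iter : ∀ k : ℕ, (norm₂ τ (b * c) / norm₂ τ c) ^ (2 ^ k) ≤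
      norm₂ τ (b ^ (2 ^ k) * c) / norm₂ τ c := by
    intro k
    induction k with
    | zero => simp
    | succ k ih =>
      rw [pow_succ, pow_mul]
      have h1 := step (2 ^ k)
      have h2 : (norm₂ τ (b ^ 2 ^ k * c) / norm₂ τ c) ^ 2 ≤
          norm₂ τ (b ^ (2 ^ k * 2) * c) / norm₂ τ c := by
        rw [div_pow, div_le_div_iff₀ (by positivity) h0, mul_comm (2 ^ k) 2]
        nlinarith
      refine le_trans ?_ h2
      have h3 : 0 ≤ norm₂ τ (b * c) / norm₂ τ c := div_nonneg (norm₂_nonneg _) h0.le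
      gcongr
  -- the moments control the growth of the iterates
  have growth : ∀ n : ℕ, norm₂ τ (b ^ n * c) ^ 2 ≤
      (norm₂ τ (c * star c) * Real.sqrt |M|) * (C ^ n) ^ 2 := by
    intro n
    -- Traciality brings c next to its adjoint, so that Cauchy–Schwarz separates the fixed vector c
    -- c* from the power of b, whose norm is a moment.
    rw [hτ.norm₂_sq, star_mul, hstar, mul_assoc, ← mul_assoc (b ^ n), ← pow_add, ← two_mul,
      hτ.trace, mul_assoc, hτ.trace]
    refine (Complex.re_le_norm _).trans ((hτ.norm_mul_le _ _).trans ?_)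
    rw [mul_assoc]
    refine mul_le_mul_of_nonneg_left ?_ (norm₂_nonneg _)
    rw [norm₂, hstar, ← pow_add, ← two_mul]
    refine (Real.sqrt_le_sqrt ((h _).trans (mul_le_mul_of_nonneg_right (le_abs_self M)
      (by positivity)))).trans ?_
    rw [Real.sqrt_mul (abs_nonneg M)]
    refine mul_le_mul_of_nonneg_left ?_ (Real.sqrt_nonneg _)
    rw [show C ^ (2 * (2 * n)) = (C ^ (2 * n)) ^ 2 by ring, Real.sqrt_sq (by positivity)]
    exact le_of_eq (by ring)
  set x := norm₂ τ (b * c) / norm₂ τ c with hx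
  have hx0 : 0 ≤ x := div_nonneg (norm₂_nonneg _) h0.le
  suffices hxC : x ≤ C by rwa [hx, div_le_iff₀ h0] at hxC
  by_contra hlt
  push Not at hlt
  have hxpos : 0 < x := hC.trans_lt hlt
  -- If x exceeded C, the ratios (x / C)^(2^(k+1)) would be unbounded in k, whereas the two
  -- preceding estimates bound them by K.
  set K := norm₂ τ (c * star c) * Real.sqrt |M| / norm₂ τ c ^ 2 with hK
  have bound : ∀ k : ℕ, (x ^ 2 ^ k) ^ 2 ≤ K * (C ^ 2 ^ k) ^ 2 := by
    intro k
    have h1 := growth (2 ^ k)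
    have h2 := iter k
    calc (x ^ 2 ^ k) ^ 2 ≤ (norm₂ τ (b ^ (2 ^ k) * c) / norm₂ τ c) ^ 2 := by gcongr
      _ = norm₂ τ (b ^ (2 ^ k) * c) ^ 2 / norm₂ τ c ^ 2 := div_pow _ _ _
      _ ≤ (norm₂ τ (c * star c) * Real.sqrt |M|) * (C ^ 2 ^ k) ^ 2 / norm₂ τ c ^ 2 := by gcongr
      _ = _ := by rw [hK]; ring
  rcases hC.eq_or_lt with hC0 | hC0
  · have := bound 0
    rw [← hC0] at this
    simp at this
    nlinarith
  · have hr : 1 < x / C := (one_lt_div hC0).mpr hlt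
    have ht : Tendsto (fun k : ℕ => ((x / C) ^ 2) ^ (2 ^ k)) atTop atTop :=
      (tendsto_pow_atTop_atTop_of_one_lt (by nlinarith)).comp
        (tendsto_pow_atTop_atTop_of_one_lt (by norm_num))
    obtain ⟨k, hk⟩ := (ht.eventually_gt_atTop K).exists
    have h3 := bound k
    rw [← pow_mul, mul_comm 2, pow_mul, div_pow, div_pow, lt_div_iff₀ (by positivity)] at hk
    linarith

/-! ### Empirical distributions as non-commutative laws -/

/-- The empirical distribution as a linear form. -/
def empiricalLin (X : HermTuple ℓ N) : smoothAlg ℓ →ₗ[ℂ] ℂ :=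
  (1 / N : ℂ) • (Matrix.traceLinearMap (Fin N) ℂ ℂ ∘ₗ (evalHom X : smoothAlg ℓ →ₐ[ℂ] _).toLinearMap)

theorem empiricalLin_apply (X : HermTuple ℓ N) (a : smoothAlg ℓ) :
    empiricalLin X a = empirical X a := rfl

theorem isNCLaw_empiricalLin (hN : 1 ≤ N) (X : HermTuple ℓ N) : IsNCLaw (empiricalLin X) where
  pos a := by
    refine ⟨1 / N * ∑ p : Fin N, ∑ q : Fin N, ‖eval a X p q‖ ^ 2, by positivity, ?_⟩
    change (1 / N : ℂ) * (eval a X * star (eval a X)).trace = _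
    push_cast
    congr 1
    rw [Matrix.trace]
    refine Finset.sum_congr rfl fun p _ => ?_
    rw [Matrix.diag_apply, Matrix.mul_apply]
    refine Finset.sum_congr rfl fun q _ => ?_
    rw [Matrix.star_apply]
    exact Complex.mul_conj' _
  one := by
    change (1 / N : ℂ) * (1 : Matrix (Fin N) (Fin N) ℂ).trace = 1
    rw [Matrix.trace_one, Fintype.card_fin, one_div, inv_mul_cancel₀]
    exact_mod_cast (by omega : N ≠ 0)
  trace a b := by
    change (1 / N : ℂ) * (eval a X * eval b X).trace = (1 / N : ℂ) * (eval b X * eval a X).trace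
    rw [Matrix.trace_mul_comm]

theorem empirical_smoothElt (X : HermTuple ℓ N) (j : Fin ℓ) {f : ℝ → ℝ} (hf : ContDiff ℝ ∞ f) :
    empirical X (smoothElt j f hf) =
      ((1 / N * ∑ a, f ((isHermitian_coe (X j)).eigenvalues a) : ℝ) : ℂ) := by
  rw [empirical, eval_smoothElt, trace_cfc]
  push_cast
  rfl

/-! ### Limit points along ultrafilters -/

/-- The non-commutative law `τ` is the limit of empirical distributions along an ultrafilter. -/
structure IsLimitAlong (X : (N : ℕ) → HermTuple ℓ N) (𝒰 : Ultrafilter ℕ)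
    (τ : smoothAlg ℓ →ₗ[ℂ] ℂ) : Prop where
  law : IsNCLaw τ
  le_atTop : (𝒰 : Filter ℕ) ≤ atTop
  tendsto : ∀ P : NCSmooth ℓ, Tendsto (fun N => empirical (X N) P.elt) 𝒰 (𝓝 (τ P.elt))

variable {X : (N : ℕ) → HermTuple ℓ N} {𝒰 : Ultrafilter ℕ}

/-- An ultrafilter turns a cluster point into a genuine limit, for all test functions
simultaneously. -/
theorem IsLimitPoint.exists_isLimitAlong (h : IsLimitPoint X τ) :
    ∃ 𝒰 : Ultrafilter ℕ, IsLimitAlong X 𝒰 τ := by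
  obtain ⟨𝒰, h1, h2⟩ := mapClusterPt_iff_ultrafilter.mp h.2
  exact ⟨𝒰, h.1, h1, tendsto_pi_nhds.mp h2⟩

/-- A polynomial as a test function. -/
def NCSmooth.ofPoly (P : NCPoly ℓ) : NCSmooth ℓ := ⟨P, fun _ _ => 0, fun _ => contDiff_const⟩

theorem smoothElt_zero (j : Fin ℓ) : smoothElt j (fun _ => 0) contDiff_const = 0 := by
  rw [smoothElt_const, Complex.ofReal_zero, zero_smul]

theorem NCSmooth.ofPoly_elt (P : NCPoly ℓ) : (NCSmooth.ofPoly P).elt = polyElt P := by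
  simp [NCSmooth.elt, NCSmooth.ofPoly, smoothElt_zero]

/-- A function of one coordinate as a test function. -/
def NCSmooth.ofFun (j : Fin ℓ) {f : ℝ → ℝ} (hf : ContDiff ℝ ∞ f) : NCSmooth ℓ :=
  ⟨0, fun i x => if i = j then f x else 0, fun i => by
    split_ifs
    exacts [hf, contDiff_const]⟩

theorem NCSmooth.ofFun_elt (j : Fin ℓ) {f : ℝ → ℝ} (hf : ContDiff ℝ ∞ f) :
    (NCSmooth.ofFun j hf).elt = smoothElt j f hf := by
  rw [NCSmooth.elt, Finset.sum_eq_single j]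
  · simp [NCSmooth.ofFun]
  · intro i _ hij
    simp only [NCSmooth.ofFun, hij, if_false]
    exact smoothElt_zero i
  · simp

/-! ### Existence and compact support of the distribution of a coordinate -/

/-- A smooth function dominating a locally bounded family of functions. -/
theorem exists_smooth_dominating {ι : Type*} (G : ι → ℝ → ℝ)
    (hG : ∀ x, ∃ c, ∀ᶠ y in 𝓝 x, ∀ n, G n y ≤ c) :
    ∃ h : ℝ → ℝ, ContDiff ℝ ∞ h ∧ (∀ x, 0 ≤ h x) ∧ ∀ n x, G n x ≤ h x := by
  -- The admissible values at each point form a convex set, so local constant upper bounds are glued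
  -- by a smooth partition of unity.
  obtain ⟨g, hg⟩ := exists_contMDiffMap_forall_mem_convex_of_local_const (n := (⊤ : ℕ∞))
    (modelWithCornersSelf ℝ ℝ) (t := fun x : ℝ => {c : ℝ | 0 ≤ c ∧ ∀ n, G n x ≤ c})
    (fun x => by
      have : {c : ℝ | 0 ≤ c ∧ ∀ n, G n x ≤ c} = Set.Ici 0 ∩ ⋂ n, Set.Ici (G n x) := by
        ext c; simp
      rw [this]
      exact (convex_Ici 0).inter (convex_iInter fun n => convex_Ici _))
    (fun x => by
      obtain ⟨c, hc⟩ := hG x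
      refine ⟨max 0 c, hc.mono fun y hy => ⟨le_max_left _ _, fun n => (hy n).trans
        (le_max_right _ _)⟩⟩)
  exact ⟨g, g.contMDiff.contDiff, fun x => (hg x).1, fun n x => (hg x).2 n⟩

theorem outside_le_one (R x : ℝ) : outside R x ≤ 1 := Real.smoothTransition.le_one _

namespace IsLimitAlong

theorem tendsto_poly (h : IsLimitAlong X 𝒰 τ) (P : NCPoly ℓ) :
    Tendsto (fun N => empirical (X N) (polyElt P)) 𝒰 (𝓝 (τ (polyElt P))) := by
  simpa only [NCSmooth.ofPoly_elt] using h.tendsto (NCSmooth.ofPoly P)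

theorem tendsto_fun (h : IsLimitAlong X 𝒰 τ) (j : Fin ℓ) {f : ℝ → ℝ} (hf : ContDiff ℝ ∞ f) :
    Tendsto (fun N => empirical (X N) (smoothElt j f hf)) 𝒰 (𝓝 (τ (smoothElt j f hf))) := by
  simpa only [NCSmooth.ofFun_elt] using h.tendsto (NCSmooth.ofFun j hf)

theorem im_eq_zero (h : IsLimitAlong X 𝒰 τ) (j : Fin ℓ) {f : ℝ → ℝ} (hf : ContDiff ℝ ∞ f) :
    (τ (smoothElt j f hf)).im = 0 := by
  have h1 := h.law.map_star (smoothElt j f hf)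
  rw [star_smoothElt] at h1
  exact Complex.conj_eq_iff_im.mp h1.symm

theorem tendsto_sum (h : IsLimitAlong X 𝒰 τ) (j : Fin ℓ) {f : ℝ → ℝ} (hf : ContDiff ℝ ∞ f) :
    Tendsto (fun N : ℕ => 1 / N * ∑ a, f ((isHermitian_coe (X N j)).eigenvalues a)) 𝒰
      (𝓝 (τ (smoothElt j f hf)).re) := by
  refine ((Complex.continuous_re.tendsto _).comp (h.tendsto_fun j hf)).congr fun N => ?_
  rw [Function.comp_apply, empirical_smoothElt, Complex.ofReal_re]

theorem re_mono (h : IsLimitAlong X 𝒰 τ) (j : Fin ℓ) {f g : ℝ → ℝ} (hf : ContDiff ℝ ∞ f)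
    (hg : ContDiff ℝ ∞ g) (hfg : ∀ x, f x ≤ g x) :
    (τ (smoothElt j f hf)).re ≤ (τ (smoothElt j g hg)).re :=
  le_of_tendsto_of_tendsto' (h.tendsto_sum j hf) (h.tendsto_sum j hg) fun N =>
    mul_le_mul_of_nonneg_left (Finset.sum_le_sum fun a _ => hfg _) (by positivity)

theorem abs_re_le (h : IsLimitAlong X 𝒰 τ) (j : Fin ℓ) {f g : ℝ → ℝ} (hf : ContDiff ℝ ∞ f)
    (hg : ContDiff ℝ ∞ g) (hfg : ∀ x, |f x| ≤ g x) :
    |(τ (smoothElt j f hf)).re| ≤ (τ (smoothElt j g hg)).re := by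
  rw [abs_le]
  refine ⟨?_, h.re_mono j hf hg fun x => (abs_le.mp (hfg x)).2⟩
  have h1 := h.re_mono j (contDiff_const.mul hg) hf (f := fun x => (-1 : ℝ) * g x) fun x => by
    linarith [(abs_le.mp (hfg x)).1]
  rw [smoothElt_const_mul j (-1) hg, map_smul, smul_eq_mul, Complex.re_ofReal_mul] at h1
  linarith

/-- The distribution of a coordinate under a limit point has compact support. -/
theorem exists_forall_eq_zero (h : IsLimitAlong X 𝒰 τ) (j : Fin ℓ) : ∃ n : ℕ, ∀ (f : ℝ → ℝ)
    (hf : ContDiff ℝ ∞ f), (∀ x : ℝ, |x| ≤ n → f x = 0) → τ (smoothElt j f hf) = 0 := by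
  by_contra hcon
  push Not at hcon
  choose f hf hf0 hτ using hcon
  have hre : ∀ n, 0 < |(τ (smoothElt j (f n) (hf n))).re| := fun n => by
    rw [abs_pos]
    exact fun h0 => hτ n (Complex.ext h0 (h.im_eq_zero j (hf n)))
  set t := fun n => |(τ (smoothElt j (f n) (hf n))).re| with ht
  -- If the support were unbounded there would be f n vanishing on [-n, n] with |τ(f n)| = t n > 0.
  -- Near any point only finitely many are nonzero, so one smooth H dominates all n |f n| / t n.
  -- Since H is a test function, n ≤ τ(H) for every n, which is absurd.
  obtain ⟨H, hH, -, hGH⟩ := exists_smooth_dominating (fun (n : ℕ) x => n / t n * |f n x|) (by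
    intro x
    have hev : ∀ᶠ y in 𝓝 x, ∀ n ∈ Finset.range (⌈|x|⌉₊ + 1),
        n / t n * |f n y| < n / t n * |f n x| + 1 := by
      rw [Filter.eventually_all_finset]
      intro n _
      have hc : Continuous fun y => n / t n * |f n y| :=
        continuous_const.mul (hf n).continuous.abs
      exact (hc.tendsto x).eventually (gt_mem_nhds (by linarith))
    refine ⟨∑ n ∈ Finset.range (⌈|x|⌉₊ + 1), (n / t n * |f n x| + 1), ?_⟩
    have hx : ∀ᶠ y : ℝ in 𝓝 x, |y| < ⌈|x|⌉₊ + 1 :=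
      (continuous_abs.tendsto x).eventually (gt_mem_nhds (by linarith [Nat.le_ceil |x|]))
    filter_upwards [hev, hx] with y hy hyx n
    have hnn : ∀ m : ℕ, 0 ≤ (m : ℝ) / t m * |f m x| + 1 := fun m => by
      have := (hre m).le
      positivity
    by_cases hn : n < ⌈|x|⌉₊ + 1
    · exact (hy n (Finset.mem_range.mpr hn)).le.trans
        (Finset.single_le_sum (f := fun n : ℕ => (n : ℝ) / t n * |f n x| + 1)
          (fun m _ => hnn m) (Finset.mem_range.mpr hn))
    · have : ((⌈|x|⌉₊ + 1 : ℕ) : ℝ) ≤ n := by exact_mod_cast not_lt.mp hn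
      push_cast at this
      rw [hf0 n y (by linarith), abs_zero, mul_zero]
      exact Finset.sum_nonneg fun m _ => hnn m)
  obtain ⟨n, hn⟩ := exists_nat_gt (τ (smoothElt j H hH)).re
  have h1 := h.abs_re_le j (f := fun x => n / t n * f n x) (contDiff_const.mul (hf n)) hH
    fun x => by
      rw [abs_mul, abs_of_nonneg (div_nonneg n.cast_nonneg (hre n).le)]
      exact hGH n x
  rw [smoothElt_const_mul j _ (hf n), map_smul, smul_eq_mul, Complex.re_ofReal_mul, abs_mul,
    abs_of_nonneg (div_nonneg n.cast_nonneg (hre n).le)] at h1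
  change n / t n * t n ≤ _ at h1
  rw [div_mul_cancel₀ _ (hre n).ne'] at h1
  linarith

/-- Averages of a bounded continuous function of a coordinate converge along the ultrafilter. -/
theorem exists_tendsto_average (X : (N : ℕ) → HermTuple ℓ N) (𝒰 : Ultrafilter ℕ) (j : Fin ℓ)
    (f : C_c(ℝ, ℝ)) : ∃ r : ℝ,
      Tendsto (fun N : ℕ => 1 / N * ∑ a, f ((isHermitian_coe (X N j)).eigenvalues a)) 𝒰 (𝓝 r) := by
  obtain ⟨C, hC⟩ := f.hasCompactSupport.exists_bound_of_continuous f.continuous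
  have hC0 : 0 ≤ C := (norm_nonneg _).trans (hC 0)
  obtain ⟨r, -, hr⟩ := (isCompact_closedBall (0 : ℝ) C).ultrafilter_le_nhds'
    (𝒰.map fun N : ℕ => 1 / N * ∑ a, f ((isHermitian_coe (X N j)).eigenvalues a))
    (Filter.mem_map.mpr (Filter.univ_mem' fun N => by
      rw [Set.mem_preimage, mem_closedBall_zero_iff, norm_mul, norm_div, norm_one, Real.norm_natCast]
      rcases N.eq_zero_or_pos with rfl | hN
      · simpa using hC0
      have : ‖∑ a, f ((isHermitian_coe (X N j)).eigenvalues a)‖ ≤ N * C := by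
        simpa using norm_sum_le_of_le Finset.univ fun a _ =>
          hC ((isHermitian_coe (X N j)).eigenvalues a)
      have hN' : (0 : ℝ) < N := by exact_mod_cast hN
      rwa [one_div, inv_mul_le_iff₀ hN']))
  exact ⟨r, hr⟩

/-- The limit of averages, as a positive linear form on compactly supported functions. -/
def averageLim (X : (N : ℕ) → HermTuple ℓ N) (𝒰 : Ultrafilter ℕ) (j : Fin ℓ) :
    C_c(ℝ, ℝ) →ₚ[ℝ] ℝ :=
  PositiveLinearMap.mk₀
    { toFun := fun f => (exists_tendsto_average X 𝒰 j f).choose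
      map_add' := fun f g => by
        refine tendsto_nhds_unique (exists_tendsto_average X 𝒰 j (f + g)).choose_spec
          (((exists_tendsto_average X 𝒰 j f).choose_spec.add
            (exists_tendsto_average X 𝒰 j g).choose_spec).congr fun N => ?_)
        simp only [CompactlySupportedContinuousMap.coe_add, Pi.add_apply]
        rw [Finset.sum_add_distrib, mul_add]
      map_smul' := fun r f => by
        refine tendsto_nhds_unique (exists_tendsto_average X 𝒰 j (r • f)).choose_spec
          (((exists_tendsto_average X 𝒰 j f).choose_spec.const_mul r).congr fun N => ?_)
        simp only [CompactlySupportedContinuousMap.coe_smul, Pi.smul_apply, smul_eq_mul]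
        rw [← Finset.mul_sum]
        ring }
    fun f hf => ge_of_tendsto' (exists_tendsto_average X 𝒰 j f).choose_spec fun N =>
      mul_nonneg (by positivity) (Finset.sum_nonneg fun a _ => hf _)

theorem integral_rieszMeasure_averageLim (h : IsLimitAlong X 𝒰 τ) (j : Fin ℓ) {f : ℝ → ℝ}
    (hf : ContDiff ℝ ∞ f) (hc : HasCompactSupport f) :
    ∫ x, f x ∂(RealRMK.rieszMeasure (averageLim X 𝒰 j)) = (τ (smoothElt j f hf)).re := by
  have h1 := RealRMK.integral_rieszMeasure (averageLim X 𝒰 j) ⟨⟨f, hf.continuous⟩, hc⟩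
  refine h1.trans ?_
  exact tendsto_nhds_unique (exists_tendsto_average X 𝒰 j ⟨⟨f, hf.continuous⟩, hc⟩).choose_spec
    (h.tendsto_sum j hf)

theorem hasCompactSupport_one_sub_outside (R : ℝ) (hR : 0 ≤ R) :
    HasCompactSupport fun x => 1 - outside R x := by
  refine HasCompactSupport.of_support_subset_isCompact (isCompact_Icc (a := -(R + 1)) (b := R + 1))
    fun x hx => ?_
  refine Set.mem_Icc.mpr (abs_le.mp (abs_le_of_outside_lt_one hR ?_))
  refine lt_of_le_of_ne (outside_le_one _ _) fun h1 => hx ?_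
  change 1 - outside R x = 0
  rw [h1, sub_self]

/-- Every coordinate has a compactly supported distribution under a limit point. -/
theorem exists_isSpectralDistribution (h : IsLimitAlong X 𝒰 τ) (j : Fin ℓ) :
    ∃ m : Measure ℝ, IsSpectralDistribution τ j m := by
  obtain ⟨n, hn⟩ := h.exists_forall_eq_zero j
  have hn0 : (0 : ℝ) ≤ n := n.cast_nonneg
  set m := RealRMK.rieszMeasure (averageLim X 𝒰 j) with hm
  have hsub : ∀ k : ℕ, ContDiff ℝ ∞ fun x => 1 - outside k x := fun k =>
    contDiff_const.sub (contDiff_outside k)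
  have hcs : ∀ (k : ℕ) (g : ℝ → ℝ), HasCompactSupport fun x => g x * (1 - outside k x) :=
    fun k g => (hasCompactSupport_one_sub_outside k k.cast_nonneg).mul_left
  have hae : ∀ᵐ x : ℝ ∂m, |x| ≤ n := by
    -- The Riesz representation only sees compactly supported functions, so the mass outside [-n, n]
    -- is tested through truncations at every level k.
    have h1 : ∀ k : ℕ, ∀ᵐ x ∂m, outside n x * (1 - outside k x) = 0 := by
      intro k
      have hg : ContDiff ℝ ∞ fun x => outside n x * (1 - outside k x) :=
        (contDiff_outside n).mul (hsub k)
      have hi := h.integral_rieszMeasure_averageLim j hg (hcs k _)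
      rw [hn _ hg fun x hx => by rw [outside_eq_zero hx, zero_mul], Complex.zero_re,
        integral_eq_zero_iff_of_nonneg
          (fun x => mul_nonneg (outside_nonneg _ _) (sub_nonneg.mpr (outside_le_one _ _)))
          (hg.continuous.integrable_of_hasCompactSupport (hcs k _))] at hi
      exact hi
    filter_upwards [ae_all_iff.mpr h1] with x hx
    by_contra hlt
    push Not at hlt
    have h2 := hx ⌈|x|⌉₊
    rw [outside_eq_zero (Nat.le_ceil _), sub_zero, mul_one] at h2
    refine (Real.smoothTransition.pos_of_pos ?_).ne' h2
    rw [← sq_abs x]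
    nlinarith
  have hint : ∀ (f : ℝ → ℝ) (hf : ContDiff ℝ ∞ f), ∫ x, f x ∂m = (τ (smoothElt j f hf)).re := by
    intro f hf
    have e1 : ∫ x, f x ∂m = ∫ x, f x * (1 - outside n x) ∂m := by
      refine integral_congr_ae (hae.mono fun x hx => ?_)
      simp only []
      rw [outside_eq_zero hx, sub_zero, mul_one]
    have hfo : ContDiff ℝ ∞ fun x => f x * outside n x := hf.mul (contDiff_outside n)
    have h0 := hn _ hfo fun x hx => by rw [outside_eq_zero hx, mul_zero]
    rw [e1, h.integral_rieszMeasure_averageLim j (hf.mul (hsub n)) (hcs n f)]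
    have e2 : smoothElt j f hf = smoothElt j (fun x => f x * (1 - outside n x)) (hf.mul (hsub n)) +
        smoothElt j _ hfo := by
      rw [← smoothElt_add]
      congr 1
      funext x
      ring
    rw [e2, map_add, h0, add_zero]
  -- No mass escapes to infinity, since the identity between integrals and τ has been extended to
  -- functions without compact support.
  have hone : ∫ _, (1 : ℝ) ∂m = 1 := by
    rw [hint _ contDiff_const, smoothElt_const, Complex.ofReal_one, one_smul, h.law.one,
      Complex.one_re]
  refine ⟨m, ⟨⟨?_⟩, ⟨n, hae⟩, fun f hf => ?_⟩⟩
  · rw [integral_const, smul_eq_mul, mul_one] at hone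
    have := (ENNReal.toReal_eq_one_iff _).mp hone
    exact this
  · rw [hint f hf]
    exact Complex.ext rfl (by rw [h.im_eq_zero j hf, Complex.ofReal_im])

end IsLimitAlong

/-! ### Spectral distributions -/

theorem smoothElt_id_pow (j : Fin ℓ) (n : ℕ) :
    smoothElt j (fun x => x ^ n) (contDiff_id.pow n) = polyElt (monomial [j] ^ n) := by
  rw [map_pow, polyElt_monomial_singleton, ← smoothElt_id, ← smoothElt_pow]

namespace IsSpectralDistribution

variable {j : Fin ℓ} {m : Measure ℝ}

/-- A function of a coordinate is bounded by its supremum on the support of the distribution. -/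
theorem isBoundedBy (hm : IsSpectralDistribution τ j m) (hτ : IsNCLaw τ) {R C : ℝ}
    (hR : ∀ᵐ x : ℝ ∂m, |x| ≤ R) (hC : 0 ≤ C) {f : ℝ → ℝ} (hf : ContDiff ℝ ∞ f)
    (hfC : ∀ x, |x| ≤ R → |f x| ≤ C) : IsBoundedBy τ (smoothElt j f hf) C := by
  have := hm.prob
  refine isBoundedBy_of_moments (M := 1) hτ (star_smoothElt j hf) hC fun n => ?_
  rw [← smoothElt_pow, hm.integral_eq, Complex.ofReal_re, one_mul]
  have h1 : ∀ᵐ x : ℝ ∂m, ‖f x ^ (2 * n)‖ ≤ C ^ (2 * n) := hR.mono fun x hx => by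
    rw [norm_pow]
    exact pow_le_pow_left₀ (norm_nonneg _) (hfC x hx) _
  have h2 := norm_integral_le_of_norm_le_const h1
  rw [probReal_univ, mul_one] at h2
  exact (le_abs_self _).trans h2

theorem norm₂_le (hm : IsSpectralDistribution τ j m) (hτ : IsNCLaw τ) {R C : ℝ}
    (hR : ∀ᵐ x : ℝ ∂m, |x| ≤ R) (hC : 0 ≤ C) {f : ℝ → ℝ} (hf : ContDiff ℝ ∞ f)
    (hfC : ∀ x, |x| ≤ R → |f x| ≤ C) : norm₂ τ (smoothElt j f hf) ≤ C := by
  have := (hm.isBoundedBy hτ hR hC hf hfC).2 1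
  rwa [mul_one, hτ.norm₂_one, mul_one] at this

theorem ae_prod (hm : IsSpectralDistribution τ j m) {R : ℝ} (hR : ∀ᵐ x : ℝ ∂m, |x| ≤ R) :
    ∀ᵐ z : ℝ × ℝ ∂(m.prod m), |z.1| ≤ R ∧ |z.2| ≤ R := by
  have := hm.prob
  exact (Measure.quasiMeasurePreserving_fst.ae hR).and (Measure.quasiMeasurePreserving_snd.ae hR)

theorem integrable_prod (hm : IsSpectralDistribution τ j m) {F : ℝ × ℝ → ℝ} (hF : Continuous F) :
    Integrable F (m.prod m) := by
  have := hm.prob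
  obtain ⟨R, hR⟩ := hm.bounded
  obtain ⟨C, hC⟩ := ((isCompact_Icc (a := -R) (b := R)).prod
    (isCompact_Icc (a := -R) (b := R))).exists_bound_of_continuousOn hF.continuousOn
  exact Integrable.of_bound hF.aestronglyMeasurable C ((hm.ae_prod hR).mono fun z hz =>
    hC z ⟨abs_le.mp hz.1, abs_le.mp hz.2⟩)

theorem moment (hm : IsSpectralDistribution τ j m) (n : ℕ) :
    τ (polyElt (monomial [j] ^ n)) = (∫ x, x ^ n ∂m : ℝ) := by
  rw [← smoothElt_id_pow, hm.integral_eq]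

end IsSpectralDistribution

theorem continuous_dslope_polynomial (p : Polynomial ℝ) :
    Continuous fun z : ℝ × ℝ => dslope (fun x => p.eval x) z.1 z.2 := by
  induction p using Polynomial.induction_on' with
  | add p q hp hq =>
    simp only [Polynomial.eval_add]
    simp only [dslope_add p.differentiable q.differentiable]
    exact hp.add hq
  | monomial n c =>
    simp only [Polynomial.eval_monomial, dslope_const_mul_pow]
    fun_prop

theorem tensorSq_polyDeriv_polyX {j : Fin ℓ} {m : Measure ℝ} (hm : IsSpectralDistribution τ j m)
    (p : Polynomial ℝ) : tensorSq τ (polyDeriv j (polyX j p)) =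
      (∫ z : ℝ × ℝ, dslope (fun x => p.eval x) z.1 z.2 ∂(m.prod m) : ℝ) := by
  have := hm.prob
  induction p using Polynomial.induction_on' with
  | add p q hp hq =>
    simp only [Polynomial.eval_add]
    simp only [dslope_add p.differentiable q.differentiable]
    rw [integral_add (hm.integrable_prod (continuous_dslope_polynomial p))
      (hm.integrable_prod (continuous_dslope_polynomial q)), polyX_add, map_add, map_add, hp, hq,
      Complex.ofReal_add]
  | monomial n c =>
    simp only [Polynomial.eval_monomial, dslope_const_mul_pow]
    rw [← Polynomial.C_mul_X_pow_eq_monomial, polyX_C_mul_X_pow, map_smul, map_smul, polyDeriv_pow,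
      polyDeriv_X, if_pos rfl, integral_const_mul, integral_finsetSum _ fun a _ =>
        hm.integrable_prod (by fun_prop), map_sum, Complex.ofReal_mul, smul_eq_mul,
      Complex.ofReal_sum]
    congr 1
    refine Finset.sum_congr rfl fun a _ => ?_
    rw [mul_one, Algebra.TensorProduct.tmul_mul_tmul, mul_one, one_mul,
      integral_prod_mul (fun x : ℝ => x ^ a) fun y : ℝ => y ^ (n - 1 - a)]
    simp [tensorSq, ← hm.moment]

/-! ### Limits of mixed products and the Dyson–Schwinger equations -/

namespace IsLimitAlong

theorem eventually_one_le (h : IsLimitAlong X 𝒰 τ) : ∀ᶠ N in (𝒰 : Filter ℕ), 1 ≤ N :=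
  h.le_atTop (eventually_ge_atTop 1)

/-- The square of the L² norm is the value of the law on another polynomial, hence is covered by the
convergence on test functions. -/
theorem tendsto_norm₂_poly (h : IsLimitAlong X 𝒰 τ) (P : NCPoly ℓ) :
    Tendsto (fun N => norm₂ (empiricalLin (X N)) (polyElt P)) 𝒰 (𝓝 (norm₂ τ (polyElt P))) := by
  simp only [norm₂, star_polyElt, ← map_mul]
  exact ((Real.continuous_sqrt.comp Complex.continuous_re).tendsto _).comp (h.tendsto_poly _)

theorem tendsto_norm₂_fun (h : IsLimitAlong X 𝒰 τ) (j : Fin ℓ) {f : ℝ → ℝ}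
    (hf : ContDiff ℝ ∞ f) :
    Tendsto (fun N => norm₂ (empiricalLin (X N)) (smoothElt j f hf)) 𝒰
      (𝓝 (norm₂ τ (smoothElt j f hf))) := by
  simp only [norm₂, star_smoothElt, ← smoothElt_mul]
  exact ((Real.continuous_sqrt.comp Complex.continuous_re).tendsto _).comp (h.tendsto_fun j _)

/-- Convergence on products of a function of a coordinate and a polynomial. -/
theorem tendsto_fun_mul_poly (h : IsLimitAlong X 𝒰 τ) (j : Fin ℓ) {f : ℝ → ℝ}
    (hf : ContDiff ℝ ∞ f) (P : NCPoly ℓ) :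
    Tendsto (fun N => empirical (X N) (smoothElt j f hf * polyElt P)) 𝒰
      (𝓝 (τ (smoothElt j f hf * polyElt P))) := by
  obtain ⟨m, hm⟩ := h.exists_isSpectralDistribution j
  obtain ⟨R, hR⟩ := hm.bounded
  rw [Metric.tendsto_nhds]
  intro ε hε
  set b := norm₂ τ (polyElt P) with hb
  have hb0 : 0 ≤ b := norm₂_nonneg _
  obtain ⟨q, hq⟩ := exists_polynomial_near_deriv (hf.of_le (by norm_cast)) R
    (ε := ε / (3 * (b + 1))) (by positivity)
  set g := smoothElt j (fun x => f x - q.eval x) (hf.sub (contDiff_polynomial q)) with hg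
  have hfg : smoothElt j f hf = polyElt (polyX j q) + g := by
    rw [polyElt_polyX, hg, smoothElt_sub j hf (contDiff_polynomial q), add_sub_cancel]
  have hgn : norm₂ τ g * b < ε / 3 := by
    have h1 : norm₂ τ g ≤ ε / (3 * (b + 1)) := hm.norm₂_le h.law hR (by positivity) _ fun x hx => by
      rw [abs_sub_comm]
      exact (hq x hx).1
    calc norm₂ τ g * b ≤ ε / (3 * (b + 1)) * b := mul_le_mul_of_nonneg_right h1 hb0
      _ < ε / 3 := by
        rw [div_mul_eq_mul_div, div_lt_div_iff₀ (by positivity) (by norm_num)]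
        nlinarith
  -- The remainder g is small only on the support of the limit distribution, not on the spectra of
  -- the matrices. Its empirical L² norm is nevertheless eventually small, because g² is itself a
  -- test function.
  have e1 : ∀ᶠ N in (𝒰 : Filter ℕ), norm₂ (empiricalLin (X N)) g *
      norm₂ (empiricalLin (X N)) (polyElt P) < ε / 3 :=
    ((h.tendsto_norm₂_fun j _).mul (h.tendsto_norm₂_poly P)).eventually (gt_mem_nhds hgn)
  have e2 := Metric.tendsto_nhds.mp (h.tendsto_poly (polyX j q * P)) (ε / 3) (by positivity)
  filter_upwards [e1, e2, h.eventually_one_le] with N h1 h2 hN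
  rw [map_mul] at h2
  rw [dist_eq_norm] at h2 ⊢
  rw [hfg, add_mul, map_add, ← empiricalLin_apply, map_add, empiricalLin_apply]
  have h3 := (isNCLaw_empiricalLin hN (X N)).norm_mul_le g (polyElt P)
  have h4 := h.law.norm_mul_le g (polyElt P)
  calc _ = ‖(empirical (X N) (polyElt (polyX j q) * polyElt P) -
        τ (polyElt (polyX j q) * polyElt P)) + empiricalLin (X N) (g * polyElt P) -
        τ (g * polyElt P)‖ := by congr 1; ring
    _ ≤ _ := (norm_sub_le _ _).trans (add_le_add_left (norm_add_le _ _) _)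
    _ < ε := by linarith

/-- Sequences that vanish asymptotically along tuples of bounded norm tend to zero. -/
theorem tendsto_of_cutoff (h : IsLimitAlong X 𝒰 τ) {d : ℕ → ℝ}
    (hd : ∀ R : ℕ, Tendsto (fun N => d N * cutoff R (X N)) atTop (𝓝 0)) :
    Tendsto d 𝒰 (𝓝 0) := by
  have hd' : ∀ R : ℕ, ∃ n : ℕ, ∀ N ≥ n, |d N * cutoff R (X N)| ≤ 1 / ((R : ℝ) + 1) := fun R => by
    obtain ⟨n, hn⟩ := Metric.tendsto_atTop.mp (hd R) (1 / ((R : ℝ) + 1)) (by positivity)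
    refine ⟨n, fun N hN => ?_⟩
    have := hn N hN
    rw [Real.dist_eq, sub_zero] at this
    exact this.le
  choose n hn using hd'
  -- From time n R on, the truncated sequence at radius R is below 1/(R + 1). The function H is at
  -- least R n R at every point of modulus at least R - 1, so a large eigenvalue that appears too
  -- early makes the average of H large.
  obtain ⟨H, hH, hH0, hHn⟩ := exists_smooth_dominating
    (fun (R : ℕ) x => if (R : ℝ) ≤ |x| + 1 then (R : ℝ) * n R else 0) (by
      intro x
      have hx : ∀ᶠ y : ℝ in 𝓝 x, |y| < ⌈|x|⌉₊ + 1 :=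
        (continuous_abs.tendsto x).eventually (gt_mem_nhds (by linarith [Nat.le_ceil |x|]))
      refine ⟨∑ R ∈ Finset.range (⌈|x|⌉₊ + 2), (R : ℝ) * n R, hx.mono fun y hy R => ?_⟩
      split_ifs with hR
      · refine Finset.single_le_sum (f := fun R : ℕ => (R : ℝ) * n R)
          (fun m _ => by positivity) (Finset.mem_range.mpr ?_)
        have : (R : ℝ) < (⌈|x|⌉₊ + 2 : ℕ) := by push_cast; linarith
        exact_mod_cast this
      · exact Finset.sum_nonneg fun m _ => by positivity)
  obtain ⟨K, hK⟩ := exists_nat_gt (∑ j, (τ (smoothElt j H hH)).re)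
  have hτ0 : ∀ j, 0 ≤ (τ (smoothElt j H hH)).re := fun j =>
    ge_of_tendsto' (h.tendsto_sum j hH) fun N =>
      mul_nonneg (by positivity) (Finset.sum_nonneg fun a _ => hH0 _)
  have eK : ∀ᶠ N : ℕ in (𝒰 : Filter ℕ), ∀ j,
      1 / N * ∑ a, H ((isHermitian_coe (X N j)).eigenvalues a) < K := by
    rw [Filter.eventually_all]
    exact fun j => (h.tendsto_sum j hH).eventually (gt_mem_nhds (lt_of_le_of_lt
      (Finset.single_le_sum (fun j _ => hτ0 j) (Finset.mem_univ j)) hK))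
  rw [Metric.tendsto_nhds]
  intro ε hε
  obtain ⟨R₀, hR₀⟩ := exists_nat_one_div_lt hε
  set L := max K R₀ with hL
  filter_upwards [eK, h.eventually_one_le, h.le_atTop (eventually_ge_atTop (n L))] with N hNK hN hNL
  rw [Real.dist_eq, sub_zero]
  have key : ∀ R : ℕ, L ≤ R → n R ≤ N → NormLE R (X N) → |d N| < ε := by
    intro R hLR hRN hX
    have h1 := hn R N hRN
    rw [cutoff_eq_one hX, mul_one] at h1
    refine h1.trans_lt (lt_of_le_of_lt ?_ hR₀)
    have : (R₀ : ℝ) ≤ R := by exact_mod_cast (le_max_right _ _).trans hLR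
    gcongr
  -- The least integer bounding all norms at this N. It may be unbounded along the ultrafilter, so
  -- it must be shown that the estimate at radius r is already in force.
  set r : ℕ := Finset.univ.sup fun j => ⌈‖(X N j : Matrix (Fin N) (Fin N) ℂ)‖⌉₊ with hr
  have hXr : NormLE r (X N) := fun j => (Nat.le_ceil _).trans (by
    exact_mod_cast Finset.le_sup (f := fun j => ⌈‖(X N j : Matrix (Fin N) (Fin N) ℂ)‖⌉₊)
      (Finset.mem_univ j))
  rcases le_or_gt r L with hrL | hrL
  · exact key L le_rfl hNL fun j => (hXr j).trans (by exact_mod_cast hrL)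
  · refine key r hrL.le ?_ hXr
    have hr0 : 0 < r := by omega
    obtain ⟨j, -, hj⟩ := (Finset.lt_sup_iff (a := r - 1)).mp (show r - 1 < r by omega)
    have hspec : ∃ x ∈ spectrum ℝ (X N j : Matrix (Fin N) (Fin N) ℂ), ((r - 1 : ℕ) : ℝ) < |x| := by
      by_contra hcon
      push Not at hcon
      have := norm_le_of_spectrum (Nat.cast_nonneg _) hcon
      exact absurd (Nat.ceil_le.mpr this) (not_le.mpr hj)
    obtain ⟨x, hx, hxr⟩ := hspec
    -- The eigenvalue x forces r n r ≤ H x, while the sum of H over the spectrum is below N K ≤ N r.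
    -- Hence n r ≤ N and radius r is admissible.
    have h1 := hHn r x
    rw [if_pos (by rw [Nat.cast_sub hr0] at hxr; push_cast at hxr; linarith)] at h1
    have h2 := le_trace_cfc (X N j) hH0 hx
    rw [trace_cfc, Complex.ofReal_re] at h2
    have h3 := hNK j
    have hN' : (0 : ℝ) < N := by exact_mod_cast hN
    rw [one_div, inv_mul_lt_iff₀ hN'] at h3
    have h4 : (K : ℝ) ≤ r := by exact_mod_cast (le_max_left _ _).trans hrL.le
    have hr' : (0 : ℝ) < r := by exact_mod_cast hr0
    have h5 : (r : ℝ) * n r ≤ r * N := by nlinarith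
    exact_mod_cast le_of_mul_le_mul_left h5 hr'

theorem tendsto_traceSq (h : IsLimitAlong X 𝒰 τ) (T : NCPoly ℓ ⊗[ℂ] NCPoly ℓ) :
    Tendsto (fun N : ℕ => (1 / N : ℂ) ^ 2 * traceSq (X N) T) 𝒰 (𝓝 (tensorSq τ T)) := by
  induction T with
  | zero => simp
  | add S T hS hT =>
    simp only [map_add, mul_add]
    exact hS.add hT
  | tmul u v =>
    refine ((h.tendsto_poly u).mul (h.tendsto_poly v)).congr fun N => ?_
    rw [traceSq_tmul, empirical, empirical]
    ring

theorem tendsto_cyclicDeriv_mul_poly (h : IsLimitAlong X 𝒰 τ) (V : NCSmooth ℓ) (i : Fin ℓ)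
    (P : NCPoly ℓ) : Tendsto (fun N => empirical (X N) (V.cyclicDeriv i * polyElt P)) 𝒰
      (𝓝 (τ (V.cyclicDeriv i * polyElt P))) := by
  simp only [NCSmooth.cyclicDeriv, add_mul, map_add, ← map_mul]
  refine ((h.tendsto_poly (polyCyclicDeriv i V.poly * P)).add
    (h.tendsto_fun_mul_poly i ((contDiff_infty_iff_deriv.mp (V.contDiff i)).2)
      P)).congr fun N => ?_
  rw [← empiricalLin_apply, ← empiricalLin_apply, ← empiricalLin_apply, ← map_add]

/-- The Dyson–Schwinger equations, tested against polynomials. -/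
theorem dysonSchwinger_poly (h : IsLimitAlong X 𝒰 τ) {V : NCSmooth ℓ}
    (hd : ∀ (i : Fin ℓ) (w : List (Fin ℓ)) (R : ℕ),
      Tendsto (fun N => ‖defect V i (monomial w) (X N)‖ * cutoff R (X N)) atTop (𝓝 0))
    (i : Fin ℓ) (P : NCPoly ℓ) :
    τ (V.cyclicDeriv i * polyElt P) = tensorSq τ (polyDeriv i P) := by
  induction P using NCPoly.induction with
  | ha P Q hP hQ => rw [map_add, mul_add, map_add, hP, hQ, map_add, map_add]
  | hs z P hP => rw [map_smul, mul_smul_comm, map_smul, hP, map_smul, map_smul]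
  | hm w =>
    have h1 := tendsto_zero_iff_norm_tendsto_zero.mpr (h.tendsto_of_cutoff (hd i w))
    have h2 := h.tendsto_cyclicDeriv_mul_poly V i (monomial w)
    have h3 := h2.sub (h.tendsto_traceSq (polyDeriv i (monomial w)))
    exact sub_eq_zero.mp (tendsto_nhds_unique h3 h1)

/-- The Dyson–Schwinger equations, tested against functions of one coordinate. -/
theorem dysonSchwinger_fun (h : IsLimitAlong X 𝒰 τ) {D : smoothAlg ℓ} {i : Fin ℓ}
    (hD : ∀ P, τ (D * polyElt P) = tensorSq τ (polyDeriv i P)) {m : Measure ℝ}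
    (hm : IsSpectralDistribution τ i m) (j : Fin ℓ) {f : ℝ → ℝ} (hf : ContDiff ℝ ∞ f) :
    τ (D * smoothElt j f hf) =
      if j = i then ((∫ z : ℝ × ℝ, dslope f z.1 z.2 ∂(m.prod m) : ℝ) : ℂ) else 0 := by
  obtain ⟨m', hm'⟩ := h.exists_isSpectralDistribution j
  obtain ⟨R', hR'⟩ := hm'.bounded
  obtain ⟨R'', hR''⟩ := hm.bounded
  -- One interval carries both the distribution m of X_i, which enters the right side, and the
  -- distribution m' of X_j, which controls the L² error on the left.
  set R := max R' R'' with hRdef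
  have hRj : ∀ᵐ x : ℝ ∂m', |x| ≤ R := hR'.mono fun x hx => hx.trans (le_max_left _ _)
  have hRi : ∀ᵐ x : ℝ ∂m, |x| ≤ R := hR''.mono fun x hx => hx.trans (le_max_right _ _)
  have hf1 : ContDiff ℝ 1 f := hf.of_le (by norm_cast)
  have hex : ∀ k : ℕ, ∃ p : Polynomial ℝ, ∀ x, |x| ≤ R → |p.eval x - f x| ≤ 1 / ((k : ℝ) + 1) ∧
      |p.derivative.eval x - deriv f x| ≤ 1 / ((k : ℝ) + 1) := fun k =>
    exists_polynomial_near_deriv hf1 R (by positivity)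
  choose q hq using hex
  have h1 : Tendsto (fun k => τ (D * polyElt (polyX j (q k)))) atTop
      (𝓝 (τ (D * smoothElt j f hf))) := by
    rw [tendsto_iff_norm_sub_tendsto_zero]
    refine squeeze_zero (fun _ => norm_nonneg _) (fun k => ?_)
      (mul_zero (norm₂ τ D) ▸
        (tendsto_one_div_add_atTop_nhds_zero_nat (𝕜 := ℝ)).const_mul (norm₂ τ D))
    rw [← map_sub, ← mul_sub, polyElt_polyX, ← smoothElt_sub j (contDiff_polynomial (q k)) hf]
    exact (h.law.norm_mul_le _ _).trans (mul_le_mul_of_nonneg_left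
      (hm'.norm₂_le h.law hRj (by positivity) _ fun x hx => (hq k x hx).1) (norm₂_nonneg _))
  refine tendsto_nhds_unique h1 ?_
  simp only [hD]
  split_ifs with hji
  · subst hji
    simp only [tensorSq_polyDeriv_polyX hm]
    refine (Complex.continuous_ofReal.tendsto _).comp ?_
    obtain ⟨C, hC⟩ := (isCompact_Icc (a := -R) (b := R)).exists_bound_of_continuousOn
      (hf1.continuous_deriv le_rfl).continuousOn
    refine tendsto_integral_of_dominated_convergence (fun _ => C + 1)
      (fun k => (continuous_dslope_polynomial (q k)).aestronglyMeasurable)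
      (have := hm.prob; integrable_const _) (fun k => (hm.ae_prod hRi).mono fun z hz => ?_)
      ((hm.ae_prod hRi).mono fun z hz => ?_)
    · refine abs_dslope_le (q k).differentiable (fun x hx => ?_) hz.1 hz.2
      have h2 := (hq k x hx).2
      have h3 := hC x (abs_le.mp hx)
      have h4 : 1 / ((k : ℝ) + 1) ≤ 1 := by
        rw [div_le_one (by positivity)]
        linarith [k.cast_nonneg (α := ℝ)]
      rw [Real.norm_eq_abs] at h3
      rw [Polynomial.deriv]
      rw [abs_le] at *
      constructor <;> linarith
    · rw [tendsto_iff_norm_sub_tendsto_zero]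
      refine squeeze_zero (fun _ => norm_nonneg _) (fun k => ?_)
        (tendsto_one_div_add_atTop_nhds_zero_nat (𝕜 := ℝ))
      have e : dslope (fun x => (q k).eval x) z.1 z.2 - dslope f z.1 z.2 =
          dslope (fun x => (q k).eval x - f x) z.1 z.2 := by
        have := dslope_add (f := fun x => (q k).eval x - f x) (g := f)
          ((q k).differentiable.sub (hf1.differentiable one_ne_zero))
          (hf1.differentiable one_ne_zero) z.1 z.2
        simp only [sub_add_cancel] at this
        rw [this, add_sub_cancel_right]
      rw [e]
      refine abs_dslope_le ((q k).differentiable.sub (hf1.differentiable one_ne_zero))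
        (fun x hx => ?_) hz.1 hz.2
      rw [deriv_sub (q k).differentiable.differentiableAt
        (hf1.differentiable one_ne_zero).differentiableAt, Polynomial.deriv]
      exact (hq k x hx).2
  · simp only [polyDeriv_polyX_of_ne hji, map_zero]
    exact tendsto_const_nhds

theorem dysonSchwinger (h : IsLimitAlong X 𝒰 τ) {V : NCSmooth ℓ}
    (hd : ∀ (i : Fin ℓ) (w : List (Fin ℓ)) (R : ℕ),
      Tendsto (fun N => ‖defect V i (monomial w) (X N)‖ * cutoff R (X N)) atTop (𝓝 0)) :
    DysonSchwinger V τ := by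
  intro i
  obtain ⟨m, hm⟩ := h.exists_isSpectralDistribution i
  refine ⟨m, hm, fun P => ?_⟩
  rw [NCSmooth.elt, mul_add, map_add, h.dysonSchwinger_poly hd, tensorDeriv, Finset.mul_sum,
    map_sum]
  congr 1
  rw [Finset.sum_congr rfl fun j _ => h.dysonSchwinger_fun (h.dysonSchwinger_poly hd i) hm j
    (P.contDiff j), Finset.sum_ite_eq' Finset.univ i, if_pos (Finset.mem_univ i)]

end IsLimitAlong

/-! ### Real sequences -/

theorem sum_one_div_sq_le (n : ℕ) :
    ∑ j ∈ Finset.range (n + 1), 1 / ((j : ℝ) + 1) ^ 2 ≤ 2 - 1 / ((n : ℝ) + 1) := by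
  induction n with
  | zero => norm_num
  | succ n ih =>
    rw [Finset.sum_range_succ]
    have : 1 / ((n + 1 : ℕ) + 1 : ℝ) ^ 2 ≤ 1 / ((n : ℝ) + 1) - 1 / ((n + 1 : ℕ) + 1 : ℝ) := by
      push_cast
      rw [div_sub_div _ _ (by positivity) (by positivity), div_le_div_iff₀ (by positivity)
        (by positivity)]
      nlinarith [n.cast_nonneg (α := ℝ)]
    linarith

/-- The weights `1/(j+1)²` are stable under convolution. -/
theorem sum_convolution_le (k : ℕ) :
    ∑ j ∈ Finset.range (k + 1), 1 / ((j : ℝ) + 1) ^ 2 * (1 / (((k - j : ℕ) : ℝ) + 1) ^ 2) ≤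
      8 / ((k : ℝ) + 2) ^ 2 := by
  -- With x = j + 1 and y = k - j + 1 one has x + y = k + 2, and the bound is (x + y)² ≤ 2(x² + y²)
  -- divided by x² y² (x + y)².
  have h1 : ∀ j ∈ Finset.range (k + 1),
      1 / ((j : ℝ) + 1) ^ 2 * (1 / (((k - j : ℕ) : ℝ) + 1) ^ 2) ≤
        2 / ((k : ℝ) + 2) ^ 2 * (1 / ((j : ℝ) + 1) ^ 2 + 1 / (((k - j : ℕ) : ℝ) + 1) ^ 2) := by
    intro j hj
    have hjk : (j : ℝ) + 1 + (((k - j : ℕ) : ℝ) + 1) = k + 2 := by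
      rw [Nat.cast_sub (by rw [Finset.mem_range] at hj; omega)]
      ring
    rw [← hjk]
    have hx : (0 : ℝ) < (j : ℝ) + 1 := by positivity
    have hy : (0 : ℝ) < ((k - j : ℕ) : ℝ) + 1 := by positivity
    generalize (j : ℝ) + 1 = x at *
    generalize ((k - j : ℕ) : ℝ) + 1 = y at *
    rw [div_add_div _ _ (by positivity) (by positivity), div_mul_div_comm, div_mul_div_comm,
      div_le_div_iff₀ (by positivity) (by positivity)]
    have : 0 ≤ (x * y) ^ 2 * (x - y) ^ 2 := by positivity
    nlinarith
  refine (Finset.sum_le_sum h1).trans ?_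
  rw [← Finset.mul_sum, Finset.sum_add_distrib]
  have h2 := Finset.sum_range_reflect (fun j : ℕ => 1 / ((j : ℝ) + 1) ^ 2) (k + 1)
  simp only [Nat.add_sub_cancel] at h2
  rw [h2]
  have h3 := sum_one_div_sq_le k
  have h4 : 0 ≤ 1 / ((k : ℝ) + 1) := by positivity
  calc _ ≤ 2 / ((k : ℝ) + 2) ^ 2 * 4 := by
        refine mul_le_mul_of_nonneg_left (by linarith) (by positivity)
    _ = _ := by ring

/-- A sequence subject to a quadratic recursion of Catalan type grows geometrically. -/
theorem exists_geometric_bound {η : ℝ} (hη : 0 < η) {a b L : ℝ} (ha : 0 ≤ a) (hb : 0 ≤ b)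
    (hL : 0 ≤ L) : ∃ M K : ℝ, 0 ≤ K ∧ ∀ T : ℕ → ℝ, (∀ k, 0 ≤ T k) → T 0 ≤ L →
      T 1 ^ 2 ≤ L * T 2 →
      (∀ k, 1 ≤ k → η * T (k + 1) ≤
        a + b * T k + 2 * ∑ j ∈ Finset.range k, T (j + 1) * T (k - 1 - j)) →
      ∀ k, T k ≤ M * K ^ k := by
  set c := L * (a + b + 2 * L) with hc
  have hc0 : 0 ≤ c := by positivity
  set M := 1 + L + 2 * c / η with hM
  have hM1 : 1 ≤ M := by
    have : 0 ≤ 2 * c / η := by positivity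
    linarith
  have hLM : L ≤ M := by
    have : 0 ≤ 2 * c / η := by positivity
    linarith
  set K := 4 + (4 * a + 4 * b + 16 * M) / η with hK
  have hK4 : 4 ≤ K := by
    have : 0 ≤ (4 * a + 4 * b + 16 * M) / η := by positivity
    linarith
  have hKη : 4 * a + 4 * b + 16 * M ≤ K * η := by
    rw [hK, add_mul, div_mul_cancel₀ _ hη.ne']
    linarith
  refine ⟨M, K, by linarith, fun T hT hT0 hT12 hrec => ?_⟩
  -- The recursion starts at k = 1 and says nothing about T 1. Combined with T 1² ≤ L T 2, its first
  -- instance is a quadratic inequality that bounds T 1.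
  have hT1 : T 1 ≤ M := by
    by_contra hlt
    push Not at hlt
    have h1 := hrec 1 le_rfl
    simp only [Finset.sum_range_one, Nat.sub_self, zero_add] at h1
    have h2 : η * T 1 ^ 2 ≤ 2 * c * T 1 := by
      have h3 : 1 ≤ T 1 := by linarith
      calc η * T 1 ^ 2 ≤ L * (η * T (1 + 1)) := by nlinarith
        _ ≤ L * (a * T 1 + b * T 1 + 2 * (T 1 * L)) := by
          refine mul_le_mul_of_nonneg_left (h1.trans ?_) hL
          have : T 1 * T 0 ≤ T 1 * L := mul_le_mul_of_nonneg_left hT0 (hT 1)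
          nlinarith
        _ = c * T 1 := by rw [hc]; ring
        _ ≤ _ := by nlinarith [mul_nonneg hc0 (hT 1)]
    have h4 : 2 * c / η < T 1 := by linarith
    rw [div_lt_iff₀ hη] at h4
    nlinarith
  -- The extra weight 1/(k + 1)² makes the induction close, since it is stable under convolution up
  -- to a constant.
  have main : ∀ k, T k ≤ M * K ^ k / ((k : ℝ) + 1) ^ 2 := by
    intro k
    induction k using Nat.strong_induction_on with
    | _ k ih =>
      rcases k with _ | _ | k
      · simpa using hT0.trans hLM
      · simp only [zero_add, Nat.cast_one, pow_one]
        rw [le_div_iff₀ (by positivity)]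
        nlinarith
      · have h1 := hrec (k + 1) (by omega)
        set n := k + 1 with hn
        have hsum : ∑ j ∈ Finset.range n, T (j + 1) * T (n - 1 - j) ≤
            M ^ 2 * K ^ n * (8 / ((n : ℝ) + 2) ^ 2) := by
          have h2 : ∀ j ∈ Finset.range n, T (j + 1) * T (n - 1 - j) ≤ M ^ 2 * K ^ n *
              (1 / (((j + 1 : ℕ) : ℝ) + 1) ^ 2 * (1 / (((n - (j + 1) : ℕ) : ℝ) + 1) ^ 2)) := by
            intro j hj
            rw [Finset.mem_range] at hj
            have h3 := ih (j + 1) (by omega)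
            have h4 := ih (n - 1 - j) (by omega)
            refine (mul_le_mul h3 h4 (hT _) ((hT _).trans h3)).trans (le_of_eq ?_)
            rw [show n - (j + 1) = n - 1 - j by omega]
            have : K ^ n = K ^ (j + 1) * K ^ (n - 1 - j) := by rw [← pow_add]; congr 1; omega
            rw [this]
            ring
          refine (Finset.sum_le_sum h2).trans ?_
          rw [← Finset.mul_sum]
          refine mul_le_mul_of_nonneg_left (le_trans ?_ (sum_convolution_le n)) (by positivity)
          rw [Finset.sum_range_succ' _ n]
          refine le_add_of_nonneg_right ?_
          positivity
        have h5 : T n ≤ M * K ^ n * (4 / ((n : ℝ) + 2) ^ 2) := by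
          refine (ih n (by omega)).trans ?_
          rw [mul_div_assoc]
          have : K ^ n / ((n : ℝ) + 1) ^ 2 ≤ K ^ n * (4 / ((n : ℝ) + 2) ^ 2) := by
            rw [mul_div_assoc', div_le_div_iff₀ (by positivity) (by positivity), mul_assoc]
            refine mul_le_mul_of_nonneg_left ?_ (by positivity)
            nlinarith [n.cast_nonneg (α := ℝ)]
          calc _ ≤ _ := mul_le_mul_of_nonneg_left this (by linarith)
            _ = _ := by ring
        -- Allows the constant term a of the recursion to be absorbed in the geometric bound. It
        -- uses K ≥ 4 and M ≥ 1.
        have h6 : 1 ≤ M * K ^ n * (4 / ((n : ℝ) + 2) ^ 2) := by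
          have h7 : ((n : ℝ) + 2) ^ 2 ≤ 4 * 4 ^ n := by
            have : n + 2 ≤ 2 * 2 ^ n := by
              have := n.lt_two_pow_self
              omega
            have h8 : (n : ℝ) + 2 ≤ 2 * 2 ^ n := by exact_mod_cast this
            calc ((n : ℝ) + 2) ^ 2 ≤ (2 * 2 ^ n) ^ 2 := by gcongr
              _ = _ := by rw [mul_pow, ← pow_mul, mul_comm n, pow_mul]; norm_num
          have h9 : (4 : ℝ) ^ n ≤ K ^ n := by gcongr
          have h10 : K ^ n ≤ M * K ^ n := le_mul_of_one_le_left (by positivity) hM1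
          rw [mul_div_assoc', le_div_iff₀ (by positivity)]
          linarith
        have e : (((n + 1 : ℕ) : ℝ) + 1) = n + 2 := by push_cast; ring
        rw [e]
        set s := 1 / ((n : ℝ) + 2) ^ 2 with hs
        have hs0 : 0 < s := by positivity
        rw [show (4 / ((n : ℝ) + 2) ^ 2) = 4 * s by rw [hs]; ring] at h5 h6
        rw [show (8 / ((n : ℝ) + 2) ^ 2) = 8 * s by rw [hs]; ring] at hsum
        rw [show M * K ^ (n + 1) / ((n : ℝ) + 2) ^ 2 = M * K ^ (n + 1) * s by rw [hs]; ring]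
        refine le_of_mul_le_mul_left ?_ hη
        have hP : 0 ≤ M * K ^ n * s := by positivity
        calc η * T (n + 1) ≤ a * (M * K ^ n * (4 * s)) + b * (M * K ^ n * (4 * s)) +
              2 * (M ^ 2 * K ^ n * (8 * s)) := by
              have i1 := mul_le_mul_of_nonneg_left h6 ha
              have i2 := mul_le_mul_of_nonneg_left h5 hb
              linarith
          _ = (4 * a + 4 * b + 16 * M) * (M * K ^ n * s) := by ring
          _ ≤ K * η * (M * K ^ n * s) := mul_le_mul_of_nonneg_right hKη hP
          _ = _ := by rw [pow_succ]; ring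
  intro k
  refine (main k).trans (div_le_self (by positivity) ?_)
  have := k.cast_nonneg (α := ℝ)
  nlinarith

/-! ### The trapping condition for limit points -/

/-- `Z_S = ∑_{i ∈ S} X_i²` as a polynomial. -/
def blockPoly (S : Finset (Fin ℓ)) : NCPoly ℓ := ∑ i ∈ S, monomial [i] ^ 2

theorem polyElt_blockPoly (S : Finset (Fin ℓ)) :
    polyElt (blockPoly S) = ∑ i ∈ S, coord i ^ 2 := by
  simp [blockPoly]

theorem eval_blockPoly (S : Finset (Fin ℓ)) (X : HermTuple ℓ N) :
    eval (polyElt (blockPoly S)) X = blockSq X S := by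
  rw [polyElt_blockPoly, eval_sum]
  rfl

theorem star_blockPoly (S : Finset (Fin ℓ)) :
    star (polyElt (blockPoly S)) = polyElt (blockPoly S) := by
  rw [polyElt_blockPoly, star_sum]
  exact Finset.sum_congr rfl fun i _ => by rw [star_pow, star_coord]

/-- The two orderings in the symmetrized product have complex conjugate traces. This puts the
trapping condition in the form of the left side of a Dyson–Schwinger equation. -/
theorem re_trace_blockSq_mul_symDeriv {V : NCSmooth ℓ} (hV : V.IsSelfAdj) (X : HermTuple ℓ N)
    (S : Finset (Fin ℓ)) (i : Fin ℓ) (k : ℕ) :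
    (blockSq X S ^ k * symDeriv V X i).trace.re =
      (eval (V.cyclicDeriv i * polyElt (monomial [i] * blockPoly S ^ k)) X).trace.re := by
  have hD : star (eval (V.cyclicDeriv i) X) = eval (V.cyclicDeriv i) X := by
    rw [← eval_star, hV.star_cyclicDeriv]
  have hZ : star (blockSq X S ^ k) = blockSq X S ^ k := by
    rw [star_pow, ← eval_blockPoly, ← eval_star, star_blockPoly]
  have hX : star (X i : Matrix (Fin N) (Fin N) ℂ) = X i := (X i).2
  rw [symDeriv, eval_mul, map_mul, map_pow, eval_mul, eval_pow, eval_blockPoly,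
    polyElt_monomial_singleton, eval_coord, mul_smul_comm, Matrix.trace_smul, mul_add,
    Matrix.trace_add]
  set D := eval (V.cyclicDeriv i) X
  set Z := blockSq X S ^ k
  have e1 : (Z * (D * (X i : Matrix (Fin N) (Fin N) ℂ))).trace = (D * (X i * Z)).trace := by
    rw [Matrix.trace_mul_comm, mul_assoc]
  have e2 : (Z * ((X i : Matrix (Fin N) (Fin N) ℂ) * D)).trace = star (D * (X i * Z)).trace := by
    rw [← Matrix.trace_conjTranspose, ← Matrix.star_eq_conjTranspose, star_mul, star_mul, hD, hZ,
      hX, mul_assoc]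
  rw [e1, e2]
  generalize (D * ((X i : Matrix (Fin N) (Fin N) ℂ) * Z)).trace = w
  simp
  ring

namespace IsLimitAlong

/-- The matrix inequality is divided by N, which normalizes Tr 1 to 1, and passes to the limit since
every term is the empirical law of a polynomial or of 𝒟_i V times a polynomial. -/
theorem trapping_le (h : IsLimitAlong X 𝒰 τ) {η A : ℝ}
    {I : Finpartition (Finset.univ : Finset (Fin ℓ))} {V : NCSmooth ℓ} (hV : IsTrapping η A I V)
    {k : ℕ} (hk : 1 ≤ k) :
    η * ∑ S ∈ I.parts, (τ (polyElt (blockPoly S ^ (k + 1)))).re -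
        A * (1 + ∑ S ∈ I.parts, (τ (polyElt (blockPoly S ^ k))).re) ≤
      ∑ S ∈ I.parts, ∑ i ∈ S,
        (τ (V.cyclicDeriv i * polyElt (monomial [i] * blockPoly S ^ k))).re := by
  have hre : ∀ P : NCPoly ℓ, Tendsto (fun N => (empirical (X N) (polyElt P)).re) 𝒰
      (𝓝 (τ (polyElt P)).re) := fun P =>
    (Complex.continuous_re.tendsto _).comp (h.tendsto_poly P)
  have h1 := ((tendsto_finsetSum I.parts fun S _ => hre (blockPoly S ^ (k + 1))).const_mul η).sub
    (((tendsto_finsetSum I.parts fun S _ => hre (blockPoly S ^ k)).const_add 1).const_mul A)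
  have h2 : Tendsto (fun N => ∑ S ∈ I.parts, ∑ i ∈ S, (empirical (X N)
      (V.cyclicDeriv i * polyElt (monomial [i] * blockPoly S ^ k))).re) 𝒰 _ :=
    tendsto_finsetSum I.parts fun S _ => tendsto_finsetSum S fun i _ =>
      (Complex.continuous_re.tendsto _).comp (h.tendsto_cyclicDeriv_mul_poly V i _)
  refine le_of_tendsto_of_tendsto h1 h2 ?_
  filter_upwards [h.eventually_one_le] with N hN
  have h3 := hV.2.2 k N hk hN (X N)
  have hN' : (0 : ℝ) < N := by exact_mod_cast hN
  have hemp : ∀ a : smoothAlg ℓ, (empirical (X N) a).re = 1 / N * (eval a (X N)).trace.re := by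
    intro a
    rw [empirical, show (1 / N : ℂ) = ((1 / N : ℝ) : ℂ) by push_cast; rfl, Complex.re_ofReal_mul]
  have e1 : ∀ n : ℕ, ∑ S ∈ I.parts, (empirical (X N) (polyElt (blockPoly S ^ n))).re =
      1 / N * (∑ S ∈ I.parts, blockSq (X N) S ^ n).trace.re := fun n => by
    rw [Matrix.trace_sum, Complex.re_sum, Finset.mul_sum]
    exact Finset.sum_congr rfl fun S _ => by
      rw [hemp, map_pow, eval_pow, eval_blockPoly]
  rw [e1, e1]
  have e2 : ∑ S ∈ I.parts, ∑ i ∈ S, (empirical (X N)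
      (V.cyclicDeriv i * polyElt (monomial [i] * blockPoly S ^ k))).re =
      1 / N * (∑ S ∈ I.parts, blockSq (X N) S ^ k * ∑ i ∈ S, symDeriv V (X N) i).trace.re := by
    rw [Matrix.trace_sum, Complex.re_sum, Finset.mul_sum]
    refine Finset.sum_congr rfl fun S _ => ?_
    rw [Finset.mul_sum, Matrix.trace_sum, Complex.re_sum, Finset.mul_sum]
    exact Finset.sum_congr rfl fun i _ => by
      rw [hemp, re_trace_blockSq_mul_symDeriv hV.2.1]
  rw [e2]
  have h4 := mul_le_mul_of_nonneg_left h3 (by positivity : (0 : ℝ) ≤ 1 / N)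
  refine le_trans (le_of_eq ?_) h4
  rw [Matrix.trace_sub, Matrix.trace_smul, Matrix.trace_smul, Matrix.trace_add, Matrix.trace_one,
    Complex.sub_re, smul_eq_mul, smul_eq_mul, Complex.re_ofReal_mul, Complex.re_ofReal_mul,
    Complex.add_re, Fintype.card_fin, Complex.natCast_re]
  field_simp

end IsLimitAlong

/-! ### Linear combinations of potentials -/

theorem NCSmooth.cyclicDeriv_smul_add (β : ℝ) (U W : NCSmooth ℓ) (i : Fin ℓ) :
    (β • U + W).cyclicDeriv i = (β : ℂ) • U.cyclicDeriv i + W.cyclicDeriv i := by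
  have hU := (contDiff_infty_iff_deriv.mp (U.contDiff i))
  have hW := (contDiff_infty_iff_deriv.mp (W.contDiff i))
  have e1 : (β • U + W).cyclicDeriv i = polyElt (polyCyclicDeriv i ((β : ℂ) • U.poly + W.poly)) +
      smoothElt i (fun x => β * deriv (U.smooth i) x + deriv (W.smooth i) x)
        ((contDiff_const.mul hU.2).add hW.2) := by
    rw [NCSmooth.cyclicDeriv]
    congr 2
    funext x
    exact (((hU.1 x).hasDerivAt.const_mul β).add (hW.1 x).hasDerivAt).deriv
  rw [e1, smoothElt_add i (contDiff_const.mul hU.2) hW.2, smoothElt_const_mul i β hU.2, map_add,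
    map_smul, map_add, map_smul, NCSmooth.cyclicDeriv, NCSmooth.cyclicDeriv, smul_add]
  abel

theorem NCSmooth.IsSelfAdj.smul_add {U W : NCSmooth ℓ} (hU : U.IsSelfAdj) (hW : W.IsSelfAdj)
    (β : ℝ) : (β • U + W).IsSelfAdj := by
  intro w
  change ((β : ℂ) • U.poly + W.poly).coeff w.reverse =
    star (((β : ℂ) • U.poly + W.poly).coeff w)
  simp [hU w, hW w]

/-! ### Moments of the blocks -/

theorem polyDeriv_blockPoly {i : Fin ℓ} {S : Finset (Fin ℓ)} (hi : i ∈ S) :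
    polyDeriv i (blockPoly S) = 1 ⊗ₜ monomial [i] + monomial [i] ⊗ₜ 1 := by
  have h : ∀ j ∈ S, polyDeriv i (monomial [j] ^ 2) =
      if j = i then 1 ⊗ₜ monomial [i] + monomial [i] ⊗ₜ 1 else 0 := by
    intro j _
    rw [pow_two, polyDeriv_mul, polyDeriv_X]
    split_ifs with hji
    · rw [hji, one_mul, mul_one]
    · rw [zero_mul, mul_zero, add_zero]
  rw [blockPoly, map_sum, Finset.sum_congr rfl h, Finset.sum_ite_eq', if_pos hi]

theorem polyDeriv_mul_blockPoly_pow {i : Fin ℓ} {S : Finset (Fin ℓ)} (hi : i ∈ S) (k : ℕ) :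
    polyDeriv i (monomial [i] * blockPoly S ^ k) = 1 ⊗ₜ (blockPoly S ^ k) +
      ∑ a ∈ Finset.range k,
        ((monomial [i] * blockPoly S ^ a) ⊗ₜ (monomial [i] * blockPoly S ^ (k - 1 - a)) +
          (monomial [i] * blockPoly S ^ a * monomial [i]) ⊗ₜ (blockPoly S ^ (k - 1 - a))) := by
  rw [polyDeriv_mul, polyDeriv_X, if_pos rfl, one_mul, polyDeriv_pow, Finset.mul_sum]
  congr 1
  refine Finset.sum_congr rfl fun a _ => ?_
  rw [polyDeriv_blockPoly hi]
  simp [mul_add, add_mul, mul_assoc]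

theorem tensorSq_tmul (u v : NCPoly ℓ) :
    tensorSq τ (u ⊗ₜ v) = τ (polyElt u) * τ (polyElt v) := rfl

namespace IsNCLaw

theorem im_eq_zero_of_star (hτ : IsNCLaw τ) {a : smoothAlg ℓ} (h : τ (star a) = τ a) :
    (τ a).im = 0 := by
  rw [hτ.map_star] at h
  exact Complex.conj_eq_iff_im.mp h

/-- An even power splits into a square. For an odd power the middle factor Z is expanded as the sum
of the X_i², which leaves a sum of squares. -/
theorem nonneg_blockPoly_pow (hτ : IsNCLaw τ) (S : Finset (Fin ℓ)) (a : ℕ) (c : smoothAlg ℓ) :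
    0 ≤ (τ (star c * (polyElt (blockPoly S) ^ a * c))).re := by
  have hz := star_blockPoly S
  set z := polyElt (blockPoly S) with hzdef
  have hzp : ∀ b : ℕ, star (z ^ b) = z ^ b := fun b => by rw [star_pow, hz]
  rcases Nat.even_or_odd' a with ⟨b, rfl | rfl⟩
  · have e : star c * (z ^ (2 * b) * c) = star (z ^ b * c) * (z ^ b * c) := by
      rw [star_mul, hzp, two_mul, pow_add]
      noncomm_ring
    rw [e]
    exact hτ.nonneg_re _
  · have e : star c * (z ^ (2 * b + 1) * c) =
        ∑ i ∈ S, star (coord i * (z ^ b * c)) * (coord i * (z ^ b * c)) := by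
      have e1 : z ^ (2 * b + 1) = z ^ b * (∑ i ∈ S, coord i ^ 2) * z ^ b := by
        rw [← polyElt_blockPoly, ← hzdef, ← pow_succ, ← pow_add]
        congr 1
        omega
      rw [e1, Finset.mul_sum, Finset.sum_mul, Finset.sum_mul, Finset.mul_sum]
      refine Finset.sum_congr rfl fun i _ => ?_
      rw [star_mul, star_mul, hzp, star_coord, pow_two]
      simp only [mul_assoc]
    rw [e, map_sum, Complex.re_sum]
    exact Finset.sum_nonneg fun i _ => hτ.nonneg_re _

/-- Cauchy–Schwarz for the form (c, d) ↦ τ(c* Z^a d), applied to X_i and 1. It is read off from the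
discriminant of a nonnegative quadratic polynomial. -/
theorem sq_mul_blockPoly_pow_le (hτ : IsNCLaw τ) (S : Finset (Fin ℓ)) (i : Fin ℓ) (a : ℕ) :
    (τ (coord i * polyElt (blockPoly S) ^ a)).re ^ 2 ≤
      (τ (coord i * polyElt (blockPoly S) ^ a * coord i)).re *
        (τ (polyElt (blockPoly S) ^ a)).re := by
  set z := polyElt (blockPoly S) with hz
  have h : ∀ s : ℝ, 0 ≤ (τ (coord i * z ^ a * coord i)).re * (s * s) +
      2 * (τ (coord i * z ^ a)).re * s + (τ (z ^ a)).re := by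
    intro s
    have h1 := hτ.nonneg_blockPoly_pow S a ((s : ℂ) • coord i + 1)
    rw [← hz] at h1
    have e : star ((s : ℂ) • coord i + 1) * (z ^ a * ((s : ℂ) • coord i + 1)) =
        ((s * s : ℝ) : ℂ) • (coord i * z ^ a * coord i) + (s : ℂ) • (coord i * z ^ a) +
          (s : ℂ) • (z ^ a * coord i) + z ^ a := by
      rw [star_add, star_one, star_smul, star_coord, Complex.star_def, Complex.conj_ofReal,
        Complex.ofReal_mul, ← smul_smul]
      simp only [add_mul, mul_add, smul_add, smul_mul_assoc, mul_smul_comm, one_mul, mul_one, mul_assoc]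
      abel
    rw [e, map_add, map_add, map_add, map_smul, map_smul, map_smul, hτ.trace (z ^ a),
      Complex.add_re, Complex.add_re, Complex.add_re, smul_eq_mul, smul_eq_mul,
      Complex.re_ofReal_mul, Complex.re_ofReal_mul] at h1
    linarith
  have := discrim_le_zero h
  rw [discrim] at this
  nlinarith

/-- The contribution of a block to the trapping inequality, by the Dyson–Schwinger equations. -/
theorem sum_cyclicDeriv_mul_le (hτ : IsNCLaw τ) {D : Fin ℓ → smoothAlg ℓ}
    (hD : ∀ i P, τ (D i * polyElt P) = tensorSq τ (polyDeriv i P)) (S : Finset (Fin ℓ)) (k : ℕ) :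
    ∑ i ∈ S, (τ (D i * polyElt (monomial [i] * blockPoly S ^ k))).re ≤
      S.card * (τ (polyElt (blockPoly S ^ k))).re + 2 * ∑ a ∈ Finset.range k,
        (τ (polyElt (blockPoly S ^ (a + 1)))).re *
          (τ (polyElt (blockPoly S ^ (k - 1 - a)))).re := by
  simp only [hD]
  set z := polyElt (blockPoly S) with hz
  have hzs : ∀ b : ℕ, star (z ^ b) = z ^ b := fun b => by rw [star_pow, star_blockPoly]
  set t : ℕ → ℝ := fun k => (τ (z ^ k)).re with ht
  set u : Fin ℓ → ℕ → ℝ := fun i a => (τ (coord i * z ^ a * coord i)).re with hu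
  set p : Fin ℓ → ℕ → ℝ := fun i a => (τ (coord i * z ^ a)).re with hp
  have ht0 : ∀ a, 0 ≤ t a := fun a => by
    have := hτ.nonneg_blockPoly_pow S a 1
    rwa [star_one, one_mul, mul_one] at this
  have hu0 : ∀ i a, 0 ≤ u i a := fun i a => by
    have := hτ.nonneg_blockPoly_pow S a (coord i)
    rwa [star_coord, ← mul_assoc] at this
  have hsum : ∀ a, ∑ i ∈ S, u i a = t (a + 1) := fun a => by
    simp only [hu, ht]
    rw [← Complex.re_sum, pow_succ, hz, polyElt_blockPoly S, Finset.mul_sum, map_sum]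
    congr 1
    refine Finset.sum_congr rfl fun i _ => ?_
    rw [mul_assoc, hτ.trace, pow_two, mul_assoc]
  have him : ∀ i a, (τ (coord i * z ^ a)).im = 0 := fun i a =>
    hτ.im_eq_zero_of_star (by rw [star_mul, hzs, star_coord, hτ.trace])
  have htim : ∀ a, (τ (z ^ a)).im = 0 := fun a => hτ.im_eq_zero_of_star (by rw [hzs])
  -- Terms with an odd number of factors X_i in each leg have no sign. They are dominated by the
  -- positive terms of the other type, through Cauchy–Schwarz and the arithmetic-geometric
  -- inequality.
  have hpp : ∀ i a b, p i a * p i b ≤ (u i a * t b + u i b * t a) / 2 := by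
    intro i a b
    have h1 := hτ.sq_mul_blockPoly_pow_le S i a
    have h2 := hτ.sq_mul_blockPoly_pow_le S i b
    change p i a ^ 2 ≤ u i a * t a at h1
    change p i b ^ 2 ≤ u i b * t b at h2
    refine le_of_sq_le_sq ?_ (by have := hu0 i a; have := hu0 i b; have := ht0 a; have := ht0 b
                                 positivity)
    have h3 := mul_le_mul h1 h2 (sq_nonneg _) (mul_nonneg (hu0 i a) (ht0 a))
    nlinarith [sq_nonneg (u i a * t b - u i b * t a)]
  have key : ∀ i ∈ S, (tensorSq τ (polyDeriv i (monomial [i] * blockPoly S ^ k))).re ≤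
      t k + ∑ a ∈ Finset.range k, ((u i a * t (k - 1 - a) + u i (k - 1 - a) * t a) / 2 +
        u i a * t (k - 1 - a)) := by
    intro i hi
    rw [polyDeriv_mul_blockPoly_pow hi, map_add, map_sum, tensorSq_tmul, map_one, hτ.one, one_mul,
      Complex.add_re, Complex.re_sum, map_pow]
    refine add_le_add le_rfl (Finset.sum_le_sum fun a _ => ?_)
    rw [map_add, tensorSq_tmul, tensorSq_tmul]
    simp only [map_mul, map_pow, polyElt_monomial_singleton, ← hz]
    rw [Complex.add_re, Complex.mul_re, Complex.mul_re, him, htim, zero_mul, mul_zero, sub_zero,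
      sub_zero]
    exact add_le_add (hpp i a (k - 1 - a)) le_rfl
  refine (Finset.sum_le_sum key).trans (le_of_eq ?_)
  rw [Finset.sum_add_distrib, Finset.sum_const, nsmul_eq_mul, map_pow, Finset.sum_comm]
  congr 1
  -- Summation over the block turns u i a into t (a + 1). The reflection a ↦ k - 1 - a identifies
  -- the two sums, and 3/2 + 1/2 is the factor 2 of the statement.
  have e1 : ∀ a ∈ Finset.range k, ∑ i ∈ S, ((u i a * t (k - 1 - a) + u i (k - 1 - a) * t a) / 2 +
      u i a * t (k - 1 - a)) =
      3 / 2 * (t (a + 1) * t (k - 1 - a)) + 1 / 2 * (t (k - 1 - a + 1) * t a) := by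
    intro a _
    rw [Finset.sum_add_distrib, ← Finset.sum_div, Finset.sum_add_distrib, ← Finset.sum_mul,
      ← Finset.sum_mul, hsum, hsum]
    ring
  rw [Finset.sum_congr rfl e1, Finset.sum_add_distrib, ← Finset.mul_sum, ← Finset.mul_sum]
  have e2 : ∑ a ∈ Finset.range k, t (k - 1 - a + 1) * t a =
      ∑ a ∈ Finset.range k, t (a + 1) * t (k - 1 - a) := by
    rw [← Finset.sum_range_reflect]
    refine Finset.sum_congr rfl fun a ha => ?_
    rw [Finset.mem_range] at ha
    congr 2
    omega
  rw [e2]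
  simp only [map_pow]
  change _ = 2 * ∑ a ∈ Finset.range k, t (a + 1) * t (k - 1 - a)
  ring

end IsNCLaw

/-- Boundedness of a coordinate from that of a block containing it. -/
theorem isBoundedBy_coord_of_blockPoly (hτ : IsNCLaw τ) {S : Finset (Fin ℓ)} {i : Fin ℓ}
    (hi : i ∈ S) {K : ℝ} (h : IsBoundedBy τ (polyElt (blockPoly S)) K) :
    IsBoundedBy τ (coord i) (Real.sqrt K) := by
  refine ⟨Real.sqrt_nonneg _, fun c => ?_⟩
  refine le_of_sq_le_sq ?_ (mul_nonneg (Real.sqrt_nonneg _) (norm₂_nonneg _))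
  rw [mul_pow, Real.sq_sqrt h.1]
  have e : star c * (polyElt (blockPoly S) * c) = ∑ j ∈ S, star (coord j * c) * (coord j * c) := by
    rw [polyElt_blockPoly, Finset.sum_mul, Finset.mul_sum]
    refine Finset.sum_congr rfl fun j _ => ?_
    rw [star_mul, star_coord, pow_two]
    simp only [mul_assoc]
  calc norm₂ τ (coord i * c) ^ 2 ≤ ∑ j ∈ S, norm₂ τ (coord j * c) ^ 2 :=
        Finset.single_le_sum (f := fun j => norm₂ τ (coord j * c) ^ 2) (fun j _ => sq_nonneg _) hi
    _ = (τ (star c * (polyElt (blockPoly S) * c))).re := by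
        rw [e, map_sum, Complex.re_sum]
        exact Finset.sum_congr rfl fun j _ => hτ.norm₂_sq _
    _ ≤ norm₂ τ c * (K * norm₂ τ c) := (Complex.re_le_norm _).trans
        ((hτ.norm_star_mul_le _ _).trans
          (mul_le_mul_of_nonneg_left (h.2 c) (norm₂_nonneg _)))
    _ = K * norm₂ τ c ^ 2 := by ring

/-- The coordinates are bounded under limit points, uniformly in the inverse temperature and in
the partition. -/
theorem exists_isBoundedBy_coord (ℓ : ℕ) {η : ℝ} (hη : 0 < η) (A : ℝ) : ∃ R : ℝ,
    ∀ (I : Finpartition (Finset.univ : Finset (Fin ℓ))) (U W : NCSmooth ℓ),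
      IsTrapping η A I U → IsTrapping η A I W → ∀ β : ℝ, 0 ≤ β →
      ∀ (X : (N : ℕ) → HermTuple ℓ N) (𝒰 : Ultrafilter ℕ) (τ : smoothAlg ℓ →ₗ[ℂ] ℂ),
        IsLimitAlong X 𝒰 τ →
        (∀ i P, τ ((β • U + W).cyclicDeriv i * polyElt P) = tensorSq τ (polyDeriv i P)) →
        ∀ i, IsBoundedBy τ (coord i) R := by
  -- The term |A| comes from the trapping constant, ℓ in the coefficient of T k from the size of the
  -- blocks, and the last ℓ from their number. Neither β, nor the partition, nor the potentials
  -- enter.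
  obtain ⟨M, K, hK, hT⟩ := exists_geometric_bound hη (abs_nonneg A)
    (by positivity : 0 ≤ |A| + ℓ) (Nat.cast_nonneg ℓ)
  refine ⟨Real.sqrt K, fun I U W hU hW β hβ X 𝒰 τ h hD i => ?_⟩
  have hτ := h.law
  set t : Finset (Fin ℓ) → ℕ → ℝ := fun S k => (τ (polyElt (blockPoly S ^ k))).re with ht
  have ht0 : ∀ S k, 0 ≤ t S k := fun S k => by
    have := hτ.nonneg_blockPoly_pow S k 1
    rwa [star_one, one_mul, mul_one, ← map_pow] at this
  set T : ℕ → ℝ := fun k => ∑ S ∈ I.parts, t S k with hTdef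
  have htT : ∀ S ∈ I.parts, ∀ k, t S k ≤ T k := fun S hS k =>
    Finset.single_le_sum (f := fun S => t S k) (fun S _ => ht0 S k) hS
  have hT0 : ∀ k, 0 ≤ T k := fun k => Finset.sum_nonneg fun S _ => ht0 S k
  have hcard : (I.parts.card : ℝ) ≤ ℓ := by
    have := I.card_parts_le_card
    rw [Finset.card_univ, Fintype.card_fin] at this
    exact_mod_cast this
  have hbound := hT T hT0 (by
      simp only [hTdef, ht, pow_zero, map_one, hτ.one, Complex.one_re, Finset.sum_const,
        nsmul_eq_mul, mul_one]
      exact hcard) (by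
      refine (sq_sum_le_card_mul_sum_sq (s := I.parts) (f := fun S => t S 1)).trans ?_
      refine mul_le_mul hcard (Finset.sum_le_sum fun S _ => ?_)
        (Finset.sum_nonneg fun S _ => sq_nonneg _) (Nat.cast_nonneg _)
      have h1 := hτ.norm_le_norm₂ (polyElt (blockPoly S ^ 1))
      have h2 := (Complex.abs_re_le_norm _).trans h1
      have h3 := pow_le_pow_left₀ (abs_nonneg _) h2 2
      rw [sq_abs, hτ.norm₂_sq, map_pow, star_pow, star_blockPoly, pow_one, ← pow_two,
        ← map_pow] at h3
      simpa only [ht, pow_one] using h3) (fun k hk => by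
      have h1 := h.trapping_le hU hk
      have h2 := h.trapping_le hW hk
      change η * T (k + 1) - A * (1 + T k) ≤ _ at h1 h2
      have h3 : β * (∑ S ∈ I.parts, ∑ i ∈ S,
          (τ (U.cyclicDeriv i * polyElt (monomial [i] * blockPoly S ^ k))).re) +
          (∑ S ∈ I.parts, ∑ i ∈ S,
          (τ (W.cyclicDeriv i * polyElt (monomial [i] * blockPoly S ^ k))).re) =
          ∑ S ∈ I.parts, ∑ i ∈ S,
            (τ ((β • U + W).cyclicDeriv i * polyElt (monomial [i] * blockPoly S ^ k))).re := by
        simp only [NCSmooth.cyclicDeriv_smul_add, add_mul, smul_mul_assoc, map_add, map_smul,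
          smul_eq_mul, Complex.add_re, Complex.re_ofReal_mul, Finset.mul_sum,
          Finset.sum_add_distrib]
      have h4 : ∑ S ∈ I.parts, ∑ i ∈ S,
            (τ ((β • U + W).cyclicDeriv i * polyElt (monomial [i] * blockPoly S ^ k))).re ≤
          ℓ * T k + 2 * ∑ j ∈ Finset.range k, T (j + 1) * T (k - 1 - j) := by
        refine (Finset.sum_le_sum fun S _ => hτ.sum_cyclicDeriv_mul_le hD S k).trans ?_
        rw [Finset.sum_add_distrib]
        refine add_le_add ?_ ?_
        · rw [hTdef, Finset.mul_sum]
          refine Finset.sum_le_sum fun S _ => mul_le_mul_of_nonneg_right ?_ (ht0 S k)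
          have := Finset.card_le_univ S
          rw [Fintype.card_fin] at this
          exact_mod_cast this
        · rw [← Finset.mul_sum, Finset.sum_comm]
          refine mul_le_mul_of_nonneg_left (Finset.sum_le_sum fun j _ => ?_) (by norm_num)
          change _ ≤ (∑ S ∈ I.parts, t S (j + 1)) * _
          rw [Finset.sum_mul]
          exact Finset.sum_le_sum fun S hS => mul_le_mul_of_nonneg_left (htT S hS _) (ht0 S _)
      set Q := ℓ * T k + 2 * ∑ j ∈ Finset.range k, T (j + 1) * T (k - 1 - j) with hQ
      have hQ0 : 0 ≤ Q := add_nonneg (mul_nonneg (Nat.cast_nonneg _) (hT0 k))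
        (mul_nonneg zero_le_two (Finset.sum_nonneg fun j _ => mul_nonneg (hT0 _) (hT0 _)))
      have h5 : (β + 1) * (η * T (k + 1) - A * (1 + T k)) ≤ Q := by
        have := mul_le_mul_of_nonneg_left h1 hβ
        linarith
      -- Since Q ≥ 0 and β + 1 ≥ 1, the factor β + 1 can be dropped: this is where uniformity in β
      -- comes from.
      have h6 : η * T (k + 1) - A * (1 + T k) ≤ Q := by
        by_contra hlt
        push Not at hlt
        nlinarith
      have h7 : A * (1 + T k) ≤ |A| * (1 + T k) :=
        mul_le_mul_of_nonneg_right (le_abs_self A) (by linarith [hT0 k])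
      rw [hQ] at h6
      linarith)
  obtain ⟨S, hS, hiS⟩ := I.exists_mem (Finset.mem_univ i)
  refine isBoundedBy_coord_of_blockPoly hτ hiS (isBoundedBy_of_moments (M := M) hτ
    (star_blockPoly S) hK fun n => ?_)
  rw [← map_pow]
  exact (htT S hS (2 * n)).trans (hbound (2 * n))

/-- The distribution of a bounded coordinate is supported in the corresponding interval. -/
theorem IsSpectralDistribution.ae_abs_le {i : Fin ℓ} {m : Measure ℝ}
    (hm : IsSpectralDistribution τ i m) (hτ : IsNCLaw τ) {R : ℝ}
    (hR : IsBoundedBy τ (coord i) R) : ∀ᵐ x : ℝ ∂m, |x| ≤ R := by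
  have := hm.prob
  have hmom : ∀ n : ℕ, ∫ x, x ^ (2 * n) ∂m ≤ R ^ (2 * n) := fun n => by
    have h1 := (hR.pow (2 * n)).norm_le hτ
    have h2 := hm.moment (2 * n)
    rw [map_pow, polyElt_monomial_singleton] at h2
    rw [h2, Complex.norm_real] at h1
    exact (le_abs_self _).trans h1
  have hint : ∀ n : ℕ, Integrable (fun x : ℝ => x ^ (2 * n)) m := fun n => by
    obtain ⟨S, hS⟩ := hm.bounded
    refine Integrable.of_bound (by fun_prop) (S ^ (2 * n)) (hS.mono fun x hx => ?_)
    rw [norm_pow, Real.norm_eq_abs]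
    exact pow_le_pow_left₀ (abs_nonneg _) hx _
  have hnull : ∀ r : ℝ, R < r → m.real {x | r ≤ |x|} = 0 := by
    intro r hr
    have hr0 : 0 < r := hR.1.trans_lt hr
    -- Markov's inequality for the moment of order 2n. As n grows it excludes mass beyond any r > R.
    have h1 : ∀ n : ℕ, m.real {x | r ≤ |x|} ≤ ((R / r) ^ 2) ^ n := by
      intro n
      have h2 := mul_meas_ge_le_integral_of_nonneg (μ := m) (f := fun x : ℝ => x ^ (2 * n))
        (Filter.Eventually.of_forall fun x => (even_two_mul n).pow_nonneg x) (hint n) (r ^ (2 * n))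
      have h3 : m.real {x | r ≤ |x|} ≤ m.real {x : ℝ | r ^ (2 * n) ≤ x ^ (2 * n)} := by
        refine measureReal_mono fun x hx => ?_
        have := pow_le_pow_left₀ hr0.le (show r ≤ |x| from hx) (2 * n)
        rwa [pow_mul |x|, sq_abs, ← pow_mul] at this
      rw [← pow_mul, div_pow, le_div_iff₀ (by positivity), mul_comm]
      exact (mul_le_mul_of_nonneg_left h3 (by positivity)).trans (h2.trans (hmom n))
    have h4 : Tendsto (fun n : ℕ => ((R / r) ^ 2) ^ n) atTop (𝓝 0) := by
      refine tendsto_pow_atTop_nhds_zero_of_lt_one (sq_nonneg _) ?_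
      have : R / r < 1 := (div_lt_one hr0).mpr hr
      have : 0 ≤ R / r := div_nonneg hR.1 hr0.le
      nlinarith
    exact le_antisymm (ge_of_tendsto' h4 h1) measureReal_nonneg
  have hall : ∀ n : ℕ, ∀ᵐ x : ℝ ∂m, |x| < R + 1 / ((n : ℝ) + 1) := fun n => by
    have h1 := hnull (R + 1 / ((n : ℝ) + 1)) (lt_add_of_pos_right _ (by positivity))
    rw [measureReal_eq_zero_iff] at h1
    rw [ae_iff]
    simpa only [not_lt] using h1
  filter_upwards [ae_all_iff.mpr hall] with x hx
  refine le_of_forall_pos_lt_add fun ε hε => ?_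
  obtain ⟨n, hn⟩ := exists_nat_one_div_lt hε
  exact (hx n).trans (by linarith)

/-! ### Bounds that are uniform over laws with bounded coordinates -/

/-- The constant is chosen before the law, so that it applies to all limit points and all β at once.
-/
theorem exists_isBoundedBy_polyElt (P : NCPoly ℓ) (R : ℝ) : ∃ C : ℝ, 0 ≤ C ∧
    ∀ τ : smoothAlg ℓ →ₗ[ℂ] ℂ, IsNCLaw τ → (∀ i, IsBoundedBy τ (coord i) R) →
      IsBoundedBy τ (polyElt P) C := by
  induction P using NCPoly.induction with
  | ha P Q hP hQ =>
    obtain ⟨C, hC, h⟩ := hP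
    obtain ⟨C', hC', h'⟩ := hQ
    refine ⟨C + C', add_nonneg hC hC', fun τ hτ hR => ?_⟩
    rw [map_add]
    exact (h τ hτ hR).add hτ (h' τ hτ hR)
  | hs z P hP =>
    obtain ⟨C, hC, h⟩ := hP
    refine ⟨‖z‖ * C, by positivity, fun τ hτ hR => ?_⟩
    rw [map_smul]
    exact (h τ hτ hR).smul z
  | hm w =>
    refine ⟨|R| ^ w.length, by positivity, fun τ hτ hR => ?_⟩
    induction w with
    | nil => simpa using IsBoundedBy.one
    | cons j w ih =>
      rw [polyElt_monomial_cons, List.length_cons, pow_succ']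
      exact ((hR j).mono (le_abs_self R)).mul ih

/-- Products of `τ ⊗ τ` with a fixed tensor, in terms of the `L²` norms of the factors. -/
theorem exists_norm_tensorSq_le (T : NCPoly ℓ ⊗[ℂ] NCPoly ℓ) (R : ℝ) : ∃ C : ℝ, 0 ≤ C ∧
    ∀ τ : smoothAlg ℓ →ₗ[ℂ] ℂ, IsNCLaw τ → (∀ i, IsBoundedBy τ (coord i) R) →
      ∀ P P' Q Q' : NCPoly ℓ,
        ‖tensorSq τ (((P * P') ⊗ₜ 1) * T * (1 ⊗ₜ (Q * Q')))‖ ≤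
          C * (norm₂ τ (polyElt P) * norm₂ τ (polyElt P') *
            (norm₂ τ (polyElt Q) * norm₂ τ (polyElt Q'))) := by
  induction T with
  | zero => exact ⟨0, le_rfl, fun τ _ _ P P' Q Q' => by simp⟩
  | add S T hS hT =>
    obtain ⟨C, hC, h⟩ := hS
    obtain ⟨C', hC', h'⟩ := hT
    refine ⟨C + C', add_nonneg hC hC', fun τ hτ hR P P' Q Q' => ?_⟩
    rw [mul_add, add_mul, map_add, add_mul]
    exact (norm_add_le _ _).trans (add_le_add (h τ hτ hR P P' Q Q') (h' τ hτ hR P P' Q Q'))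
  | tmul u v =>
    obtain ⟨C, hC, h⟩ := exists_isBoundedBy_polyElt u R
    obtain ⟨C', hC', h'⟩ := exists_isBoundedBy_polyElt v R
    refine ⟨C * C', mul_nonneg hC hC', fun τ hτ hR P P' Q Q' => ?_⟩
    rw [Algebra.TensorProduct.tmul_mul_tmul, Algebra.TensorProduct.tmul_mul_tmul, one_mul, mul_one,
      tensorSq_tmul, norm_mul]
    have h1 : ‖τ (polyElt (P * P' * u))‖ ≤
        norm₂ τ (polyElt P) * (C * norm₂ τ (polyElt P')) := by
      rw [mul_assoc, map_mul polyElt, map_mul polyElt]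
      exact (hτ.norm_mul_le _ _).trans
        (mul_le_mul_of_nonneg_left ((h τ hτ hR).right hτ _) (norm₂_nonneg _))
    have h2 : ‖τ (polyElt (v * (Q * Q')))‖ ≤
        (C' * norm₂ τ (polyElt Q)) * norm₂ τ (polyElt Q') := by
      rw [← mul_assoc, map_mul polyElt, map_mul polyElt]
      exact (hτ.norm_mul_le _ _).trans
        (mul_le_mul_of_nonneg_right ((h' τ hτ hR).2 _) (norm₂_nonneg _))
    refine (mul_le_mul h1 h2 (norm_nonneg _) ((norm_nonneg _).trans h1)).trans (le_of_eq ?_)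
    ring

/-- Contraction of `∂_i p(X_i)` with two linear functionals, in terms of difference quotients. -/
theorem exists_contract_polyDeriv_polyX (i : Fin ℓ) (φ ψ : NCPoly ℓ →ₗ[ℂ] ℂ) (p : Polynomial ℝ) :
    ∃ (g g' : Polynomial ℝ) (f : ℝ → Polynomial ℝ),
      (∀ x y, (f x).eval y = dslope (fun t => p.eval t) x y) ∧
      (∀ x, (((g.eval x : ℝ) : ℂ) + Complex.I * (g'.eval x : ℝ)) = ψ (polyX i (f x))) ∧
      LinearMap.mul' ℂ ℂ (TensorProduct.map φ ψ (polyDeriv i (polyX i p))) =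
        φ (polyX i g) + Complex.I * φ (polyX i g') := by
  induction p using Polynomial.induction_on' with
  | add p q hp hq =>
    obtain ⟨g, g', f, h1, h2, h3⟩ := hp
    obtain ⟨k, k', f', h1', h2', h3'⟩ := hq
    refine ⟨g + k, g' + k', fun x => f x + f' x, fun x y => ?_, fun x => ?_, ?_⟩
    · simp only [Polynomial.eval_add]
      rw [dslope_add p.differentiable q.differentiable, h1, h1']
    · rw [polyX_add, map_add, ← h2, ← h2', Polynomial.eval_add, Polynomial.eval_add]
      push_cast
      ring
    · rw [polyX_add, map_add, map_add, map_add, h3, h3', polyX_add, polyX_add, map_add, map_add]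
      ring
  | monomial n c =>
    set w : ℕ → ℂ := fun b => ψ (monomial [i] ^ b) with hw
    have hsum : ∀ (s : Finset ℕ) (F : ℕ → Polynomial ℝ),
        polyX i (∑ a ∈ s, F a) = ∑ a ∈ s, polyX i (F a) := fun s F => by
      simp [polyX, Polynomial.map_sum]
    -- Applying ψ to the second leg leaves a polynomial in the first variable with complex
    -- coefficients. Its real and imaginary parts are g and g', because `polyX` takes real
    -- polynomials.
    refine ⟨∑ a ∈ Finset.range n, Polynomial.C (c * (w (n - 1 - a)).re) * Polynomial.X ^ a,
      ∑ a ∈ Finset.range n, Polynomial.C (c * (w (n - 1 - a)).im) * Polynomial.X ^ a,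
      fun x => ∑ a ∈ Finset.range n, Polynomial.C (c * x ^ a) * Polynomial.X ^ (n - 1 - a),
      fun x y => ?_, fun x => ?_, ?_⟩
    · simp only [Polynomial.eval_monomial, dslope_const_mul_pow]
      simp only [Polynomial.eval_finsetSum, Polynomial.eval_mul, Polynomial.eval_C,
        Polynomial.eval_pow, Polynomial.eval_X, Finset.mul_sum, mul_assoc]
    · simp only [hsum, map_sum, polyX_C_mul_X_pow, map_smul, Polynomial.eval_finsetSum,
        Polynomial.eval_mul, Polynomial.eval_C, Polynomial.eval_pow, Polynomial.eval_X,
        Complex.ofReal_sum, Finset.mul_sum, smul_eq_mul]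
      rw [← Finset.sum_add_distrib]
      refine Finset.sum_congr rfl fun a _ => ?_
      change _ = _ * w (n - 1 - a)
      conv_rhs => rw [← Complex.re_add_im (w (n - 1 - a))]
      push_cast
      ring
    · rw [← Polynomial.C_mul_X_pow_eq_monomial]
      simp only [hsum, map_sum, polyX_C_mul_X_pow, map_smul, polyDeriv_pow, polyDeriv_X, if_true,
        mul_one, Algebra.TensorProduct.tmul_mul_tmul, one_mul, TensorProduct.map_tmul,
        LinearMap.mul'_apply, Finset.mul_sum, smul_eq_mul]
      rw [← Finset.sum_add_distrib]
      refine Finset.sum_congr rfl fun a _ => ?_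
      change _ * (_ * w (n - 1 - a)) = _
      conv_lhs => rw [← Complex.re_add_im (w (n - 1 - a))]
      push_cast
      ring

/-- The tensor is contracted one leg at a time. For fixed x the difference quotient is a function of
X_i bounded by L, which bounds the contraction with ψ for each x in [-R, R]. That contraction is in
turn a bounded function of X_i for φ. The factor 2 accounts for real and imaginary parts. -/
theorem norm_tensorSq_polyDeriv_polyX_le (hτ : IsNCLaw τ) {i : Fin ℓ} {m : Measure ℝ}
    (hm : IsSpectralDistribution τ i m) {R L : ℝ} (hR : ∀ᵐ x : ℝ ∂m, |x| ≤ R) (hL : 0 ≤ L)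
    {p : Polynomial ℝ} (hp : ∀ x, |x| ≤ R → |p.derivative.eval x| ≤ L) (P P' Q Q' : NCPoly ℓ) :
    ‖tensorSq τ (((P * P') ⊗ₜ 1) * polyDeriv i (polyX i p) * (1 ⊗ₜ (Q * Q')))‖ ≤
      2 * L * (norm₂ τ (polyElt P) * norm₂ τ (polyElt P') *
        (norm₂ τ (polyElt Q) * norm₂ τ (polyElt Q'))) := by
  set φ : NCPoly ℓ →ₗ[ℂ] ℂ := τ ∘ₗ polyElt.toLinearMap ∘ₗ LinearMap.mulLeft ℂ (P * P') with hφ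
  set ψ : NCPoly ℓ →ₗ[ℂ] ℂ := τ ∘ₗ polyElt.toLinearMap ∘ₗ LinearMap.mulRight ℂ (Q * Q') with hψ
  have e : ∀ T : NCPoly ℓ ⊗[ℂ] NCPoly ℓ, tensorSq τ (((P * P') ⊗ₜ 1) * T * (1 ⊗ₜ (Q * Q'))) =
      LinearMap.mul' ℂ ℂ (TensorProduct.map φ ψ T) := by
    intro T
    induction T with
    | zero => simp
    | add S T hS hT => rw [mul_add, add_mul, map_add, hS, hT, map_add, map_add]
    | tmul u v =>
      rw [Algebra.TensorProduct.tmul_mul_tmul, Algebra.TensorProduct.tmul_mul_tmul, one_mul,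
        mul_one, tensorSq_tmul]
      rfl
  set q := norm₂ τ (polyElt Q) * norm₂ τ (polyElt Q') with hq
  have hq0 : 0 ≤ q := mul_nonneg (norm₂_nonneg _) (norm₂_nonneg _)
  obtain ⟨g, g', f, h1, h2, h3⟩ := exists_contract_polyDeriv_polyX i φ ψ p
  have hψb : ∀ x, |x| ≤ R → ‖ψ (polyX i (f x))‖ ≤ L * q := by
    intro x hx
    have hb : IsBoundedBy τ (polyElt (polyX i (f x))) L := by
      rw [polyElt_polyX]
      refine hm.isBoundedBy hτ hR hL _ fun y hy => ?_
      rw [h1]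
      exact abs_dslope_le p.differentiable (fun t ht => by
        rw [Polynomial.deriv]
        exact hp t ht) hx hy
    change ‖τ (polyElt (polyX i (f x) * (Q * Q')))‖ ≤ _
    rw [map_mul polyElt, map_mul polyElt, ← mul_assoc, hq, ← mul_assoc]
    exact (hτ.norm_mul_le _ _).trans (mul_le_mul_of_nonneg_right (hb.2 _) (norm₂_nonneg _))
  have hφb : ∀ k : Polynomial ℝ, (∀ x, |x| ≤ R → |k.eval x| ≤ L * q) →
      ‖φ (polyX i k)‖ ≤ norm₂ τ (polyElt P) * ((L * q) * norm₂ τ (polyElt P')) := by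
    intro k hk
    have hb : IsBoundedBy τ (polyElt (polyX i k)) (L * q) := by
      rw [polyElt_polyX]
      exact hm.isBoundedBy hτ hR (by positivity) _ hk
    change ‖τ (polyElt (P * P' * polyX i k))‖ ≤ _
    rw [mul_assoc, map_mul polyElt, map_mul polyElt]
    exact (hτ.norm_mul_le _ _).trans
      (mul_le_mul_of_nonneg_left (hb.right hτ _) (norm₂_nonneg _))
  have hre : ∀ x, g.eval x = (ψ (polyX i (f x))).re ∧ g'.eval x = (ψ (polyX i (f x))).im := by
    intro x
    rw [← h2]
    simp
  have i1 := hφb g fun x hx => by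
    rw [(hre x).1]
    exact (Complex.abs_re_le_norm _).trans (hψb x hx)
  have i2 := hφb g' fun x hx => by
    rw [(hre x).2]
    exact (Complex.abs_im_le_norm _).trans (hψb x hx)
  rw [e, h3]
  refine (norm_add_le _ _).trans ?_
  rw [norm_mul, Complex.norm_I, one_mul]
  calc _ ≤ _ := add_le_add i1 i2
    _ = _ := by ring

/-! ### Concentration near the critical points -/

/-- A sequence subject to a quartic recursion decays geometrically in the inverse temperature. -/
theorem geometric_bound_of_quartic {α : ℕ → ℝ} (hα : ∀ j, 0 ≤ α j) (h0 : α 0 = 1) {β C C' K : ℝ}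
    (hβ : 1 ≤ β) (hC : 0 ≤ C) (hC' : 0 ≤ C') (hK : 0 < K)
    (hKβ : β * K ^ 2 = 4 * (C ^ 2 + 64 * C'))
    (hrec : ∀ k, 1 ≤ k → β * α k ^ 2 ≤ C * (α (k - 1) * α k) +
      C' * ∑ a ∈ Finset.range (2 * k - 1), α (a / 2) * α ((a + 1) / 2) *
        (α ((2 * k - 2 - a) / 2) * α ((2 * k - 2 - a + 1) / 2))) (k : ℕ) :
    α k ≤ K ^ k / ((k : ℝ) + 1) := by
  induction k using Nat.strong_induction_on with
  | _ k ih =>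
    rcases k with _ | n
    · simp [h0]
    have h1 := hrec (n + 1) (by omega)
    -- The two halves of a are nearly equal, so the product of their weights is at most 4/(a + 1)²,
    -- again a weight stable under convolution.
    have hpair : ∀ a, (a + 1) / 2 < n + 1 → α (a / 2) * α ((a + 1) / 2) ≤
        K ^ a * (4 * (1 / ((a : ℝ) + 1) ^ 2)) := by
      intro a ha
      have i1 := ih (a / 2) (by omega)
      have i2 := ih ((a + 1) / 2) ha
      refine (mul_le_mul i1 i2 (hα _) ((hα _).trans i1)).trans ?_
      rw [div_mul_div_comm, ← pow_add, show a / 2 + (a + 1) / 2 = a by omega, ← mul_div_assoc,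
        mul_one, div_eq_mul_one_div]
      refine mul_le_mul_of_nonneg_left ?_ (by positivity)
      rw [div_le_div_iff₀ (by positivity) (by positivity)]
      have e1 : (a : ℝ) = (a / 2 : ℕ) + ((a + 1) / 2 : ℕ) := by
        exact_mod_cast (show a = a / 2 + (a + 1) / 2 by omega)
      have e2 : (((a + 1) / 2 : ℕ) : ℝ) ≤ (a / 2 : ℕ) + 1 := by
        exact_mod_cast (show (a + 1) / 2 ≤ a / 2 + 1 by omega)
      have e3 : ((a / 2 : ℕ) : ℝ) ≤ ((a + 1) / 2 : ℕ) := by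
        exact_mod_cast (show a / 2 ≤ (a + 1) / 2 by omega)
      rw [e1]
      have : (0 : ℝ) ≤ (a / 2 : ℕ) := Nat.cast_nonneg _
      nlinarith
    have hsum : ∑ a ∈ Finset.range (2 * (n + 1) - 1), α (a / 2) * α ((a + 1) / 2) *
        (α ((2 * (n + 1) - 2 - a) / 2) * α ((2 * (n + 1) - 2 - a + 1) / 2)) ≤
        (K ^ n) ^ 2 * (32 / ((n : ℝ) + 1) ^ 2) := by
      have h2 : ∀ a ∈ Finset.range (2 * n + 1), α (a / 2) * α ((a + 1) / 2) *
          (α ((2 * (n + 1) - 2 - a) / 2) * α ((2 * (n + 1) - 2 - a + 1) / 2)) ≤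
          16 * (K ^ n) ^ 2 *
            (1 / ((a : ℝ) + 1) ^ 2 * (1 / (((2 * n - a : ℕ) : ℝ) + 1) ^ 2)) := by
        intro a ha
        rw [Finset.mem_range] at ha
        have i1 := hpair a (by omega)
        have i2 := hpair (2 * n - a) (by omega)
        rw [show 2 * (n + 1) - 2 - a = 2 * n - a by omega]
        refine (mul_le_mul i1 i2 (mul_nonneg (hα _) (hα _))
          ((mul_nonneg (hα _) (hα _)).trans i1)).trans (le_of_eq ?_)
        have : (K ^ n) ^ 2 = K ^ a * K ^ (2 * n - a) := by
          rw [← pow_mul, ← pow_add]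
          congr 1
          omega
        rw [this]
        ring
      rw [show 2 * (n + 1) - 1 = 2 * n + 1 by omega]
      refine (Finset.sum_le_sum h2).trans ?_
      rw [← Finset.mul_sum]
      refine (mul_le_mul_of_nonneg_left (sum_convolution_le (2 * n)) (by positivity)).trans
        (le_of_eq ?_)
      rw [show ((2 * n : ℕ) : ℝ) + 2 = 2 * ((n : ℝ) + 1) by push_cast; ring, mul_pow]
      field_simp
      norm_num
    set s := (n : ℝ) + 1 with hs
    have hs1 : 1 ≤ s := by linarith [n.cast_nonneg (α := ℝ)]
    have hs0 : 0 < s := by linarith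
    have hn := ih n (by omega)
    rw [Nat.add_sub_cancel] at h1
    -- In this normalization the recursion becomes a quadratic inequality for x with coefficients
    -- independent of n.
    set x := α (n + 1) * s / K ^ n with hx
    have hx0 : 0 ≤ x := by have := hα (n + 1); positivity
    have hKn : 0 < K ^ n := by positivity
    have hαx : α (n + 1) = x * K ^ n / s := by rw [hx]; field_simp
    have h3 : β * x ^ 2 ≤ C * x + 32 * C' := by
      have h4 : β * α (n + 1) ^ 2 ≤ C * (K ^ n / s * α (n + 1)) +
          C' * ((K ^ n) ^ 2 * (32 / s ^ 2)) := by
        refine h1.trans (add_le_add ?_ (mul_le_mul_of_nonneg_left hsum hC'))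
        exact mul_le_mul_of_nonneg_left (mul_le_mul_of_nonneg_right hn (hα _)) hC
      rw [hαx] at h4
      have h5 : (K ^ n / s) ^ 2 * (β * x ^ 2) ≤ (K ^ n / s) ^ 2 * (C * x + 32 * C') := by
        generalize K ^ n = y at h4 ⊢
        have e1 : (y / s) ^ 2 * (β * x ^ 2) = β * (x * y / s) ^ 2 := by ring
        have e2 : (y / s) ^ 2 * (C * x + 32 * C') =
            C * (y / s * (x * y / s)) + C' * (y ^ 2 * (32 / s ^ 2)) := by
          rw [div_pow]
          field_simp
        rw [e1, e2]
        exact h4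
      exact le_of_mul_le_mul_left h5 (by positivity)
    -- The linear term is absorbed using β ≥ 1, and the choice of K makes the remainder exactly β
    -- (K/2)². The spare factor 1/2 pays for passing from the weight 1/s to 1/(s + 1).
    have h6 : x ≤ K / 2 := by
      refine le_of_sq_le_sq ?_ (by positivity)
      refine le_of_mul_le_mul_left (a := β) ?_ (by linarith)
      have h7 : C * x ≤ β * x ^ 2 / 2 + C ^ 2 / 2 := by
        nlinarith [sq_nonneg (x - C), sq_nonneg x]
      calc β * x ^ 2 ≤ C ^ 2 + 64 * C' := by linarith
        _ = β * (K / 2) ^ 2 := by rw [div_pow]; linarith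
    rw [hαx, pow_succ]
    push_cast
    rw [← hs, div_le_div_iff₀ hs0 (by linarith)]
    have h8 : s + 1 ≤ 2 * s := by linarith
    calc x * K ^ n * (s + 1) ≤ K / 2 * K ^ n * (2 * s) := by gcongr
      _ = _ := by ring

/-- A self-adjoint polynomial `q` that is nearly proportional to a force in the Dyson–Schwinger
equations is bounded by the inverse square root of the proportionality constant. -/
theorem isBoundedBy_of_dysonSchwinger (hτ : IsNCLaw τ) {i : Fin ℓ} {Q : NCPoly ℓ}
    (hQ : star (polyElt Q) = polyElt Q) {b : smoothAlg ℓ} {β C C' : ℝ} (hβ : 1 ≤ β)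
    (hC : 0 < C) (hC' : 0 ≤ C') (hb : IsBoundedBy τ b C)
    (hT : ∀ P P' P'' P''' : NCPoly ℓ,
      ‖tensorSq τ (((P * P') ⊗ₜ 1) * polyDeriv i Q * (1 ⊗ₜ (P'' * P''')))‖ ≤
        C' * (norm₂ τ (polyElt P) * norm₂ τ (polyElt P') *
          (norm₂ τ (polyElt P'') * norm₂ τ (polyElt P'''))))
    (hD : ∀ P, τ (((β : ℂ) • polyElt Q + b) * polyElt P) = tensorSq τ (polyDeriv i P)) :
    IsBoundedBy τ (polyElt Q) (Real.sqrt (4 * (C ^ 2 + 64 * C') / β)) := by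
  set K := Real.sqrt (4 * (C ^ 2 + 64 * C') / β) with hK
  have hβ0 : 0 < β := by linarith
  have hK0 : 0 < K := Real.sqrt_pos.mpr (by positivity)
  have hKβ : β * K ^ 2 = 4 * (C ^ 2 + 64 * C') := by
    rw [hK, Real.sq_sqrt (by positivity), mul_div_cancel₀ _ hβ0.ne']
  set α : ℕ → ℝ := fun j => norm₂ τ (polyElt (Q ^ j)) with hα
  have hα0 : ∀ j, 0 ≤ α j := fun j => norm₂_nonneg _
  have hαsq : ∀ n, α n ^ 2 = (τ (polyElt Q ^ (2 * n))).re := fun n => by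
    rw [hα, hτ.norm₂_sq, map_pow, star_pow, hQ, ← pow_add, two_mul]
  have hrec : ∀ k, 1 ≤ k → β * α k ^ 2 ≤ C * (α (k - 1) * α k) +
      C' * ∑ a ∈ Finset.range (2 * k - 1), α (a / 2) * α ((a + 1) / 2) *
        (α ((2 * k - 2 - a) / 2) * α ((2 * k - 2 - a + 1) / 2)) := by
    intro k hk
    -- With this odd power the main term is β τ(Q^{2k}), which is β α k².
    have h1 := hD (Q ^ (2 * k - 1))
    have hsplit : polyElt Q ^ (2 * k - 1) = polyElt (Q ^ k) * polyElt (Q ^ (k - 1)) := by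
      rw [map_pow, map_pow, ← pow_add]
      congr 1
      omega
    rw [add_mul, smul_mul_assoc, map_add, map_smul, map_pow, ← pow_succ',
      show 2 * k - 1 + 1 = 2 * k by omega, smul_eq_mul, hsplit] at h1
    have h2 : β * α k ^ 2 = (tensorSq τ (polyDeriv i (Q ^ (2 * k - 1)))).re -
        (τ (b * (polyElt (Q ^ k) * polyElt (Q ^ (k - 1))))).re := by
      rw [← h1, Complex.add_re, Complex.re_ofReal_mul, hαsq]
      ring
    have h3 : ‖τ (b * (polyElt (Q ^ k) * polyElt (Q ^ (k - 1))))‖ ≤ C * (α (k - 1) * α k) := by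
      rw [← mul_assoc]
      refine (hτ.norm_mul_le _ _).trans ((mul_le_mul_of_nonneg_right (hb.2 _)
        (norm₂_nonneg _)).trans (le_of_eq ?_))
      change C * α k * α (k - 1) = _
      ring
    have h4 : ‖tensorSq τ (polyDeriv i (Q ^ (2 * k - 1)))‖ ≤
        C' * ∑ a ∈ Finset.range (2 * k - 1), α (a / 2) * α ((a + 1) / 2) *
          (α ((2 * k - 2 - a) / 2) * α ((2 * k - 2 - a + 1) / 2)) := by
      rw [polyDeriv_pow, map_sum, Finset.mul_sum]
      refine norm_sum_le_of_le _ fun a _ => ?_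
      rw [show 2 * k - 1 - 1 - a = 2 * k - 2 - a by omega]
      set c := 2 * k - 2 - a
      -- Splitting each power into halves leaves only L² norms of powers of Q with exponent at most
      -- k - 1, because a and c are at most 2k - 2.
      have hhalf : ∀ n : ℕ, Q ^ n = Q ^ (n / 2) * Q ^ ((n + 1) / 2) := fun n => by
        rw [← pow_add]
        congr 1
        omega
      rw [hhalf a, hhalf c]
      exact hT _ _ _ _
    have h5 := (Complex.re_le_norm (tensorSq τ (polyDeriv i (Q ^ (2 * k - 1))))).trans h4
    have h6 := (neg_le_abs _).trans ((Complex.abs_re_le_norm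
      (τ (b * (polyElt (Q ^ k) * polyElt (Q ^ (k - 1)))))).trans h3)
    linarith
  have hα1 : α 0 = 1 := by
    rw [hα]
    simp only [pow_zero, map_one]
    exact hτ.norm₂_one
  refine isBoundedBy_of_moments (M := 1) hτ hQ hK0.le fun n => ?_
  rw [← hαsq, one_mul, mul_comm 2 n, pow_mul]
  have h1 := geometric_bound_of_quartic hα0 hα1 hβ hC.le hC' hK0 hKβ hrec n
  exact pow_le_pow_left₀ (hα0 n) (h1.trans (div_le_self (by positivity)
    (by linarith [n.cast_nonneg (α := ℝ)]))) 2

/-- Limit points for `β U + W` concentrate near the critical points of `U`. -/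
theorem exists_concentration (U W : NCSmooth ℓ) (i : Fin ℓ) (R : ℝ) : ∃ B : ℝ, 0 ≤ B ∧
    ∀ β : ℝ, 1 ≤ β → U.IsSelfAdj → ∀ τ : smoothAlg ℓ →ₗ[ℂ] ℂ, IsNCLaw τ →
      (∃ m, IsSpectralDistribution τ i m) → (∀ j, IsBoundedBy τ (coord j) R) →
      (∀ P, τ ((β • U + W).cyclicDeriv i * polyElt P) = tensorSq τ (polyDeriv i P)) →
      ∀ k : ℕ, (τ ((star (U.cyclicDeriv i) * U.cyclicDeriv i) ^ k)).re ≤ (B / β) ^ k := by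
  have hU := (contDiff_infty_iff_deriv.mp (U.contDiff i)).2
  have hW := (contDiff_infty_iff_deriv.mp (W.contDiff i)).2
  have hU1 : ContDiff ℝ 1 (deriv (U.smooth i)) := hU.of_le (by norm_cast)
  obtain ⟨C₀, hC₀, hT₀⟩ := exists_norm_tensorSq_le (polyDeriv i (polyCyclicDeriv i U.poly)) R
  obtain ⟨C₁, hC₁, hP₁⟩ := exists_isBoundedBy_polyElt (polyCyclicDeriv i W.poly) R
  obtain ⟨C₂, hC₂⟩ := (isCompact_Icc (a := -R) (b := R)).exists_bound_of_continuousOn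
    hW.continuous.continuousOn
  obtain ⟨L, hL⟩ := (isCompact_Icc (a := -R) (b := R)).exists_bound_of_continuousOn
    (hU1.continuous_deriv le_rfl).continuousOn
  -- The last 1 bounds β times the error made in replacing 𝒟_i U by a polynomial. The 1 in the
  -- definition of C' below bounds the error in the derivative.
  set C := C₁ + |C₂| + 1 with hC
  set C' := C₀ + 2 * (|L| + 1) with hC'
  have hC0 : 0 < C := by positivity
  have hC'0 : 0 ≤ C' := by positivity
  set B := 4 * (C ^ 2 + 64 * C') with hB
  refine ⟨(Real.sqrt B + 1) ^ 2, sq_nonneg _, fun β hβ hUs τ hτ hm hR hD k => ?_⟩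
  obtain ⟨m, hm⟩ := hm
  have hβ0 : 0 < β := by linarith
  have hRm := hm.ae_abs_le hτ (hR i)
  -- The precision 1/β is the coarsest for which β times the error can be moved into the bounded
  -- part of the force, uniformly in β.
  obtain ⟨p, hp⟩ := exists_polynomial_near_deriv hU1 R (ε := 1 / β) (by positivity)
  set Q := polyCyclicDeriv i U.poly + polyX i p with hQ
  set g := smoothElt i (fun x => p.eval x - deriv (U.smooth i) x)
    ((contDiff_polynomial p).sub hU) with hg
  have hgb : IsBoundedBy τ g (1 / β) :=
    hm.isBoundedBy hτ hRm (by positivity) _ fun x hx => (hp x hx).1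
  have hQD : polyElt Q = U.cyclicDeriv i + g := by
    rw [hQ, map_add, polyElt_polyX, hg, smoothElt_sub i (contDiff_polynomial p) hU,
      NCSmooth.cyclicDeriv]
    abel
  have hQs : star (polyElt Q) = polyElt Q := by
    rw [hQD, star_add, hUs.star_cyclicDeriv, hg, star_smoothElt]
  have hWb : IsBoundedBy τ (W.cyclicDeriv i) (C₁ + |C₂|) :=
    (hP₁ τ hτ hR).add hτ (hm.isBoundedBy hτ hRm (abs_nonneg _) hW fun x hx =>
      (hC₂ x (abs_le.mp hx)).trans (le_abs_self _))
  have hbb : IsBoundedBy τ (W.cyclicDeriv i + (-β : ℂ) • g) C := by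
    refine hWb.add hτ ((hgb.smul (-β : ℂ)).mono (le_of_eq ?_))
    rw [norm_neg, Complex.norm_real, Real.norm_of_nonneg hβ0.le, mul_one_div_cancel hβ0.ne']
  have hQb : IsBoundedBy τ (polyElt Q) (Real.sqrt (B / β)) := by
    refine isBoundedBy_of_dysonSchwinger (i := i) hτ hQs hβ hC0 hC'0 hbb
      (fun P P' P'' P''' => ?_) fun P => ?_
    · rw [hQ, map_add, mul_add, add_mul, map_add, hC', add_mul]
      refine (norm_add_le _ _).trans (add_le_add (hT₀ τ hτ hR P P' P'' P''') ?_)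
      refine norm_tensorSq_polyDeriv_polyX_le hτ hm hRm (by positivity) (fun x hx => ?_) _ _ _ _
      have h1 := (hp x hx).2
      have h2 := hL x (abs_le.mp hx)
      have h3 : 1 / β ≤ 1 := (div_le_one hβ0).mpr hβ
      have h4 := abs_sub_abs_le_abs_sub (p.derivative.eval x) (deriv (deriv (U.smooth i)) x)
      rw [Real.norm_eq_abs] at h2
      linarith [le_abs_self L]
    · rw [← hD P, NCSmooth.cyclicDeriv_smul_add]
      congr 2
      rw [hQD, smul_add, neg_smul]
      abel
  have hDb : IsBoundedBy τ (U.cyclicDeriv i) (Real.sqrt (B / β) + 1 / β) := by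
    have h1 := hQb.add hτ (hgb.smul (-1))
    rwa [hQD, neg_smul, one_smul, add_neg_cancel_right, norm_neg, norm_one, one_mul] at h1
  rw [hUs.star_cyclicDeriv]
  refine (Complex.re_le_norm _).trans ((((hDb.mul hDb).pow k).norm_le hτ).trans ?_)
  refine pow_le_pow_left₀ (mul_self_nonneg _) ?_ k
  -- Returning from Q to 𝒟_i U costs 1/β, which is of lower order than the bound itself. Hence the
  -- constant (√B + 1)² in place of B.
  have h1 : 1 / β ≤ 1 / Real.sqrt β := by
    refine one_div_le_one_div_of_le (Real.sqrt_pos.mpr hβ0) ?_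
    rw [Real.sqrt_le_left hβ0.le]
    nlinarith
  have h2 : Real.sqrt (B / β) + 1 / β ≤ (Real.sqrt B + 1) / Real.sqrt β := by
    rw [Real.sqrt_div' _ hβ0.le, add_div]
    exact add_le_add le_rfl h1
  have h3 : 0 ≤ Real.sqrt (B / β) + 1 / β := by positivity
  calc _ ≤ ((Real.sqrt B + 1) / Real.sqrt β) * ((Real.sqrt B + 1) / Real.sqrt β) :=
        mul_le_mul h2 h2 h3 (h3.trans h2)
    _ = _ := by rw [div_mul_div_comm, Real.mul_self_sqrt hβ0.le, ← pow_two]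

end MatrixModel
end
theorem theorem2p6 (ℓ : ℕ) :
    -- limit points satisfy the Dyson–Schwinger equations
    (∀ (V : NCSmooth ℓ) (η A : ℝ) (I : Finpartition (Finset.univ : Finset (Fin ℓ))),
      0 < η → IsTrapping η A I V →
      ∀ (Ω : Type*) [MeasurableSpace Ω] (μ : Measure Ω) [IsProbabilityMeasure μ]
        (X : (N : ℕ) → Ω → HermTuple ℓ N),
        (∀ N, 1 ≤ N → HasLaw (X N) (gibbs N V) μ) →
        ∀ᵐ ω ∂μ, ∀ τ : smoothAlg ℓ →ₗ[ℂ] ℂ,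
          IsLimitPoint (fun N => X N ω) τ → DysonSchwinger V τ) ∧
    -- limit points for `β U + W` concentrate on the critical points of `U`
    (∀ (U W : NCSmooth ℓ) (η A : ℝ), 0 < η →
      ∃ B : ℝ, ∀ I : Finpartition (Finset.univ : Finset (Fin ℓ)),
        IsTrapping η A I U → IsTrapping η A I W →
        ∃ β₀ : ℝ, 0 < β₀ ∧ ∀ β : ℝ, β₀ ≤ β →
          ∀ (Ω : Type*) [MeasurableSpace Ω] (μ : Measure Ω) [IsProbabilityMeasure μ]
            (X : (N : ℕ) → Ω → HermTuple ℓ N),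
            (∀ N, 1 ≤ N → HasLaw (X N) (gibbs N (β • U + W)) μ) →
            ∀ᵐ ω ∂μ, ∀ τ : smoothAlg ℓ →ₗ[ℂ] ℂ,
              IsLimitPoint (fun N => X N ω) τ →
              ∀ (i : Fin ℓ) (k : ℕ),
                (τ ((star (U.cyclicDeriv i) * U.cyclicDeriv i) ^ k)).re ≤ (B / β) ^ k) := by
  refine ⟨fun V η A I _ hV Ω _ μ _ X hX => ?_, fun U W η A hη => ?_⟩
  · filter_upwards [ae_tendsto_defect hV.2.1 hX] with ξ hξ τ hτ
    obtain ⟨𝒰, h⟩ := hτ.exists_isLimitAlong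
    exact h.dysonSchwinger hξ
  · obtain ⟨R, hR⟩ := exists_isBoundedBy_coord ℓ hη A
    choose B hB0 hB using fun i => exists_concentration U W i R
    -- The radius R and the constants B i are fixed before the partition. Their sum serves all i at
    -- once, and β₀ = 1 suffices.
    refine ⟨∑ i, B i, fun I hU hW => ⟨1, one_pos, fun β hβ Ω _ μ _ X hX => ?_⟩⟩
    filter_upwards [ae_tendsto_defect (hU.2.1.smul_add hW.2.1 β) hX] with ξ hξ τ hτ i k
    obtain ⟨𝒰, h⟩ := hτ.exists_isLimitAlong
    have hD := h.dysonSchwinger_poly hξ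
    refine (hB i β hβ hU.2.1 τ h.law (h.exists_isSpectralDistribution i)
      (hR I U W hU hW β (by linarith) _ 𝒰 τ h hD) (hD i) k).trans ?_
    have h1 : B i ≤ ∑ i, B i :=
      Finset.single_le_sum (f := B) (fun j _ => hB0 j) (Finset.mem_univ i)
    have h2 := hB0 i
    gcongr
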